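/- \textbf{Setting.} Let $\Bbbk$ be an algebraically closed field; all categories and functors are $\Bbbk$-linear. A \emph{finite Abelian category} is one equivalent to the category of finite-dimensional modules over a finite-dimensional $\Bbbk$-algebra. A \emph{locally finite Abelian category} is an essentially small Abelian category in which all objects have finite length and all morphism spaces are finite-dimensional. Let $\mathcal R$ be of one of these two types. A \emph{stratification} of $\mathcal R$ is a function $\rho:\mathbf B\to\Lambda$ with finite fibres, where $\Lambda$ is a poset all of whose intervals $[\lambda,\mu]$ are finite and $\mathbf B$ indexes representatives $L(b)$ $(b\in\mathbf B)$ of the isomorphism classes of irreducible objects, such that for each $\lambda\in\Lambda$ the Serre subcategory $\mathcal R_{\le\lambda}$ of all $V\in\mathcal R$ whose composition factors are of the form $L(c)$ with $\rho(c)\le\lambda$ has enough projectives and enough injectives. Let $\mathcal R_{<\lambda}\subseteq\mathcal R_{\le\lambda}$ be defined in the same way with $\rho(c)<\lambda$, let $j^\lambda:\mathcal R_{\le\lambda}\to\mathcal R_\lambda:=\mathcal R_{\le\lambda}/\mathcal R_{<\lambda}$ be the Serre quotient functor, and let $j^\lambda_!$ and $j^\lambda_*$ be its left and right adjoints. For $b\in\mathbf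 B$ with $\rho(b)=\lambda$ let $L_\lambda(b):=j^\lambda L(b)$, let $P_\lambda(b)$ and $I_\lambda(b)$ be a projective cover and an injective hull of $L_\lambda(b)$ in $\mathcal R_\lambda$, and for a sign function $\varepsilon:\Lambda\to\{\pm\}$ put $$\Delta_\varepsilon(b):=\begin{cases} j^\lambda_!P_\lambda(b)&\text{if }\varepsilon(\lambda)=+\\ j^\lambda_!L_\lambda(b)&\text{if }\varepsilon(\lambda)=-\end{cases}\qquad \nabla_\varepsilon(b):=\begin{cases} j^\lambda_*L_\lambda(b)&\text{if }\varepsilon(\lambda)=+\\ j^\lambda_*I_\lambda(b)&\text{if }\varepsilon(\lambda)=-.\end{cases}$$ A \emph{$\Delta_\varepsilon$-flag} (resp.\ \emph{$\nabla_\varepsilon$-flag}) of $V\in\mathcal R$ is a finite filtration $0=V_0<V_1<\dots<V_n=V$ each of whose sections $V_m/V_{m-1}$ is isomorphic to some $\Delta_\varepsilon(c)$ (resp.\ $\nabla_\varepsilon(c)$); its bottom section is $V_1/V_0$ and its top section is $V_n/V_{n-1}$. $\mathcal R$ is a \emph{finite $\varepsilon$-stratified category} if it is finite Abelian, is equipped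 with a stratification, and has one of the following two (equivalent) properties: for each $b\in\mathbf B$ there is a projective object with a $\Delta_\varepsilon$-flag with top section $\Delta_\varepsilon(b)$ and other sections $\Delta_\varepsilon(c)$ with $\rho(c)\ge\rho(b)$; or for each $b\in\mathbf B$ there is an injective object with a $\nabla_\varepsilon$-flag with bottom section $\nabla_\varepsilon(b)$ and other sections $\nabla_\varepsilon(c)$ with $\rho(c)\ge\rho(b)$. $\mathcal R$ is a \emph{lower finite $\varepsilon$-stratified category} if it is locally finite Abelian, is equipped with a stratification such that $\{\mu\in\Lambda:\mu\le\lambda\}$ is finite for all $\lambda\in\Lambda$, and for each $b\in\mathbf B$ there is a finitely cogenerated injective object of the ind-completion $\operatorname{Ind}(\mathcal R)$ which is the sum of a non-empty directed family of subobjects, each of which belongs to $\mathcal R$ and has a $\nabla_\varepsilon$-flag with bottom section $\nabla_\varepsilon(b)$ and other sections $\nabla_\varepsilon(c)$ with $\rho(c)\ge\rho(b)$. An \emph{$\varepsilon$-tilting object} is an object of $\mathcal R$ which has both a $\Delta_\varepsilon$-flag and a $\nabla_\varepsilon$-flag. \textbf{Theorem.} Let $\mathcal R$ be a finite or lower finite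 $\varepsilon$-stratified category, let $b\in\mathbf B$ and $\lambda:=\rho(b)$. There is an indecomposable $\varepsilon$-tilting object $T_\varepsilon(b)\in\mathcal R$ such that (i) $T_\varepsilon(b)$ has a $\Delta_\varepsilon$-flag with bottom section isomorphic to $\Delta_\varepsilon(b)$; (ii) $T_\varepsilon(b)$ has a $\nabla_\varepsilon$-flag with top section isomorphic to $\nabla_\varepsilon(b)$; (iii) $T_\varepsilon(b)\in\mathcal R_{\le\lambda}$, and $j^\lambda T_\varepsilon(b)$ is isomorphic to $P_\lambda(b)$ if $\varepsilon(\lambda)=+$ and to $I_\lambda(b)$ if $\varepsilon(\lambda)=-$. Moreover, if $U$ is any indecomposable $\varepsilon$-tilting object satisfying at least one of the properties (i), (ii), (iii), then $U\cong T_\varepsilon(b)$, and hence $U$ satisfies all three of them. -/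

import Mathlib

open CategoryTheory CategoryTheory.Limits
open scoped ZeroObject

universe w v u uB uL uk

namespace EpsStrat

/-! ### Finiteness properties of abelian categories -/

section Finiteness

variable (k : Type uk) [Field k] (R : Type u) [Category.{v} R] [Abelian R] [Linear k R]

/-- A finite abelian category: it is `k`-linearly equivalent to the category of finite-dimensional
left modules over a finite-dimensional `k`-algebra `A`.  (Over such an algebra, an `A`-module is
finite-dimensional if and only if it is finitely generated.) -/
def IsFiniteAbelian : Prop :=
  ∃ (A : Type uk) (_ : Ring A) (_ : Algebra k A) (_ : Module.Finite k A)
    (e : R ≌ FGModuleCat.{uk} A), Functor.Linear k e.functor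

/-- A locally finite abelian category: all objects have finite length (i.e. are both noetherian
and artinian) and all morphism spaces are finite-dimensional.  (Essential smallness is a
separate hypothesis, because it depends on a universe.) -/
structure IsLocallyFiniteAbelian : Prop where
  noetherian : ∀ V : R, IsNoetherianObject V
  artinian : ∀ V : R, IsArtinianObject V
  finite_hom : ∀ V W : R, Module.Finite k (V ⟶ W)

end Finiteness

/-! ### General categorical notions -/

section General

variable {C : Type u} [Category.{v} C]

/-- `P` is a projective cover of `X`: it is projective and there is an epimorphism `P ⟶ X` which
is essential (i.e. has superfluous kernel). -/
def IsProjectiveCover (P X : C) : Prop :=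
  Projective P ∧ ∃ p : P ⟶ X, Epi p ∧ ∀ (Y : C) (g : Y ⟶ P), Epi (g ≫ p) → Epi g

/-- `I` is an injective hull of `X`: it is injective and there is an essential monomorphism
`X ⟶ I`. -/
def IsInjectiveHull (I X : C) : Prop :=
  Injective I ∧ ∃ i : X ⟶ I, Mono i ∧ ∀ (Y : C) (g : I ⟶ Y), Mono (i ≫ g) → Mono g

/-- `V` is finitely cogenerated: every family of subobjects with zero intersection has a
finite subfamily with zero intersection. -/
def IsFinitelyCogenerated (V : C) : Prop :=
  ∀ (z : Subobject V), IsBot z → ∀ s : Set (Subobject V), IsGLB s z →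
    ∃ t : Set (Subobject V), t ⊆ s ∧ t.Finite ∧ IsGLB t z

variable {D : Type*} [Category* D]

/-- `X` is (isomorphic to) the value `j_! P` at `P` of a left adjoint `j_!` of `j`: there is a
universal arrow from `P` to `j`, with target `j X`. -/
def IsLeftAdjointValue (j : C ⥤ D) (P : D) (X : C) : Prop :=
  ∃ η : P ⟶ j.obj X, Nonempty (IsInitial (StructuredArrow.mk η))

/-- `X` is (isomorphic to) the value `j_* P` at `P` of a right adjoint `j_*` of `j`: there is a
universal arrow from `j` to `P`, with source `j X`. -/
def IsRightAdjointValue (j : C ⥤ D) (P : D) (X : C) : Prop :=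
  ∃ θ : j.obj X ⟶ P, Nonempty (IsTerminal (CostructuredArrow.mk θ))

variable [Abelian C] {B : Type uB}

/-- `F` is a finite filtration `0 = F₀ < F₁ < ⋯ < Fₙ = V` of `V` in which the `m`-th section
`F_{m+1} / F_m` satisfies the predicate `Φ (c m)`, for a given sequence `c` of labels. -/
structure IsFlag (Φ : B → C → Prop) (V : C) {n : ℕ} (F : Fin (n + 1) → Subobject V)
    (c : Fin n → B) : Prop where
  bot : F 0 = ⊥
  top : F (Fin.last n) = ⊤
  strict : StrictMono F
  sections : ∀ m : Fin n,
    Φ (c m) (cokernel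
      ((F m.castSucc).ofLE (F m.succ) (strict.monotone (Fin.castSucc_lt_succ (i := m)).le)))

/-- `V` has a (possibly empty) finite filtration with sections from `Φ`. -/
def HasFlag (Φ : B → C → Prop) (V : C) : Prop :=
  ∃ (n : ℕ) (F : Fin (n + 1) → Subobject V) (c : Fin n → B), IsFlag Φ V F c

/-- `V` has a non-empty finite filtration with sections from `Φ`, with the section labelled `b` at
the bottom, and such that all labels of sections satisfy `Q`. -/
def HasFlagBottom (Φ : B → C → Prop) (b : B) (Q : B → Prop) (V : C) : Prop :=
  ∃ (n : ℕ) (F : Fin (n + 1 + 1) → Subobject V) (c : Fin (n + 1) → B),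
    IsFlag Φ V F c ∧ c 0 = b ∧ ∀ m, Q (c m)

/-- `V` has a non-empty finite filtration with sections from `Φ`, with the section labelled `b` at
the top, and such that all labels of sections satisfy `Q`. -/
def HasFlagTop (Φ : B → C → Prop) (b : B) (Q : B → Prop) (V : C) : Prop :=
  ∃ (n : ℕ) (F : Fin (n + 1 + 1) → Subobject V) (c : Fin (n + 1) → B),
    IsFlag Φ V F c ∧ c (Fin.last n) = b ∧ ∀ m, Q (c m)

end General

/-! ### Irreducible objects and Serre subcategories -/

section Irreducibles

variable {R : Type u} [Category.{v} R] [Abelian R] {B : Type uB}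

/-- `X` is a subquotient of `V`.  For irreducible `X` this says that the composition
multiplicity `[V : X]` is not zero. -/
def IsCompositionFactor (X V : R) : Prop :=
  ∃ (Y : R) (i : Y ⟶ V) (p : Y ⟶ X), Mono i ∧ Epi p

variable (R B) in
/-- A family of representatives `L b`, `b : B`, for the isomorphism classes of irreducible
objects. -/
structure IrreducibleFamily where
  L : B → R
  simple : ∀ b, Simple (L b)
  inequivalent : ∀ b c, Nonempty (L b ≅ L c) → b = c
  exhaustive : ∀ X : R, Simple X → ∃ b, Nonempty (X ≅ L b)

namespace IrreducibleFamily

variable (𝓛 : IrreducibleFamily R B)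

/-- The Serre subcategory of `R` associated to a set `S` of labels, consisting of all objects `V`
such that `[V : L b] ≠ 0` implies `b ∈ S`. -/
def serre (S : Set B) : ObjectProperty R :=
  fun V ↦ ∀ b, IsCompositionFactor (𝓛.L b) V → b ∈ S

lemma serre_L (S : Set B) (b : B) (hb : b ∈ S) : 𝓛.serre S (𝓛.L b) := by
  rintro c ⟨Y, i, p, hi, hp⟩
  have := 𝓛.simple b
  have := 𝓛.simple c
  have hi0 : i ≠ 0 := by
    rintro rfl
    have hY : IsZero Y := IsZero.of_mono_eq_zero (0 : Y ⟶ 𝓛.L b) rfl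
    exact Simple.not_isZero (𝓛.L c) (IsZero.of_epi p hY)
  have : IsIso i := isIso_of_mono_of_nonzero hi0
  have hp0 : inv i ≫ p ≠ 0 := by
    intro h
    have : p = 0 := by simpa using h
    exact Simple.not_isZero (𝓛.L c) (IsZero.of_epi_eq_zero p this)
  have : IsIso (inv i ≫ p) := isIso_of_hom_simple hp0
  obtain rfl := 𝓛.inequivalent b c ⟨asIso (inv i ≫ p)⟩
  exact hb

instance (S : Set B) : (𝓛.serre S).IsSerreClass where
  exists_zero := by
    refine ⟨0, isZero_zero R, ?_⟩
    rintro b ⟨Y, i, p, hi, hp⟩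
    have := 𝓛.simple b
    exact (Simple.not_isZero (𝓛.L b)
      (IsZero.of_epi p (IsZero.of_mono i (isZero_zero R)))).elim
  prop_of_mono f _ hY := by
    rintro b ⟨Y, i, p, hi, hp⟩
    exact hY b ⟨Y, i ≫ f, p, mono_comp _ _, hp⟩
  prop_of_epi f _ hX := by
    rintro b ⟨Y, i, p, hi, hp⟩
    exact hX b ⟨pullback f i, pullback.fst f i, pullback.snd f i ≫ p, inferInstance,
      epi_comp _ _⟩
  prop_X₂_of_shortExact {S'} hS h₁ h₃ := by
    rintro b ⟨Y, i, p, hi, hp⟩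
    have := 𝓛.simple b
    have := hS.mono_f
    let q := i ≫ S'.g
    by_cases h : kernel.ι q ≫ p = 0
    · refine h₃ b ⟨Abelian.image q, Abelian.image.ι q,
        (Abelian.coimageIsoImage q).inv ≫ cokernel.desc _ p h, inferInstance, ?_⟩
      have : Epi (cokernel.desc _ p h) :=
        epi_of_epi_fac (cokernel.π_desc _ p h)
      exact epi_comp _ _
    · have hk : (kernel.ι q ≫ i) ≫ S'.g = 0 := by
        rw [Category.assoc]; exact kernel.condition q
      refine h₁ b ⟨kernel q, hS.exact.lift _ hk, kernel.ι q ≫ p, ?_, epi_of_nonzero_to_simple h⟩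
      have : Mono (hS.exact.lift _ hk ≫ S'.f) := by
        rw [hS.exact.lift_f]; infer_instance
      exact mono_of_mono _ S'.f

instance (S : Set B) : (𝓛.serre S).IsClosedUnderFiniteProducts := by
  have : (𝓛.serre S).IsClosedUnderBinaryProducts := by
    refine ⟨?_⟩
    rintro X ⟨p⟩
    have e := IsLimit.conePointUniqueUpToIso
      ((IsLimit.postcomposeHomEquiv (diagramIsoPair p.diag) _).symm p.isLimit)
      (BinaryBiproduct.isLimit (p.diag.obj ⟨.left⟩) (p.diag.obj ⟨.right⟩))
    exact (𝓛.serre S).prop_of_iso e.symm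
      ((𝓛.serre S).prop_biprod (p.prop_diag_obj _) (p.prop_diag_obj _))
  exact ObjectProperty.IsClosedUnderFiniteProducts.mk'

instance (S : Set B) : PreservesFiniteLimits (𝓛.serre S).ι := by
  have := fun (X Y : (𝓛.serre S).FullSubcategory) (f : X ⟶ Y) ↦
    (𝓛.serre S).preservesKernels_ι f
  exact Functor.preservesFiniteLimits_of_preservesKernels _

instance (S : Set B) : PreservesFiniteColimits (𝓛.serre S).ι := by
  have := fun (X Y : (𝓛.serre S).FullSubcategory) (f : X ⟶ Y) ↦
    (𝓛.serre S).preservesCokernels_ι f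
  exact Functor.preservesFiniteColimits_of_preservesCokernels _

end IrreducibleFamily

end Irreducibles

/-! ### Stratifications, standard and costandard objects -/

section Stratifications

variable (R : Type u) [Category.{v} R] [Abelian R] (B : Type uB)
  (Λ : Type uL) [PartialOrder Λ]

/-- A stratification `ρ : B → Λ` of `R`: an interval finite poset `Λ`, a set `B` indexing
representatives for the isomorphism classes of irreducible objects, and a function `ρ` with finite
fibers, such that each Serre subcategory `R_{≤ l}` has enough projectives and injectives. -/
structure Stratification extends IrreducibleFamily R B where
  rho : B → Λ
  interval_finite : ∀ l m : Λ, (Set.Icc l m).Finite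
  finite_fibers : ∀ l : Λ, {b | rho b = l}.Finite
  enough_projectives : ∀ l : Λ,
    EnoughProjectives (toIrreducibleFamily.serre {b | rho b ≤ l}).FullSubcategory
  enough_injectives : ∀ l : Λ,
    EnoughInjectives (toIrreducibleFamily.serre {b | rho b ≤ l}).FullSubcategory

/-- Signs `+` and `-`. -/
inductive Sgn where
  | plus
  | minus

end Stratifications

namespace Stratification

variable {R : Type u} [Category.{v} R] [Abelian R] {B : Type uB} {Λ : Type uL} [PartialOrder Λ]
  (S : Stratification R B Λ)

/-- The property of belonging to the Serre subcategory `R_{≤ l}` of `R`. -/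
abbrev leProp (l : Λ) : ObjectProperty R := S.serre {b | S.rho b ≤ l}

/-- The abelian category `R_{≤ l}`. -/
abbrev Le (l : Λ) := (S.leProp l).FullSubcategory

/-- `R_{< l}`, as a Serre subcategory of `R_{≤ l}`. -/
abbrev ltProp (l : Λ) : ObjectProperty (S.Le l) :=
  (S.serre {b | S.rho b < l}).inverseImage (S.leProp l).ι

/-- The stratum `R_l`, i.e. the Serre quotient `R_{≤ l} / R_{< l}`. -/
abbrev Stratum (l : Λ) := (S.ltProp l).isoModSerre.Localization

/-- The quotient functor `j^l : R_{≤ l} ⥤ R_l`. -/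
abbrev j (l : Λ) : S.Le l ⥤ S.Stratum l := (S.ltProp l).isoModSerre.Q

/-- `L b` as an object of `R_{≤ ρ b}`. -/
def LLe (b : B) : S.Le (S.rho b) := ⟨S.L b, S.serre_L _ b (le_refl (S.rho b))⟩

/-- The irreducible object `L_l(b) = j^l (L b)` of the stratum `R_l`, where `l = ρ b`. -/
def LStratum (b : B) : S.Stratum (S.rho b) := (S.j (S.rho b)).obj (S.LLe b)

/-- `X ≅ Δ(b) = j_! P_l(b)`, where `l = ρ b` and `P_l(b)` is a projective cover of `L_l(b)`. -/
def IsStandard (b : B) (X : R) : Prop :=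
  ∃ (P : S.Stratum (S.rho b)) (Y : S.Le (S.rho b)), IsProjectiveCover P (S.LStratum b) ∧
    IsLeftAdjointValue (S.j (S.rho b)) P Y ∧ Nonempty (X ≅ Y.obj)

/-- `X` is isomorphic to the proper standard object `j_! L_l(b)`, where `l = ρ b`. -/
def IsProperStandard (b : B) (X : R) : Prop :=
  ∃ Y : S.Le (S.rho b),
    IsLeftAdjointValue (S.j (S.rho b)) (S.LStratum b) Y ∧ Nonempty (X ≅ Y.obj)

/-- `X ≅ ∇(b) = j_* I_l(b)`, where `l = ρ b` and `I_l(b)` is an injective hull of `L_l(b)`. -/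
def IsCostandard (b : B) (X : R) : Prop :=
  ∃ (I : S.Stratum (S.rho b)) (Y : S.Le (S.rho b)), IsInjectiveHull I (S.LStratum b) ∧
    IsRightAdjointValue (S.j (S.rho b)) I Y ∧ Nonempty (X ≅ Y.obj)

/-- `X` is isomorphic to the proper costandard object `j_* L_l(b)`, where `l = ρ b`. -/
def IsProperCostandard (b : B) (X : R) : Prop :=
  ∃ Y : S.Le (S.rho b),
    IsRightAdjointValue (S.j (S.rho b)) (S.LStratum b) Y ∧ Nonempty (X ≅ Y.obj)

variable (ε : Λ → Sgn)

/-- `X ≅ Δ_ε(b)`: the standard object for sign `+`, the proper standard object for sign `-`. -/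
def IsEpsStandard (b : B) (X : R) : Prop :=
  match ε (S.rho b) with
  | .plus => S.IsStandard b X
  | .minus => S.IsProperStandard b X

/-- `X ≅ ∇_ε(b)`: the proper costandard object for sign `+`, the costandard object for
sign `-`. -/
def IsEpsCostandard (b : B) (X : R) : Prop :=
  match ε (S.rho b) with
  | .plus => S.IsProperCostandard b X
  | .minus => S.IsCostandard b X

/-! ### `ε`-stratified categories -/

/-- For each `b` there is a projective object with a `Δ_ε`-flag with `Δ_ε(b)` at the top and
other sections `Δ_ε(c)` with `ρ c ≥ ρ b`. -/
def PDeltaHat : Prop :=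
  ∀ b : B, ∃ P : R, Projective P ∧
    HasFlagTop (S.IsEpsStandard ε) b (fun c ↦ S.rho b ≤ S.rho c) P

/-- For each `b` there is an injective object with a `∇_ε`-flag with `∇_ε(b)` at the bottom and
other sections `∇_ε(c)` with `ρ c ≥ ρ b`. -/
def INablaHat : Prop :=
  ∀ b : B, ∃ I : R, Injective I ∧
    HasFlagBottom (S.IsEpsCostandard ε) b (fun c ↦ S.rho b ≤ S.rho c) I

/-- The ind-completion of an essentially small category `R`, formed with a small model of `R`. -/
abbrev IndCompletion (R : Type u) [Category.{v} R] [EssentiallySmall.{w} R] :=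
  Ind (SmallModel.{w} R)

/-- The canonical embedding of `R` in its ind-completion. -/
noncomputable abbrev toInd (R : Type u) [Category.{v} R] [EssentiallySmall.{w} R] :
    R ⥤ IndCompletion.{w} R :=
  (equivSmallModel.{w} R).functor ⋙ Ind.yoneda

/-- For each `b` there is a finitely cogenerated injective object `I` of the ind-completion which
is the sum of a non-empty directed family `𝒱` of subobjects, each of which belongs to `R` and
has a `∇_ε`-flag with `∇_ε(b)` at the bottom and other sections `∇_ε(c)` with
`ρ c ≥ ρ b`. -/
def INablaHatAsc [EssentiallySmall.{w} R] : Prop :=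
  ∀ b : B, ∃ I : IndCompletion.{w} R, Injective I ∧ IsFinitelyCogenerated I ∧
    ∃ 𝒱 : Set (Subobject I), 𝒱.Nonempty ∧ DirectedOn (· ≤ ·) 𝒱 ∧ IsLUB 𝒱 ⊤ ∧
      ∀ W ∈ 𝒱, ∃ V : R, Nonempty ((W : IndCompletion.{w} R) ≅ (toInd.{w} R).obj V) ∧
        HasFlagBottom (S.IsEpsCostandard ε) b (fun c ↦ S.rho b ≤ S.rho c) V

variable (k : Type uk) [Field k] [Linear k R]

/-- `R`, with the given stratification, is a finite `ε`-stratified category. -/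
structure IsFiniteEpsStratified : Prop where
  finite_abelian : IsFiniteAbelian k R
  flags : S.PDeltaHat ε ∨ S.INablaHat ε

/-- `R`, with the given stratification, is a lower finite `ε`-stratified category. -/
structure IsLowerFiniteEpsStratified [EssentiallySmall.{w} R] : Prop where
  lower_finite : ∀ l : Λ, (Set.Iic l).Finite
  locally_finite : IsLocallyFiniteAbelian k R
  flags : INablaHatAsc.{w} S ε

/-! ### Tilting objects -/

/-- `T` is an `ε`-tilting object: it has both a `Δ_ε`-flag and a `∇_ε`-flag. -/
def IsTilting (T : R) : Prop :=
  HasFlag (S.IsEpsStandard ε) T ∧ HasFlag (S.IsEpsCostandard ε) T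

/-- `T` has a `Δ_ε`-flag with bottom section isomorphic to `Δ_ε(b)`. -/
def HasBottomStandard (b : B) (T : R) : Prop :=
  HasFlagBottom (S.IsEpsStandard ε) b (fun _ ↦ True) T

/-- `T` has a `∇_ε`-flag with top section isomorphic to `∇_ε(b)`. -/
def HasTopCostandard (b : B) (T : R) : Prop :=
  HasFlagTop (S.IsEpsCostandard ε) b (fun _ ↦ True) T

/-- `T` belongs to `R_{≤ l}`, where `l = ρ b`, and `j^l T` is isomorphic to the projective cover
`P_l(b)` of `L_l(b)` if the sign of `l` is `+`, to its injective hull `I_l(b)` if the sign is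
`-`. -/
def HasTiltingStratum (b : B) (T : R) : Prop :=
  ∃ h : S.leProp (S.rho b) T,
    match ε (S.rho b) with
    | .plus => IsProjectiveCover ((S.j (S.rho b)).obj ⟨T, h⟩) (S.LStratum b)
    | .minus => IsInjectiveHull ((S.j (S.rho b)).obj ⟨T, h⟩) (S.LStratum b)

end Stratification

end EpsStrat

/-! The proof is Ringel's construction of tilting objects, driven by the vanishing of Ext¹ and Ext²
from standard to costandard objects. Since `R` need not have enough projectives or injectives, no
Ext groups are used: `Ext1Zero` says that extensions split, `Ext2Zero` that Yoneda products of two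
extensions can be filled in, and the needed pieces of the long exact sequences are proved by hand.

`StdData` records what is needed of the objects Δ(b) and ∇(b): an essential map to, respectively
from, L(b); bounds on the composition factors; and inside R_{≤ρ b} either vanishing of extensions or
a small kernel or cokernel, according to the sign. These axioms are self-dual with signs reversed,
so each result also gives its dual, and often only one sign needs an argument.

Every form of the hypothesis gives `Effaceable`, for the data or for its dual. It implies Ext¹(Δ, ∇)
= 0 (`ext1Zero_std_costd`). The cokernel of ∇(c) in a suitable object with a ∇-flag still has no
extensions by standard objects (`rightOrth_cokernel`), whence Ext²(Δ, ∇) = 0. Consequently an object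
has a ∇-flag exactly if it is in `rightOrth`, and a Δ-flag exactly if it is in `leftOrth`
(`exists_costd_mono` and its dual). In particular, having a flag passes to direct summands.

Existence: by induction on ρ(c), each L(c) is a quotient of a Δ-filtered object by a ∇-filtered one,
and a subobject of a ∇-filtered object with Δ-filtered quotient (`approx_L`). Ext² vanishing extends
this to all objects built from such L(c). For sign + this embeds Δ(b) in a ∇-filtered object Y whose
quotient by Δ(b) is Δ-filtered from strictly lower strata, so Y is tilting. The idempotents of Δ(b)
are trivial, so Δ(b) lies in a single indecomposable summand T. The map Δ(b) → L(b) → ∇(b) extends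
to T, and this extension is an epimorphism with ∇-filtered kernel (`costdTop_of_plus`). Sign − is
dual.

Uniqueness: if two indecomposable tilting objects both start with Δ(b), the identity of Δ(b) extends
to maps in both directions, which are isomorphisms by Fitting's lemma. Property (iii) reduces to (i)
or (ii), depending on the sign: for sign + the universal property of j_! gives a map Δ(b) → U that
is an isomorphism modulo lower strata, and such a map is the bottom of a Δ-flag
(`stdBottom_of_isoMod`). -/

namespace EpsStrat

/-! ### Short exact sequences -/

section ShortExactSequences

variable {C : Type u} [Category.{v} C] [Abelian C]

/-- `0 ⟶ X ⟶ Y ⟶ Z ⟶ 0` is a short exact sequence. -/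
def IsSES {X Y Z : C} (i : X ⟶ Y) (p : Y ⟶ Z) : Prop :=
  ∃ w : i ≫ p = 0, (ShortComplex.mk i p w).ShortExact

namespace IsSES

variable {X Y Z : C} {i : X ⟶ Y} {p : Y ⟶ Z}

lemma zero (h : IsSES i p) : i ≫ p = 0 := h.1

lemma mono (h : IsSES i p) : Mono i := h.2.mono_f

lemma epi (h : IsSES i p) : Epi p := h.2.epi_g

lemma lift (h : IsSES i p) {W : C} (f : W ⟶ Y) (hf : f ≫ p = 0) : ∃ g, g ≫ i = f := by
  have := h.mono
  exact ⟨h.2.exact.lift f hf, h.2.exact.lift_f f hf⟩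

lemma desc (h : IsSES i p) {W : C} (f : Y ⟶ W) (hf : i ≫ f = 0) : ∃ g, p ≫ g = f := by
  have := h.epi
  exact ⟨h.2.exact.desc f hf, h.2.exact.g_desc f hf⟩

lemma op (h : IsSES i p) : IsSES p.op i.op :=
  ⟨by rw [← op_comp, h.zero, op_zero], h.2.op⟩

lemma unop {X Y Z : Cᵒᵖ} {i : X ⟶ Y} {p : Y ⟶ Z} (h : IsSES i p) : IsSES p.unop i.unop :=
  ⟨by rw [← unop_comp, h.zero, unop_zero], h.2.unop⟩

/-- The criterion for diagram chases in which an element must first be lifted through an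
epimorphism, so that it is only available after a cover of the test object. -/
lemma of_refine (i : X ⟶ Y) (p : Y ⟶ Z) [Mono i] [Epi p] (hw : i ≫ p = 0)
    (H : ∀ {W : C} (f : W ⟶ Y), f ≫ p = 0 →
      ∃ (W' : C) (π : W' ⟶ W) (_ : Epi π) (g : W' ⟶ X), π ≫ f = g ≫ i) : IsSES i p := by
  refine ⟨hw, { exact := ?_, mono_f := ‹_›, epi_g := ‹_› }⟩
  rw [ShortComplex.exact_iff_exact_up_to_refinements]
  intro A x hx
  exact H x hx

lemma of_lift (i : X ⟶ Y) (p : Y ⟶ Z) [Mono i] [Epi p] (hw : i ≫ p = 0)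
    (H : ∀ {W : C} (f : W ⟶ Y), f ≫ p = 0 → ∃ g : W ⟶ X, g ≫ i = f) : IsSES i p :=
  of_refine i p hw fun {W} f hf ↦ by
    obtain ⟨g, hg⟩ := H f hf
    exact ⟨W, 𝟙 W, inferInstance, g, by rw [hg, Category.id_comp]⟩

lemma of_desc (i : X ⟶ Y) (p : Y ⟶ Z) [Mono i] [Epi p] (hw : i ≫ p = 0)
    (H : ∀ {W : C} (f : Y ⟶ W), i ≫ f = 0 → ∃ g : Z ⟶ W, p ≫ g = f) : IsSES i p := by
  refine (of_lift p.op i.op (by rw [← op_comp, hw, op_zero]) fun {W} f hf ↦ ?_).unop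
  obtain ⟨g, hg⟩ := H f.unop (Quiver.Hom.op_inj hf)
  exact ⟨g.op, by rw [← op_comp, hg, Quiver.Hom.op_unop]⟩

lemma of_mono (i : X ⟶ Y) [Mono i] : IsSES i (cokernel.π i) :=
  of_desc _ _ (cokernel.condition i) fun f hf ↦ ⟨cokernel.desc i f hf, cokernel.π_desc _ _ _⟩

lemma of_epi (p : Y ⟶ Z) [Epi p] : IsSES (kernel.ι p) p :=
  of_lift _ _ (kernel.condition p) fun f hf ↦ ⟨kernel.lift p f hf, kernel.lift_ι _ _ _⟩

lemma of_split (X Z : C) : IsSES (biprod.inl : X ⟶ X ⊞ Z) biprod.snd :=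
  of_lift _ _ biprod.inl_snd fun f hf ↦
    ⟨f ≫ biprod.fst, by apply biprod.hom_ext <;> simp [hf]⟩

/-- A short exact sequence may be transported along isomorphisms of its terms. -/
lemma comp_iso (h : IsSES i p) {X' Y' Z' : C} (a : X' ⟶ X) (b : Y ⟶ Y') (b' : Y' ⟶ Y) (c : Z ⟶ Z')
    [IsIso a] [IsIso c] (hb : b ≫ b' = 𝟙 _) (hb' : b' ≫ b = 𝟙 _) :
    IsSES (a ≫ i ≫ b) (b' ≫ p ≫ c) := by
  have := h.mono
  have := h.epi
  have : IsIso b := ⟨b', hb, hb'⟩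
  have : IsIso b' := ⟨b, hb', hb⟩
  refine of_lift _ _ (by simp [reassoc_of% hb, reassoc_of% h.zero]) fun f hf ↦ ?_
  obtain ⟨g, hg⟩ := h.lift (f ≫ b') (by
    rw [← cancel_mono c, zero_comp, ← hf, Category.assoc, Category.assoc])
  exact ⟨g ≫ inv a, by simp [reassoc_of% hg, hb']⟩

lemma comp_right_iso (h : IsSES i p) {Z' : C} (c : Z ⟶ Z') [IsIso c] : IsSES i (p ≫ c) := by
  simpa using h.comp_iso (𝟙 _) (𝟙 _) (𝟙 _) c (by simp) (by simp)

lemma comp_left_iso (h : IsSES i p) {X' : C} (a : X' ⟶ X) [IsIso a] : IsSES (a ≫ i) p := by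
  simpa using h.comp_iso a (𝟙 _) (𝟙 _) (𝟙 _) (by simp) (by simp)

lemma comp_mid_iso (h : IsSES i p) {Y' : C} (e : Y ≅ Y') : IsSES (i ≫ e.hom) (e.inv ≫ p) := by
  simpa using h.comp_iso (𝟙 _) e.hom e.inv (𝟙 _) (by simp) (by simp)

/-- Any two cokernels of a monomorphism are isomorphic. -/
lemma cokernelIso (h : IsSES i p) : Nonempty (cokernel i ≅ Z) := by
  have := h.epi
  obtain ⟨g, hg⟩ := h.desc (cokernel.π i) (cokernel.condition i)
  refine ⟨⟨cokernel.desc i p h.zero, g, ?_, ?_⟩⟩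
  · rw [← cancel_epi (cokernel.π i), cokernel.π_desc_assoc, hg, Category.comp_id]
  · rw [← cancel_epi p, reassoc_of% hg, cokernel.π_desc, Category.comp_id]

lemma kernelIso (h : IsSES i p) : Nonempty (kernel p ≅ X) := by
  have := h.mono
  obtain ⟨g, hg⟩ := h.lift (kernel.ι p) (kernel.condition p)
  refine ⟨⟨g, kernel.lift p i h.zero, ?_, ?_⟩⟩
  · rw [← cancel_mono (kernel.ι p), Category.assoc, kernel.lift_ι, hg, Category.id_comp]
  · rw [← cancel_mono i, Category.assoc, hg, kernel.lift_ι, Category.id_comp]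

lemma isIso_left (h : IsSES i p) (hZ : IsZero Z) : IsIso i := by
  have := h.mono
  obtain ⟨g, hg⟩ := h.lift (𝟙 Y) (hZ.eq_of_tgt _ _)
  refine ⟨g, ?_, hg⟩
  rw [← cancel_mono i, Category.assoc, hg, Category.comp_id, Category.id_comp]

lemma isIso_right (h : IsSES i p) (hX : IsZero X) : IsIso p := by
  have := h.op.isIso_left hX.op
  exact (isIso_op_iff p).1 this

lemma isZero_right (h : IsSES i p) [Epi i] : IsZero Z := by
  have := h.epi
  exact IsZero.of_epi_eq_zero p (by rw [← cancel_epi i, h.zero, comp_zero])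

/-- Pullback of a short exact sequence. -/
lemma pullback (h : IsSES i p) {Z' : C} (f : Z' ⟶ Z) :
    ∃ (Y' : C) (i' : X ⟶ Y') (p' : Y' ⟶ Z') (g : Y' ⟶ Y), IsSES i' p' ∧ i' ≫ g = i ∧
      g ≫ p = p' ≫ f ∧ IsPullback g p' p f := by
  have := h.mono
  have := h.epi
  let i' : X ⟶ Limits.pullback p f := pullback.lift i 0 (by rw [h.zero, zero_comp])
  have hi' : i' ≫ pullback.fst p f = i := pullback.lift_fst _ _ _
  have : Mono (i' ≫ pullback.fst p f) := by rw [hi']; infer_instance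
  have : Mono i' := mono_of_mono i' (pullback.fst p f)
  refine ⟨Limits.pullback p f, i', pullback.snd p f, pullback.fst p f, ?_, hi',
    pullback.condition, IsPullback.of_hasPullback p f⟩
  refine of_lift _ _ (pullback.lift_snd _ _ _) fun {W} k hk ↦ ?_
  obtain ⟨g, hg⟩ := h.lift (k ≫ pullback.fst p f) (by
    rw [Category.assoc, pullback.condition, reassoc_of% hk, zero_comp])
  refine ⟨g, pullback.hom_ext ?_ ?_⟩
  · rw [Category.assoc, hi', hg]
  · rw [Category.assoc, pullback.lift_snd, comp_zero, hk]

/-- Pullback of a short exact sequence along an epimorphism. -/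
lemma pullback_epi (h : IsSES i p) {K Z' : C} {k : K ⟶ Z'} {f : Z' ⟶ Z} (hf : IsSES k f) :
    ∃ (Y' : C) (i' : X ⟶ Y') (p' : Y' ⟶ Z') (k' : K ⟶ Y') (g : Y' ⟶ Y),
      IsSES i' p' ∧ IsSES k' g ∧ i' ≫ g = i ∧ g ≫ p = p' ≫ f ∧ k' ≫ p' = k := by
  obtain ⟨Y', i', p', g, h₁, h₂, h₃, h₄⟩ := h.pullback f
  have := hf.mono
  have := hf.epi
  have := h.epi
  let k' : K ⟶ Y' := h₄.lift 0 k (by rw [hf.zero, zero_comp])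
  have hk' : k' ≫ p' = k := h₄.lift_snd _ _ _
  have : Mono (k' ≫ p') := by rw [hk']; infer_instance
  have : Mono k' := mono_of_mono k' p'
  have : Epi g := by
    have e := h₄.isoPullback_hom_fst
    rw [← e]
    infer_instance
  refine ⟨Y', i', p', k', g, h₁, of_lift _ _ (h₄.lift_fst _ _ _) fun {W} x hx ↦ ?_, h₂, h₃, hk'⟩
  obtain ⟨y, hy⟩ := hf.lift (x ≫ p') (by rw [Category.assoc, ← h₃, reassoc_of% hx, zero_comp])
  refine ⟨y, h₄.hom_ext ?_ ?_⟩
  · rw [Category.assoc, h₄.lift_fst, comp_zero, hx]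
  · rw [Category.assoc, hk', hy]

/-- Pushout of a short exact sequence. -/
lemma pushout (h : IsSES i p) {X' : C} (f : X ⟶ X') :
    ∃ (Y' : C) (i' : X' ⟶ Y') (p' : Y' ⟶ Z) (g : Y ⟶ Y'), IsSES i' p' ∧ g ≫ p' = p ∧
      i ≫ g = f ≫ i' := by
  obtain ⟨Y', i', p', g, h₁, h₂, h₃, -⟩ := h.op.pullback f.op
  exact ⟨Y'.unop, p'.unop, i'.unop, g.unop, h₁.unop, Quiver.Hom.op_inj h₂,
    Quiver.Hom.op_inj h₃⟩

/-- Pushout of a short exact sequence along a monomorphism. -/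
lemma pushout_mono (h : IsSES i p) {K X' : C} {f : X ⟶ X'} {k : X' ⟶ K} (hf : IsSES f k) :
    ∃ (Y' : C) (i' : X' ⟶ Y') (p' : Y' ⟶ Z) (g : Y ⟶ Y') (k' : Y' ⟶ K),
      IsSES i' p' ∧ IsSES g k' ∧ g ≫ p' = p ∧ i ≫ g = f ≫ i' ∧ i' ≫ k' = k := by
  obtain ⟨Y', i', p', k', g, h₁, h₂, h₃, h₄, h₅⟩ := h.op.pullback_epi hf.op
  exact ⟨Y'.unop, p'.unop, i'.unop, g.unop, k'.unop, h₁.unop, h₂.unop, Quiver.Hom.op_inj h₃,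
    Quiver.Hom.op_inj h₄, Quiver.Hom.op_inj h₅⟩

/-- For subobjects `X ⊆ Y ⊆ V`, the quotient `V / X` is an extension of `V / Y` by `Y / X`. -/
lemma quotient (h : IsSES i p) {V R : C} {j : Y ⟶ V} {q : V ⟶ R} (hj : IsSES j q) :
    ∃ (W : C) (π : V ⟶ W) (s : Z ⟶ W) (t : W ⟶ R), IsSES (i ≫ j) π ∧ IsSES s t ∧
      j ≫ π = p ≫ s ∧ π ≫ t = q := by
  obtain ⟨W, s, t, π, h₁, h₂, h₃⟩ := hj.pushout p
  have := h.mono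
  have := hj.mono
  have := h₁.mono
  have := h.epi
  have := hj.epi
  have : Epi π := by
    rw [Preadditive.epi_iff_cancel_zero]
    intro T f hf
    obtain ⟨g, hg⟩ := h₁.desc f (by
      rw [← cancel_epi p, ← reassoc_of% h₃, hf, comp_zero, comp_zero])
    rw [← hg] at hf
    rw [← hg, show g = 0 by rw [← cancel_epi q, ← h₂, Category.assoc, hf, comp_zero], comp_zero]
  refine ⟨W, π, s, t, of_lift _ _ ?_ fun {T} f hf ↦ ?_, h₁, h₃, h₂⟩
  · rw [Category.assoc, h₃, reassoc_of% h.zero, zero_comp]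
  · obtain ⟨g, hg⟩ := hj.lift f (by rw [← h₂, reassoc_of% hf, zero_comp])
    obtain ⟨g', hg'⟩ := h.lift g (by
      rw [← cancel_mono s, Category.assoc, ← h₃, reassoc_of% hg, hf, zero_comp])
    exact ⟨g', by rw [reassoc_of% hg', hg]⟩

/-- The preimage in `V` of a subobject of a quotient of `V`. -/
lemma preimage (h : IsSES i p) {V R : C} {j : R ⟶ V} {q : V ⟶ Y} (hj : IsSES j q) :
    ∃ (W : C) (k : W ⟶ V) (s : R ⟶ W) (t : W ⟶ X), IsSES k (q ≫ p) ∧ IsSES s t ∧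
      k ≫ q = t ≫ i ∧ s ≫ k = j := by
  obtain ⟨W, π, s, t, h₁, h₂, h₃, h₄⟩ := h.op.quotient hj.op
  exact ⟨W.unop, π.unop, t.unop, s.unop, h₁.unop, h₂.unop, Quiver.Hom.op_inj h₃,
    Quiver.Hom.op_inj h₄⟩

end IsSES

end ShortExactSequences

/-! ### Vanishing of `Ext¹` and `Ext²` -/

section ExtVanishing

variable {C : Type u} [Category.{v} C] [Abelian C]

/-- Every extension of `X` by `Y` splits. -/
def Ext1Zero (X Y : C) : Prop :=
  ∀ ⦃E : C⦄ (i : Y ⟶ E) (p : E ⟶ X), IsSES i p → ∃ r : E ⟶ Y, i ≫ r = 𝟙 Y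

/-- Every Yoneda product of an extension of `X` by `Z` and an extension of `Z` by `A` is
trivial. -/
def Ext2Zero (X A : C) : Prop :=
  ∀ ⦃Y Z W : C⦄ (a : A ⟶ Y) (p : Y ⟶ Z) (i : Z ⟶ W) (q : W ⟶ X), IsSES a p → IsSES i q →
    ∃ (G : C) (j : Y ⟶ G) (r : G ⟶ W), IsSES j (r ≫ q) ∧ IsSES (a ≫ j) r ∧ j ≫ r = p ≫ i

/-- A retraction of a short exact sequence yields a section. -/
lemma IsSES.exists_section {X Y Z : C} {i : X ⟶ Y} {p : Y ⟶ Z} (h : IsSES i p) {r : Y ⟶ X}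
    (hr : i ≫ r = 𝟙 X) : ∃ s : Z ⟶ Y, s ≫ p = 𝟙 Z ∧ s ≫ r = 0 := by
  have := h.epi
  obtain ⟨s, hs⟩ := h.desc (𝟙 Y - r ≫ i) (by simp [reassoc_of% hr])
  refine ⟨s, ?_, ?_⟩
  · rw [← cancel_epi p, reassoc_of% hs]
    simp [h.zero]
  · rw [← cancel_epi p, reassoc_of% hs]
    simp [hr]

lemma IsSES.exists_retraction {X Y Z : C} {i : X ⟶ Y} {p : Y ⟶ Z} (h : IsSES i p) {s : Z ⟶ Y}
    (hs : s ≫ p = 𝟙 Z) : ∃ r : Y ⟶ X, i ≫ r = 𝟙 X ∧ s ≫ r = 0 := by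
  obtain ⟨r, hr, hr'⟩ := h.op.exists_section (r := s.op) (Quiver.Hom.unop_inj hs)
  exact ⟨r.unop, Quiver.Hom.op_inj hr, Quiver.Hom.op_inj hr'⟩

namespace Ext1Zero

lemma exists_section {X Y E : C} (H : Ext1Zero X Y) {i : Y ⟶ E} {p : E ⟶ X} (h : IsSES i p) :
    ∃ s : X ⟶ E, s ≫ p = 𝟙 X := by
  obtain ⟨r, hr⟩ := H i p h
  obtain ⟨s, hs, -⟩ := h.exists_section hr
  exact ⟨s, hs⟩

lemma op {X Y : C} (H : Ext1Zero X Y) : Ext1Zero (Opposite.op Y) (Opposite.op X) := by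
  intro E i p h
  obtain ⟨s, hs⟩ := H.exists_section h.unop
  exact ⟨s.op, Quiver.Hom.unop_inj hs⟩

lemma unop {X Y : Cᵒᵖ} (H : Ext1Zero X Y) : Ext1Zero Y.unop X.unop := by
  intro E i p h
  obtain ⟨s, hs⟩ := H.exists_section h.op
  exact ⟨s.unop, Quiver.Hom.op_inj hs⟩

/-- The obstruction to lifting `f` is the pullback of the sequence along `f`, an extension of `X` by
`A`; a section of it composes to a lift. -/
lemma lift {X A G H : C} (hXA : Ext1Zero X A) {i : A ⟶ G} {p : G ⟶ H} (h : IsSES i p)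
    (f : X ⟶ H) : ∃ g : X ⟶ G, g ≫ p = f := by
  obtain ⟨Y', i', p', g, h₁, h₂, h₃, -⟩ := h.pullback f
  obtain ⟨s, hs⟩ := hXA.exists_section h₁
  exact ⟨s ≫ g, by rw [Category.assoc, h₃, reassoc_of% hs]⟩

lemma extend {X A G H : C} (hXA : Ext1Zero X A) {i : G ⟶ H} {p : H ⟶ X} (h : IsSES i p)
    (f : G ⟶ A) : ∃ g : H ⟶ A, i ≫ g = f := by
  obtain ⟨g, hg⟩ := hXA.op.lift h.op f.op
  exact ⟨g.unop, Quiver.Hom.op_inj hg⟩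

lemma of_lift {X A : C} (H : ∀ ⦃G : C⦄ (i : A ⟶ G) (p : G ⟶ X), IsSES i p →
    ∃ s : X ⟶ G, s ≫ p = 𝟙 X) : Ext1Zero X A := by
  intro E i p h
  obtain ⟨s, hs⟩ := H i p h
  obtain ⟨r, hr, -⟩ := h.exists_retraction hs
  exact ⟨r, hr⟩

lemma of_isZero_left {X A : C} (hX : IsZero X) : Ext1Zero X A :=
  of_lift fun _ _ _ _ ↦ ⟨0, hX.eq_of_src _ _⟩

lemma of_isZero_right {X A : C} (hA : IsZero A) : Ext1Zero X A :=
  fun _ _ _ _ ↦ ⟨0, hA.eq_of_src _ _⟩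

lemma of_iso {X X' A A' : C} (H : Ext1Zero X A) (e : X ≅ X') (e' : A ≅ A') : Ext1Zero X' A' := by
  intro E i p h
  obtain ⟨r, hr⟩ := H (e'.hom ≫ i) (p ≫ e.inv) ((h.comp_right_iso _).comp_left_iso _)
  exact ⟨r ≫ e'.hom, by
    rw [← cancel_epi e'.hom, ← Category.assoc, ← Category.assoc, hr]; simp⟩

lemma of_retract_right {X A A' : C} (H : Ext1Zero X A) (s : A' ⟶ A) (r : A ⟶ A')
    (hr : s ≫ r = 𝟙 A') : Ext1Zero X A' := by
  intro E i p h
  obtain ⟨g, hg⟩ := H.extend h s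
  exact ⟨g ≫ r, by rw [reassoc_of% hg, hr]⟩

lemma of_retract_left {X X' A : C} (H : Ext1Zero X A) (s : X' ⟶ X) (r : X ⟶ X')
    (hr : s ≫ r = 𝟙 X') : Ext1Zero X' A :=
  (H.op.of_retract_right r.op s.op (Quiver.Hom.unop_inj hr)).unop

lemma ext_right {X A A' A'' : C} {s : A' ⟶ A} {t : A ⟶ A''} (h : IsSES s t)
    (H' : Ext1Zero X A') (H'' : Ext1Zero X A'') : Ext1Zero X A :=
  of_lift fun G i p hp ↦ by
    obtain ⟨W, π, c, d, h₁, h₂, h₃, h₄⟩ := h.quotient hp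
    obtain ⟨g, hg⟩ := H''.lift h₂ (𝟙 X)
    obtain ⟨g', hg'⟩ := H'.lift h₁ g
    exact ⟨g', by rw [← h₄, reassoc_of% hg', hg]⟩

lemma ext_left {X X' X'' A : C} {s : X' ⟶ X} {t : X ⟶ X''} (h : IsSES s t)
    (H' : Ext1Zero X' A) (H'' : Ext1Zero X'' A) : Ext1Zero X A :=
  (H''.op.ext_right h.op H'.op).unop

/-- The part `Hom(X, A) ⟶ Hom(X, A'') ⟶ Ext¹(X, A') ⟶ Ext¹(X, A)` of the long exact
sequence. -/
lemma of_surjective_right {X A A' A'' : C} {s : A' ⟶ A} {t : A ⟶ A''} (h : IsSES s t)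
    (H : Ext1Zero X A) (hsurj : ∀ f : X ⟶ A'', ∃ g : X ⟶ A, g ≫ t = f) : Ext1Zero X A' := by
  intro E i p hp
  have := hp.epi
  have := h.mono
  obtain ⟨f, hf⟩ := H.extend hp s
  obtain ⟨f', hf'⟩ := hp.desc (f ≫ t) (by rw [reassoc_of% hf, h.zero])
  obtain ⟨g, hg⟩ := hsurj f'
  obtain ⟨r, hr⟩ := h.lift (f - p ≫ g) (by simp [hg, hf'])
  refine ⟨r, ?_⟩
  rw [← cancel_mono s, Category.assoc, hr]
  simp [hf, reassoc_of% hp.zero]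

lemma of_hom_eq_zero_right {X A A' A'' : C} {s : A' ⟶ A} {t : A ⟶ A''} (h : IsSES s t)
    (H : Ext1Zero X A) (h0 : ∀ f : X ⟶ A'', f = 0) : Ext1Zero X A' :=
  of_surjective_right h H fun f ↦ ⟨0, by rw [h0 f, zero_comp]⟩

lemma of_surjective_left {X X' X'' A : C} {s : X' ⟶ X} {t : X ⟶ X''} (h : IsSES s t)
    (H : Ext1Zero X A) (hsurj : ∀ f : X' ⟶ A, ∃ g : X ⟶ A, s ≫ g = f) : Ext1Zero X'' A := by
  refine (of_surjective_right h.op H.op fun f ↦ ?_).unop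
  obtain ⟨g, hg⟩ := hsurj f.unop
  exact ⟨g.op, Quiver.Hom.unop_inj hg⟩

lemma of_hom_eq_zero_left {X X' X'' A : C} {s : X' ⟶ X} {t : X ⟶ X''} (h : IsSES s t)
    (H : Ext1Zero X A) (h0 : ∀ f : X' ⟶ A, f = 0) : Ext1Zero X'' A :=
  of_surjective_left h H fun f ↦ ⟨0, by rw [h0 f, comp_zero]⟩

/-- The part `Ext¹(X, A) ⟶ Ext¹(X, A'') ⟶ Ext²(X, A')` of the long exact sequence. -/
lemma of_ext2Zero_right {X A A' A'' : C} {s : A' ⟶ A} {t : A ⟶ A''} (h : IsSES s t)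
    (H : Ext1Zero X A) (H2 : Ext2Zero X A') : Ext1Zero X A'' :=
  of_lift fun F i q hq ↦ by
    obtain ⟨G, j, r, h₁, -, -⟩ := H2 s t i q h hq
    obtain ⟨σ, hσ⟩ := H.lift h₁ (𝟙 X)
    exact ⟨σ ≫ r, by rw [Category.assoc, hσ]⟩

lemma of_projective {X Y : C} [Projective X] : Ext1Zero X Y :=
  of_lift fun _ _ r h ↦ have := h.epi; ⟨_, Projective.factorThru_comp (𝟙 X) r⟩

lemma of_injective {X Y : C} [Injective Y] : Ext1Zero X Y :=
  fun _ i _ h ↦ have := h.mono; ⟨_, Injective.comp_factorThru (𝟙 Y) i⟩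

end Ext1Zero

namespace Ext2Zero

lemma op {X A : C} (H : Ext2Zero X A) : Ext2Zero (Opposite.op A) (Opposite.op X) := by
  intro Y Z W a p i q h₁ h₂
  obtain ⟨G, j, r, h₃, h₄, h₅⟩ := H q.unop i.unop p.unop a.unop h₂.unop h₁.unop
  exact ⟨Opposite.op G, r.op, j.op, h₄.op, h₃.op, Quiver.Hom.unop_inj h₅⟩

lemma unop {X A : Cᵒᵖ} (H : Ext2Zero X A) : Ext2Zero A.unop X.unop := by
  intro Y Z W a p i q h₁ h₂
  obtain ⟨G, j, r, h₃, h₄, h₅⟩ := H q.op i.op p.op a.op h₂.op h₁.op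
  exact ⟨G.unop, r.unop, j.unop, h₄.unop, h₃.unop, Quiver.Hom.op_inj h₅⟩

lemma of_isZero_right {X A : C} (hA : IsZero A) : Ext2Zero X A := by
  intro Y Z W a p i q h₁ h₂
  have := h₁.isIso_right hA
  have := h₂.mono
  refine ⟨W, p ≫ i, 𝟙 W, by simpa using h₂.comp_left_iso p, ?_, by simp⟩
  have : Mono (a ≫ p ≫ i) := ⟨fun _ _ _ ↦ hA.eq_of_tgt _ _⟩
  refine IsSES.of_lift _ _ (by rw [reassoc_of% h₁.zero, zero_comp, zero_comp]) fun f hf ↦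
    ⟨0, by rw [zero_comp, ← hf, Category.comp_id]⟩

lemma of_iso_right {X A A' : C} (H : Ext2Zero X A) (e : A ≅ A') : Ext2Zero X A' := by
  intro Y Z W a p i q h₁ h₂
  obtain ⟨G, j, r, h₃, h₄, h₅⟩ := H (e.hom ≫ a) p i q (h₁.comp_left_iso _) h₂
  exact ⟨G, j, r, h₃, by simpa using h₄.comp_left_iso e.inv, h₅⟩

/-- Divide `Y` by `A'`, fill in over `A''`, then fill in the resulting product over `A'`. The kernel
of the composite `G₁ ⟶ G₂ ⟶ W` is an extension of `A''` by `A'` and is identified with `A` after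
refining along `t`. -/
lemma ext_right {X A A' A'' : C} {s : A' ⟶ A} {t : A ⟶ A''} (h : IsSES s t)
    (H' : Ext2Zero X A') (H'' : Ext2Zero X A'') : Ext2Zero X A := by
  intro Y Z W a p i q h₁ h₂
  obtain ⟨V, w, c, d, k₁, k₂, k₃, k₄⟩ := h.quotient h₁
  obtain ⟨G₂, j₂, r₂, l₁, l₂, l₃⟩ := H'' c d i q k₂ h₂
  obtain ⟨G₁, j₁, r₁, m₁, m₂, m₃⟩ := H' (s ≫ a) w j₂ (r₂ ≫ q) k₁ l₁
  have := h₁.mono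
  have := m₁.mono
  have := m₂.mono
  have := m₂.epi
  have := l₂.epi
  have := h.epi
  refine ⟨G₁, j₁, r₁ ≫ r₂, by simpa using m₁, ?_, by rw [reassoc_of% m₃, l₃, reassoc_of% k₄]⟩
  refine IsSES.of_refine _ _ ?_ fun {T} f hf ↦ ?_
  · rw [Category.assoc, reassoc_of% m₃, reassoc_of% k₃, ← Category.assoc c, l₂.zero, comp_zero]
  · obtain ⟨z, hz⟩ := l₂.lift (f ≫ r₁) (by simpa using hf)
    let T' := Limits.pullback z t
    let z' : T' ⟶ A := pullback.snd z t
    let π : T' ⟶ T := pullback.fst z t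
    have hπ : π ≫ z = z' ≫ t := pullback.condition
    obtain ⟨y, hy⟩ := m₂.lift (π ≫ f - z' ≫ a ≫ j₁) (by
      rw [Preadditive.sub_comp, Category.assoc, ← hz, reassoc_of% hπ, Category.assoc,
        Category.assoc, m₃, reassoc_of% k₃, sub_self])
    exact ⟨T', π, inferInstance, z' + y ≫ s, by simp [← hy, ← sub_eq_iff_eq_add']⟩

lemma ext_left {X X' X'' A : C} {s : X' ⟶ X} {t : X ⟶ X''} (h : IsSES s t)
    (H' : Ext2Zero X' A) (H'' : Ext2Zero X'' A) : Ext2Zero X A :=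
  (H''.op.ext_right h.op H'.op).unop

/-- `Ext²(X, A)` vanishes if each monomorphism from `A` has an extension to a monomorphism whose
cokernel has no extensions by `X`. -/
lemma of_effaceable {X A : C} (H : ∀ ⦃Y : C⦄ (a : A ⟶ Y), Mono a →
    ∃ (V Q : C) (f : Y ⟶ V) (π : V ⟶ Q), IsSES (a ≫ f) π ∧ Ext1Zero X Q) : Ext2Zero X A := by
  intro Y Z W a p i q h₁ h₂
  obtain ⟨V, Q, f, π, h₃, hQ⟩ := H a h₁.mono
  obtain ⟨f', hf'⟩ := h₁.desc (f ≫ π) (by rw [← Category.assoc, h₃.zero])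
  obtain ⟨g, hg⟩ := hQ.extend h₂ f'
  -- Since `X` has no extensions by `Q`, the map `Z ⟶ Q` induced by `f` extends to `g : W ⟶ Q`. The
  -- filler is the pullback of `V ⟶ Q` along `g`, into which `Y` maps by `f` and `p ≫ i`.
  obtain ⟨G, k, r, m, k₁, k₂, k₃, k₄⟩ := h₃.pullback g
  have := k₁.mono
  have := k₁.epi
  have := h₁.mono
  have := h₁.epi
  have := h₂.mono
  have := h₂.epi
  have := h₃.mono
  let j : Y ⟶ G := k₄.lift f (p ≫ i) (by rw [Category.assoc, hg, hf'])
  have hj₁ : j ≫ m = f := k₄.lift_fst _ _ _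
  have hj₂ : j ≫ r = p ≫ i := k₄.lift_snd _ _ _
  have hk : a ≫ j = k := k₄.hom_ext (by rw [Category.assoc, hj₁, k₂])
    (by rw [Category.assoc, hj₂, reassoc_of% h₁.zero, zero_comp, k₁.zero])
  have : Mono j := by
    rw [Preadditive.mono_iff_cancel_zero]
    intro T x hx
    obtain ⟨y, hy⟩ := h₁.lift x (by
      rw [← cancel_mono i, Category.assoc, ← hj₂, reassoc_of% hx, zero_comp, zero_comp])
    rw [← hy, show y = 0 by
      rw [← cancel_mono k, ← hk, reassoc_of% hy, hx, zero_comp], zero_comp]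
  refine ⟨G, j, r, IsSES.of_refine _ _ (by rw [reassoc_of% hj₂, h₂.zero, comp_zero])
    fun {T} x hx ↦ ?_, by rwa [hk], hj₂⟩
  obtain ⟨z, hz⟩ := h₂.lift (x ≫ r) (by simpa using hx)
  let T' := Limits.pullback z p
  let y : T' ⟶ Y := pullback.snd z p
  let e : T' ⟶ T := pullback.fst z p
  have he : e ≫ z = y ≫ p := pullback.condition
  obtain ⟨x', hx'⟩ := k₁.lift (e ≫ x - y ≫ j) (by
    rw [Preadditive.sub_comp, Category.assoc, ← hz, reassoc_of% he, Category.assoc, hj₂, sub_self])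
  exact ⟨T', e, inferInstance, y + x' ≫ a, by simp [hk, hx']⟩

end Ext2Zero

end ExtVanishing

/-! ### Categories in which all objects have finite length -/

section FiniteLength

/-- All objects of `C` have finite length. -/
class AllFiniteLength (C : Type u) [Category.{v} C] : Prop where
  noetherian : ∀ V : C, IsNoetherianObject V
  artinian : ∀ V : C, IsArtinianObject V

variable {C : Type u} [Category.{v} C] [Abelian C]

instance [AllFiniteLength C] : AllFiniteLength Cᵒᵖ where
  noetherian V := by
    have := AllFiniteLength.artinian V.unop
    refine ⟨?_⟩
    change WellFoundedGT (Subobject (Opposite.op V.unop))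
    rw [← wellFoundedLT_dual_iff]
    exact (Abelian.subobjectIsoSubobjectOp V.unop).symm.toOrderEmbedding.wellFoundedLT
  artinian V := by
    have := AllFiniteLength.noetherian V.unop
    refine ⟨?_⟩
    change WellFoundedLT (Subobject (Opposite.op V.unop))
    rw [← wellFoundedGT_dual_iff]
    exact (Abelian.subobjectIsoSubobjectOp V.unop).symm.toOrderEmbedding.wellFoundedGT

variable [AllFiniteLength C]

/-- Noetherian induction: to prove a property of an object, one may assume it for all proper
quotients. -/
lemma induction_quotient {P : C → Prop}
    (H : ∀ V : C, (∀ ⦃A V' : C⦄ (i : A ⟶ V) (p : V ⟶ V'), IsSES i p → ¬ IsZero A → P V') → P V)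
    (V : C) : P V := by
  have := AllFiniteLength.noetherian V
  -- Every quotient occurring is a quotient of the fixed object `V`, so the induction climbs through
  -- its kernels in the single noetherian poset `Subobject V`.
  suffices ∀ (K : Subobject V) (Q : C) (p : V ⟶ Q), IsSES K.arrow p → P Q by
    refine this ⊥ V (𝟙 V) (IsSES.of_lift _ _ (by simp) fun f hf ↦ ⟨0, ?_⟩)
    rw [zero_comp, ← hf, Category.comp_id]
  intro K
  induction K using WellFoundedGT.induction with
  | ind K IH =>
    intro Q p hp
    refine H Q fun A V' i q hq hA ↦ ?_
    obtain ⟨W, k, s, t, h₁, h₂, h₃, h₄⟩ := hq.preimage hp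
    have := h₁.mono
    have := h₂.mono
    refine IH (Subobject.mk k) ?_ V' (p ≫ q) ?_
    · refine lt_of_le_of_ne (Subobject.le_mk_of_comm s h₄) fun h ↦ hA ?_
      have hs : s = (Subobject.isoOfEqMk K k h).hom := by
        rw [← cancel_mono k, h₄]
        simp
      have : Epi s := by rw [hs]; infer_instance
      exact h₂.isZero_right
    · have := h₁.comp_left_iso (Subobject.underlyingIso k).hom
      rwa [Subobject.underlyingIso_hom_comp_eq_mk] at this

/-- Artinian induction: to prove a property of an object, one may assume it for all proper
subobjects. -/
lemma induction_sub {P : C → Prop}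
    (H : ∀ V : C, (∀ ⦃V' A : C⦄ (i : V' ⟶ V) (p : V ⟶ A), IsSES i p → ¬ IsZero A → P V') → P V)
    (V : C) : P V :=
  induction_quotient (C := Cᵒᵖ) (P := fun V ↦ P V.unop)
    (fun V hV ↦ H V.unop fun _ _ i p h hA ↦ hV p.op i.op h.op fun h0 ↦ hA h0.unop) (.op V)

omit [Abelian C] in
-- The images of the powers of `f` form a descending chain. Once two consecutive ones agree,
-- cancelling the monomorphism `f ^ n` leaves `g` with `g ≫ f = 𝟙 X`.
lemma isIso_of_mono_endo {X : C} (f : X ⟶ X) [Mono f] : IsIso f := by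
  have := AllFiniteLength.artinian X
  have hm : ∀ n : ℕ, Mono ((show End X from f) ^ n : End X) := fun n ↦ by
    induction n with
    | zero => exact inferInstanceAs (Mono (𝟙 X))
    | succ n ih => rw [pow_succ]; exact mono_comp f _
  obtain ⟨n, hn⟩ := antitone_chain_condition_of_isArtinianObject (X := X)
    ⟨fun n ↦ OrderDual.toDual (Subobject.mk ((show End X from f) ^ n : End X)),
      monotone_nat_of_le_succ fun n ↦ OrderDual.toDual_le_toDual.2
        (Subobject.mk_le_mk_of_comm f (by rw [pow_succ]; rfl))⟩
  have h := hn (n + 1) (Nat.le_succ n)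
  have h' : Subobject.mk ((show End X from f) ^ n : End X) ≤
    Subobject.mk ((show End X from f) ^ (n + 1) : End X) := (OrderDual.toDual.injective h).le
  have e := Subobject.ofMkLEMk_comp h'
  set g := Subobject.ofMkLEMk _ _ h'
  have hg : g ≫ f = 𝟙 X := by
    have := hm n
    rw [← cancel_mono ((show End X from f) ^ n : End X), Category.id_comp, Category.assoc]
    rw [pow_succ] at e
    exact e
  exact ⟨g, by rw [← cancel_mono f, Category.assoc, hg, Category.comp_id, Category.id_comp], hg⟩

lemma isIso_of_epi_endo {X : C} (f : X ⟶ X) [Epi f] : IsIso f :=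
  (isIso_op_iff f).1 (isIso_of_mono_endo f.op)

omit [AllFiniteLength C] in
lemma Indecomposable.isZero_or_isZero {X Y Z : C} (h : Indecomposable Y) {i : X ⟶ Y} {p : Y ⟶ Z}
    (hip : IsSES i p) {r : Y ⟶ X} (hr : i ≫ r = 𝟙 X) : IsZero X ∨ IsZero Z := by
  obtain ⟨s, hs, hs'⟩ := hip.exists_section hr
  have := hip.mono
  have := hip.epi
  refine h.2 X Z ⟨biprod.lift r p, biprod.desc i s, ?_, ?_⟩
  · rw [biprod.lift_desc]
    obtain ⟨g, hg⟩ := hip.lift (r ≫ i + p ≫ s - 𝟙 Y) (by simp [hip.zero, hs])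
    have : g = 0 := by
      have h := hg =≫ r
      simpa [hr, hs'] using h
    rw [← sub_eq_zero, ← hg, this, zero_comp]
  · apply biprod.hom_ext <;> apply biprod.hom_ext' <;> simp [hr, hs, hs', hip.zero]

omit [AllFiniteLength C] in
lemma indecomposable_of_split {Y : C} (h0 : ¬ IsZero Y)
    (H : ∀ ⦃X Z : C⦄ (i : X ⟶ Y) (p : Y ⟶ Z) (r : Y ⟶ X), IsSES i p → i ≫ r = 𝟙 X →
      IsZero X ∨ IsZero Z) : Indecomposable Y := by
  refine ⟨h0, fun X Z e ↦ H (biprod.inl ≫ e.inv) (e.hom ≫ biprod.snd) (e.hom ≫ biprod.fst)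
    ((IsSES.of_split X Z).comp_mid_iso e.symm) (by simp)⟩

omit [AllFiniteLength C] in
lemma Indecomposable.op {Y : C} (h : Indecomposable Y) : Indecomposable (Opposite.op Y) := by
  refine indecomposable_of_split (fun h0 ↦ h.1 h0.unop) fun X Z i p r hip hr ↦ ?_
  obtain ⟨s, hs, -⟩ := hip.exists_section hr
  exact (Indecomposable.isZero_or_isZero h hip.unop (r := s.unop)
    (Quiver.Hom.op_inj hs)).symm.imp (fun h ↦ h.op) fun h ↦ h.op

omit [AllFiniteLength C] in
lemma Indecomposable.unop {Y : Cᵒᵖ} (h : Indecomposable Y) : Indecomposable Y.unop := by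
  refine indecomposable_of_split (fun h0 ↦ h.1 h0.op) fun X Z i p r hip hr ↦ ?_
  obtain ⟨s, hs, -⟩ := hip.exists_section hr
  exact (Indecomposable.isZero_or_isZero h hip.op (r := s.op)
    (Quiver.Hom.unop_inj hs)).symm.imp (fun h ↦ h.unop) fun h ↦ h.unop

/-- Fitting's lemma: an endomorphism of an indecomposable object which fixes a non-zero morphism
is an isomorphism. -/
lemma Indecomposable.isIso_of_fixes {X A : C} (hX : Indecomposable X) (f : X ⟶ X) (a : A ⟶ X)
    (ha : a ≠ 0) (hf : a ≫ f = a) : IsIso f := by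
  have := AllFiniteLength.noetherian X
  have hpow : ∀ n, a ≫ ((show End X from f) ^ n : End X) = a := fun n ↦ by
    induction n with
    | zero => exact Category.comp_id a
    | succ n ih =>
      rw [pow_succ]
      change a ≫ f ≫ _ = a
      rw [reassoc_of% hf, ih]
  obtain ⟨n, hn⟩ := monotone_chain_condition_of_isNoetherianObject (X := X)
    ⟨fun n ↦ kernelSubobject ((show End X from f) ^ n : End X),
      monotone_nat_of_le_succ fun n ↦ le_kernelSubobject _ _ (by
        rw [pow_succ']
        change _ ≫ (_ ≫ f) = 0
        rw [kernelSubobject_arrow_comp_assoc, zero_comp])⟩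
  -- The kernels are constant from `n` on; using `n + 1` makes `f` a factor of `f ^ m`, so that `f`
  -- is mono once `f ^ m` is.
  set m := n + 1
  have hm : kernelSubobject ((show End X from f) ^ m : End X) =
      kernelSubobject ((show End X from f) ^ (m + m) : End X) :=
    (hn m (by omega)).symm.trans (hn (m + m) (by omega))
  set g : X ⟶ X := ((show End X from f) ^ m : End X)
  have hg2 : ((show End X from f) ^ (m + m) : End X) = g ≫ g := pow_add _ m m
  have hg : ∀ {T : C} (x : T ⟶ X), x ≫ g ≫ g = 0 → x ≫ g = 0 := fun x hx ↦ by
    have h1 : (kernelSubobject ((show End X from f) ^ (m + m) : End X)).Factors x :=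
      kernelSubobject_factors _ _ (by rw [hg2, hx])
    rw [← hm] at h1
    exact (kernelSubobject_factors_iff _ _).1 h1
  let p := Abelian.factorThruImage g
  let i := Abelian.image.ι g
  have hpi : p ≫ i = g := Abelian.image.fac g
  -- As `g` and `g ≫ g` have the same kernel, the image of `g` meets the kernel of `g` trivially.
  -- The image then splits off, and indecomposability applies.
  have : Mono (i ≫ p) := by
    rw [Preadditive.mono_iff_cancel_zero]
    intro T x hx
    let e : Limits.pullback x p ⟶ T := pullback.fst x p
    let y : Limits.pullback x p ⟶ X := pullback.snd x p
    have hey : e ≫ x = y ≫ p := pullback.condition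
    have h1 : y ≫ g = 0 := hg y (by
      have e1 : g ≫ g = p ≫ i ≫ p ≫ i := by rw [reassoc_of% hpi, hpi]
      rw [e1, ← reassoc_of% hey, reassoc_of% hx, zero_comp, comp_zero])
    rw [← cancel_epi e, ← cancel_mono i, hey, Category.assoc, hpi, h1, comp_zero, zero_comp]
  have := isIso_of_mono_endo (i ≫ p)
  obtain ⟨r, hr, -⟩ := (IsSES.of_epi p).exists_retraction (s := inv (i ≫ p) ≫ i) (by simp)
  rcases Indecomposable.isZero_or_isZero hX (IsSES.of_epi p) hr with h | h
  · have := (IsSES.of_epi p).isIso_right h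
    have : Mono g := by rw [← hpi]; infer_instance
    have hfg : f ≫ ((show End X from f) ^ n : End X) = g := (pow_succ (show End X from f) n).symm
    have : Mono (f ≫ ((show End X from f) ^ n : End X)) := by rw [hfg]; infer_instance
    have : Mono f := mono_of_mono f ((show End X from f) ^ n : End X)
    exact isIso_of_mono_endo f
  -- Here the image of `g` is zero, although `g` fixes `a ≠ 0`.
  · refine (ha ?_).elim
    rw [← hpow m]
    change a ≫ g = 0
    rw [← hpi, h.eq_of_tgt p 0, zero_comp, comp_zero]

lemma isIso_of_fixes {X Y A A' : C} (hX : Indecomposable X) (hY : Indecomposable Y)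
    (f : X ⟶ Y) (g : Y ⟶ X) (a : A ⟶ X) (a' : A' ⟶ Y) (ha : a ≠ 0) (ha' : a' ≠ 0)
    (h : a ≫ f ≫ g = a) (h' : a' ≫ g ≫ f = a') : IsIso f := by
  have := Indecomposable.isIso_of_fixes hX _ a ha h
  have := Indecomposable.isIso_of_fixes hY _ a' ha' h'
  have : Mono f := mono_of_mono f g
  have : Epi f := epi_of_epi g f
  exact isIso_of_mono_of_epi f

end FiniteLength

/-! ### Families of irreducible objects -/

section Families

variable {C : Type u} [Category.{v} C] [Abelian C] {B : Type uB}

lemma simple_op {X : C} [Simple X] : Simple (Opposite.op X) where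
  mono_isIso_iff_nonzero {Y} f hf := by
    rw [← isIso_unop_iff]
    constructor
    · intro h h0
      refine Simple.not_isZero X (IsZero.of_mono_eq_zero f.unop ?_)
      rw [h0]
      rfl
    · intro h
      exact isIso_of_epi_of_nonzero fun h0 ↦ h (Quiver.Hom.unop_inj h0)

lemma simple_unop {X : Cᵒᵖ} [Simple X] : Simple X.unop where
  mono_isIso_iff_nonzero {Y} f hf := by
    rw [← isIso_op_iff]
    constructor
    · intro h h0
      refine Simple.not_isZero X (IsZero.of_mono_eq_zero f.op ?_)
      rw [h0]
      rfl
    · intro h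
      exact isIso_of_epi_of_nonzero fun h0 ↦ h (Quiver.Hom.op_inj h0)

lemma IsCompositionFactor.op {X V : C} (h : IsCompositionFactor X V) :
    IsCompositionFactor (Opposite.op X) (Opposite.op V) := by
  obtain ⟨Y, i, p, hi, hp⟩ := h
  exact ⟨Opposite.op (pushout i p), (pushout.inl i p).op, (pushout.inr i p).op, inferInstance,
    inferInstance⟩

lemma IsCompositionFactor.unop {X V : Cᵒᵖ} (h : IsCompositionFactor X V) :
    IsCompositionFactor X.unop V.unop := by
  obtain ⟨Y, i, p, hi, hp⟩ := h
  exact ⟨(pushout i p).unop, (pushout.inl i p).unop, (pushout.inr i p).unop, inferInstance,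
    inferInstance⟩

namespace IrreducibleFamily

variable (𝓛 : IrreducibleFamily C B)

/-- The family of irreducible objects of the opposite category. -/
def op : IrreducibleFamily Cᵒᵖ B where
  L b := Opposite.op (𝓛.L b)
  simple b := by
    have := 𝓛.simple b
    exact simple_op
  inequivalent b c h := 𝓛.inequivalent b c (h.map fun e ↦ e.unop.symm)
  exhaustive X hX := by
    obtain ⟨b, ⟨e⟩⟩ := 𝓛.exhaustive X.unop simple_unop
    exact ⟨b, ⟨e.symm.op⟩⟩

variable {𝓛} {s t : Set B}

lemma serre_op {V : C} : 𝓛.op.serre s (Opposite.op V) ↔ 𝓛.serre s V :=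
  ⟨fun h b hb ↦ h b hb.op, fun h b hb ↦ h b hb.unop⟩

lemma serre_unop {V : Cᵒᵖ} : 𝓛.serre s V.unop ↔ 𝓛.op.serre s V := serre_op.symm

lemma serre_mono (h : s ⊆ t) {V : C} (hV : 𝓛.serre s V) : 𝓛.serre t V :=
  fun b hb ↦ h (hV b hb)

lemma serre_of_mono {X Y : C} (i : X ⟶ Y) [Mono i] (h : 𝓛.serre s Y) : 𝓛.serre s X :=
  (𝓛.serre s).prop_of_mono i h

lemma serre_of_epi {X Y : C} (p : X ⟶ Y) [Epi p] (h : 𝓛.serre s X) : 𝓛.serre s Y :=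
  (𝓛.serre s).prop_of_epi p h

lemma serre_of_isZero {X : C} (h : IsZero X) : 𝓛.serre s X :=
  (𝓛.serre s).prop_of_isZero h

lemma serre_of_ses {X Y Z : C} {i : X ⟶ Y} {p : Y ⟶ Z} (h : IsSES i p) (hX : 𝓛.serre s X)
    (hZ : 𝓛.serre s Z) : 𝓛.serre s Y :=
  (𝓛.serre s).prop_X₂_of_shortExact h.2 hX hZ

lemma mem_of_mono {b : B} {X : C} (i : 𝓛.L b ⟶ X) [Mono i] (h : 𝓛.serre s X) : b ∈ s :=
  h b ⟨_, i, 𝟙 _, inferInstance, inferInstance⟩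

lemma mem_of_epi {b : B} {X : C} (p : X ⟶ 𝓛.L b) [Epi p] (h : 𝓛.serre s X) : b ∈ s :=
  h b ⟨_, 𝟙 _, p, inferInstance, inferInstance⟩

lemma mono_of_ne_zero {b : B} {X : C} {i : 𝓛.L b ⟶ X} (h : i ≠ 0) : Mono i :=
  have := 𝓛.simple b
  mono_of_nonzero_from_simple h

lemma epi_of_ne_zero {b : B} {X : C} {p : X ⟶ 𝓛.L b} (h : p ≠ 0) : Epi p :=
  have := 𝓛.simple b
  epi_of_nonzero_to_simple h

lemma not_isZero (b : B) : ¬ IsZero (𝓛.L b) :=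
  have := 𝓛.simple b
  Simple.not_isZero _

variable [AllFiniteLength C]

lemma exists_mono (𝓛 : IrreducibleFamily C B) {X : C} (h : ¬ IsZero X) :
    ∃ (b : B) (i : 𝓛.L b ⟶ X), Mono i := by
  have := AllFiniteLength.artinian X
  obtain ⟨Y, hY⟩ := exists_simple_subobject h
  obtain ⟨b, ⟨e⟩⟩ := 𝓛.exhaustive _ hY
  exact ⟨b, e.inv ≫ Y.arrow, inferInstance⟩

lemma exists_epi (𝓛 : IrreducibleFamily C B) {X : C} (h : ¬ IsZero X) :
    ∃ (b : B) (p : X ⟶ 𝓛.L b), Epi p := by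
  obtain ⟨b, i, hi⟩ := 𝓛.op.exists_mono (X := Opposite.op X) fun h' ↦ h h'.unop
  exact ⟨b, i.unop, @unop_epi_of_mono _ _ _ _ i hi⟩

/-- A property of objects holds on a Serre subcategory if it holds for zero objects, for the
irreducible objects, and is stable under extensions. -/
lemma serre_induction (𝓛 : IrreducibleFamily C B) {P : C → Prop} (h0 : ∀ X, IsZero X → P X)
    (hL : ∀ b ∈ s, P (𝓛.L b))
    (hE : ∀ ⦃X Y Z : C⦄ (i : X ⟶ Y) (p : Y ⟶ Z), IsSES i p → 𝓛.serre s Y → P X → P Z → P Y)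
    (V : C) (hV : 𝓛.serre s V) : P V := by
  induction V using induction_quotient with
  | H V ih =>
    by_cases hz : IsZero V
    · exact h0 V hz
    · obtain ⟨b, i, hi⟩ := 𝓛.exists_mono hz
      have := serre_of_epi (cokernel.π i) hV
      exact hE _ _ (IsSES.of_mono i) hV (hL b (mem_of_mono i hV))
        (ih _ _ (IsSES.of_mono i) (𝓛.not_isZero b) this)

end IrreducibleFamily

end Families

/-- In a split sequence the two summands may exchange roles; used to divide by the complementary
summand. -/
lemma IsSES.swap {C : Type u} [Category.{v} C] [Abelian C] {X Y Z : C} {i : X ⟶ Y} {p : Y ⟶ Z}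
    (h : IsSES i p) {r : Y ⟶ X} {s : Z ⟶ Y} (hr : i ≫ r = 𝟙 X) (hs : s ≫ p = 𝟙 Z)
    (hsr : s ≫ r = 0) : IsSES s r := by
  have : Mono (s ≫ p) := by rw [hs]; infer_instance
  have : Mono s := mono_of_mono s p
  have : Epi (i ≫ r) := by rw [hr]; infer_instance
  have : Epi r := epi_of_epi i r
  refine IsSES.of_lift _ _ hsr fun f hf ↦ ⟨f ≫ p, ?_⟩
  obtain ⟨g, hg⟩ := h.lift (f ≫ p ≫ s - f) (by simp [hs])
  have : g = 0 := by
    have h := hg =≫ r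
    simpa [hr, hsr, hf] using h
  rw [Category.assoc, ← sub_eq_zero, ← hg, this, zero_comp]

/-- If `X` and `X'` are subobjects of `Y` such that `X' ⟶ Y / X` is a monomorphism, then `Y / X'`
is an extension of `(Y / X) / X'` by `X`. -/
lemma IsSES.cross {C : Type u} [Category.{v} C] [Abelian C] {X Y Z X' Z' : C} {a : X ⟶ Y}
    {q : Y ⟶ Z} (h : IsSES a q) {i : X' ⟶ Y} {p : Y ⟶ Z'} (h' : IsSES i p) [Mono (i ≫ q)] :
    ∃ (W : C) (s : X ⟶ W) (t : W ⟶ cokernel (i ≫ q)), IsSES s t ∧ Nonempty (W ≅ Z') := by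
  -- `W` is the sum of `X` and `X'` inside `Y`. It is direct because `i` lifts to a section `σ`, so
  -- `W / X' ≅ X`, while `Y / W` is the cokernel of `i ≫ q`.
  obtain ⟨W, k, s, t, h₁, h₂, h₃, h₄⟩ := (IsSES.of_mono (i ≫ q)).preimage h
  have := h₁.mono
  obtain ⟨σ, hσ⟩ := h₁.lift i (by rw [← Category.assoc, cokernel.condition])
  have hσt : σ ≫ t = 𝟙 X' := by
    rw [← cancel_mono (i ≫ q), Category.assoc, ← h₃, reassoc_of% hσ, Category.id_comp]
  obtain ⟨r, hr, hr'⟩ := h₂.exists_retraction hσt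
  obtain ⟨V, π, c, d, k₁, k₂, -, -⟩ := (h₂.swap hr hσt hr').quotient h₁
  rw [hσ] at k₁
  exact ⟨V, c, d, k₂, k₁.cokernelIso.map2 (fun e e' ↦ e.symm ≪≫ e') h'.cokernelIso⟩

/-- The closure of a class of objects under extensions. -/
inductive Filt {C : Type u} [Category.{v} C] [Abelian C] (Φ : ObjectProperty C) : C → Prop
  | zero {X : C} : IsZero X → Filt Φ X
  | cons {X Y Z : C} {i : X ⟶ Y} {p : Y ⟶ Z} : IsSES i p → Φ X → Filt Φ Z → Filt Φ Y

namespace Filt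

variable {C : Type u} [Category.{v} C] [Abelian C] {Φ : ObjectProperty C}

lemma of_iso {X Y : C} (hX : Filt Φ X) (e : X ≅ Y) : Filt Φ Y := by
  cases hX with
  | zero h => exact zero (h.of_iso e.symm)
  | cons h h' h'' => exact cons (h.comp_mid_iso e) h' h''

/-- `Filt.cons` adds only one section, at the bottom; peeling the sections of `X` off one at a time
gives closure under all extensions. -/
lemma ext {X Y Z : C} {i : X ⟶ Y} {p : Y ⟶ Z} (h : IsSES i p) (hX : Filt Φ X) (hZ : Filt Φ Z) :
    Filt Φ Y := by
  induction hX generalizing Y with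
  | zero h0 =>
    have := h.isIso_right h0
    exact hZ.of_iso (asIso p).symm
  | cons h₁ h' _ ih =>
    obtain ⟨W, π, s, t, k₁, k₂, -, -⟩ := h₁.quotient h
    exact cons k₁ h' (ih k₂)

lemma single {X : C} (h : Φ X) : Filt Φ X :=
  cons (IsSES.of_mono (𝟙 X)) h (zero (isZero_cokernel_of_epi _))

lemma closed {P : C → Prop} (h0 : ∀ X, IsZero X → P X) (h1 : ∀ X, Φ X → P X)
    (hE : ∀ ⦃X Y Z : C⦄ (i : X ⟶ Y) (p : Y ⟶ Z), IsSES i p → P X → P Z → P Y) {X : C}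
    (hX : Filt Φ X) : P X := by
  induction hX with
  | zero h => exact h0 _ h
  | cons h h' _ ih => exact hE _ _ h (h1 _ h') ih

end Filt

/-! ### Standard and costandard objects -/

/-- An irreducible family with a function `rho` to a poset, together with standard and costandard
objects attached to a choice of signs, characterized by homological properties in the category
itself. -/
structure StdData (R : Type u) [Category.{v} R] [Abelian R] (B : Type uB) (Λ : Type uL)
    [PartialOrder Λ] extends IrreducibleFamily R B where
  rho : B → Λ
  plus : Λ → Prop
  std : B → R
  costd : B → R
  head (b : B) : std b ⟶ L b
  socle (b : B) : L b ⟶ costd b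
  epi_head (b : B) : Epi (head b)
  mono_socle (b : B) : Mono (socle b)
  head_essential (b : B) {Y : R} (g : Y ⟶ std b) : Epi (g ≫ head b) → Epi g
  socle_essential (b : B) {Y : R} (g : costd b ⟶ Y) : Mono (socle b ≫ g) → Mono g
  std_le (b : B) : toIrreducibleFamily.serre {c | rho c ≤ rho b} (std b)
  costd_le (b : B) : toIrreducibleFamily.serre {c | rho c ≤ rho b} (costd b)
  std_lt (b : B) {M : R} : toIrreducibleFamily.serre {c | rho c < rho b} M → Ext1Zero (std b) M
  costd_lt (b : B) {M : R} : toIrreducibleFamily.serre {c | rho c < rho b} M →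
    Ext1Zero M (costd b)
  std_plus (b : B) : plus (rho b) → ∀ {M : R},
    toIrreducibleFamily.serre {c | rho c ≤ rho b} M → Ext1Zero (std b) M
  costd_minus (b : B) : ¬ plus (rho b) → ∀ {M : R},
    toIrreducibleFamily.serre {c | rho c ≤ rho b} M → Ext1Zero M (costd b)
  std_minus (b : B) : ¬ plus (rho b) → ∀ {K : R} (i : K ⟶ std b), Mono i → i ≫ head b = 0 →
    toIrreducibleFamily.serre {c | rho c < rho b} K
  costd_plus (b : B) : plus (rho b) → ∀ {Q : R} (p : costd b ⟶ Q), Epi p → socle b ≫ p = 0 →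
    toIrreducibleFamily.serre {c | rho c < rho b} Q

namespace StdData

variable {R : Type u} [Category.{v} R] [Abelian R] {B : Type uB} {Λ : Type uL} [PartialOrder Λ]

/-- The dual data, in the opposite category. -/
def op (D : StdData R B Λ) : StdData Rᵒᵖ B Λ where
  toIrreducibleFamily := D.toIrreducibleFamily.op
  rho := D.rho
  plus l := ¬ D.plus l
  std b := Opposite.op (D.costd b)
  costd b := Opposite.op (D.std b)
  head b := (D.socle b).op
  socle b := (D.head b).op
  epi_head b := by
    have := D.mono_socle b
    exact op_epi_of_mono _
  mono_socle b := by
    have := D.epi_head b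
    exact op_mono_of_epi _
  head_essential b {Y} g hg := by
    have : Mono (D.socle b ≫ g.unop) := @unop_mono_of_epi _ _ _ _ (g ≫ (D.socle b).op) hg
    have := D.socle_essential b g.unop this
    exact op_epi_of_mono g.unop
  socle_essential b {Y} g hg := by
    have : Epi (g.unop ≫ D.head b) := @unop_epi_of_mono _ _ _ _ ((D.head b).op ≫ g) hg
    have := D.head_essential b g.unop this
    exact op_mono_of_epi g.unop
  std_le b := IrreducibleFamily.serre_op.2 (D.costd_le b)
  costd_le b := IrreducibleFamily.serre_op.2 (D.std_le b)
  std_lt b {M} hM := (D.costd_lt b (IrreducibleFamily.serre_unop.2 hM)).op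
  costd_lt b {M} hM := (D.std_lt b (IrreducibleFamily.serre_unop.2 hM)).op
  std_plus b hb {M} hM := (D.costd_minus b hb (IrreducibleFamily.serre_unop.2 hM)).op
  costd_minus b hb {M} hM := (D.std_plus b (not_not.1 hb) (IrreducibleFamily.serre_unop.2 hM)).op
  std_minus b hb {K} i hi h0 := IrreducibleFamily.serre_unop.1
    (D.costd_plus b (not_not.1 hb) i.unop (@unop_epi_of_mono _ _ _ _ i hi) (Quiver.Hom.op_inj h0))
  costd_plus b hb {Q} p hp h0 := IrreducibleFamily.serre_unop.1
    (D.std_minus b hb p.unop (@unop_mono_of_epi _ _ _ _ p hp) (Quiver.Hom.op_inj h0))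

variable (D : StdData R B Λ)

/-- Objects all of whose composition factors have labels with `rho`-values at most `l`. -/
abbrev le (l : Λ) : ObjectProperty R := D.serre {c | D.rho c ≤ l}

/-- Objects all of whose composition factors have labels with `rho`-values less than `l`. -/
abbrev lt (l : Λ) : ObjectProperty R := D.serre {c | D.rho c < l}

/-- Objects without extensions by standard objects. -/
def rightOrth : ObjectProperty R := fun V ↦ ∀ b, Ext1Zero (D.std b) V

/-- Objects without extensions of them by costandard objects. -/
def leftOrth : ObjectProperty R := fun V ↦ ∀ b, Ext1Zero V (D.costd b)

/-- Objects filtered by costandard objects with labels with `rho`-values at least `l`. -/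
def costdFilt (l : Λ) : R → Prop :=
  Filt fun X ↦ ∃ d, l ≤ D.rho d ∧ Nonempty (X ≅ D.costd d)

/-- Each monomorphism from a costandard object `∇(c)` extends to a monomorphism from `∇(c)` to an
object filtered by costandard objects `∇(d)` with `rho d ≥ rho c`. -/
def Effaceable : Prop :=
  ∀ ⦃c : B⦄ ⦃Y : R⦄ (i : D.costd c ⟶ Y), Mono i →
    ∃ (V : R) (f : Y ⟶ V), D.costdFilt (D.rho c) V ∧ Mono (i ≫ f)

variable {D} {s t : Set B}

lemma le_of_lt {l : Λ} {V : R} (h : D.lt l V) : D.le l V :=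
  IrreducibleFamily.serre_mono (fun _ h ↦ _root_.le_of_lt h) h

lemma L_le (b : B) : D.le (D.rho b) (D.L b) := D.serre_L _ b le_rfl

lemma rightOrth_op {V : Rᵒᵖ} : D.op.rightOrth V ↔ D.leftOrth V.unop :=
  ⟨fun h b ↦ (h b).unop, fun h b ↦ (h b).op⟩

lemma leftOrth_op {V : Rᵒᵖ} : D.op.leftOrth V ↔ D.rightOrth V.unop :=
  ⟨fun h b ↦ (h b).unop, fun h b ↦ (h b).op⟩

lemma rightOrth_ext {X Y Z : R} {i : X ⟶ Y} {p : Y ⟶ Z} (h : IsSES i p) (hX : D.rightOrth X)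
    (hZ : D.rightOrth Z) : D.rightOrth Y :=
  fun b ↦ (hX b).ext_right h (hZ b)

lemma rightOrth_iso {X Y : R} (e : X ≅ Y) (h : D.rightOrth X) : D.rightOrth Y :=
  fun b ↦ (h b).of_iso (Iso.refl _) e

lemma leftOrth_ext {X Y Z : R} {i : X ⟶ Y} {p : Y ⟶ Z} (h : IsSES i p) (hX : D.leftOrth X)
    (hZ : D.leftOrth Z) : D.leftOrth Y :=
  fun b ↦ (hX b).ext_left h (hZ b)

lemma leftOrth_iso {X Y : R} (e : X ≅ Y) (h : D.leftOrth X) : D.leftOrth Y :=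
  fun b ↦ (h b).of_iso e (Iso.refl _)

/-! ### Morphisms from standard and to costandard objects -/

lemma head_ne_zero (b : B) : D.head b ≠ 0 := fun h ↦ by
  have := D.epi_head b
  exact D.not_isZero b (IsZero.of_epi_eq_zero _ h)

lemma socle_ne_zero (b : B) : D.socle b ≠ 0 := D.op.head_ne_zero b |> fun h h' ↦ h (by
  change (D.socle b).op = 0
  rw [h', op_zero])

/-- The head is essential, so every non-zero quotient of Δ(b), in particular the image of `f`, maps
onto L(b). -/
lemma mem_of_std_hom_ne_zero {b : B} {M : R} (f : D.std b ⟶ M) (hM : D.serre s M) (hf : f ≠ 0) :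
    b ∈ s := by
  have := D.epi_head b
  let p := Abelian.factorThruImage f
  have hI := IrreducibleFamily.serre_of_mono (Abelian.image.ι f) hM
  by_cases h : kernel.ι p ≫ D.head b = 0
  · obtain ⟨g, hg⟩ := (IsSES.of_epi p).desc _ h
    have : Epi (p ≫ g) := by rw [hg]; infer_instance
    have : Epi g := epi_of_epi p g
    exact IrreducibleFamily.mem_of_epi g hI
  · have := D.head_essential b (kernel.ι p) (IrreducibleFamily.epi_of_ne_zero h)
    have hp : p = 0 := by rw [← cancel_epi (kernel.ι p), kernel.condition, comp_zero]
    exact (hf (by rw [← Abelian.image.fac f]; change p ≫ _ = 0; rw [hp, zero_comp])).elim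

lemma std_hom_eq_zero {b : B} {M : R} (hM : D.serre s M) (hb : b ∉ s) (f : D.std b ⟶ M) :
    f = 0 := by
  by_contra hf
  exact hb (mem_of_std_hom_ne_zero f hM hf)

lemma mem_of_hom_costd_ne_zero {b : B} {M : R} (f : M ⟶ D.costd b) (hM : D.serre s M)
    (hf : f ≠ 0) : b ∈ s :=
  mem_of_std_hom_ne_zero (D := D.op) f.op (IrreducibleFamily.serre_op.2 hM)
    fun h ↦ hf (Quiver.Hom.op_inj h)

lemma hom_costd_eq_zero {b : B} {M : R} (hM : D.serre s M) (hb : b ∉ s) (f : M ⟶ D.costd b) :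
    f = 0 := by
  by_contra hf
  exact hb (mem_of_hom_costd_ne_zero f hM hf)

lemma costd_coker_lt {c : B} (hc : D.plus (D.rho c)) : D.lt (D.rho c) (cokernel (D.socle c)) :=
  D.costd_plus c hc _ inferInstance (cokernel.condition _)

lemma std_ker_lt {c : B} (hc : ¬ D.plus (D.rho c)) : D.lt (D.rho c) (kernel (D.head c)) :=
  D.std_minus c hc _ inferInstance (kernel.condition _)

/-- Comparing head and socle forces ρ(b) = ρ(c). Modulo lower strata ∇(c) is L(c) for sign + and
Δ(b) is L(b) for sign −, so `f` factors through that irreducible object. -/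
lemma eq_of_std_hom_costd {b c : B} (f : D.std b ⟶ D.costd c) (hf : f ≠ 0) : b = c := by
  have h₁ : D.rho b ≤ D.rho c :=
    mem_of_std_hom_ne_zero (s := {e | D.rho e ≤ D.rho c}) f (D.costd_le c) hf
  have h₂ : D.rho c ≤ D.rho b :=
    mem_of_hom_costd_ne_zero (s := {e | D.rho e ≤ D.rho b}) f (D.std_le b) hf
  have := D.epi_head b
  have := D.mono_socle c
  by_cases hc : D.plus (D.rho c)
  · have h0 := std_hom_eq_zero (costd_coker_lt hc) (fun h : D.rho b < D.rho c ↦ h.not_ge h₂)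
      (f ≫ cokernel.π (D.socle c))
    obtain ⟨g, hg⟩ := (IsSES.of_mono (D.socle c)).lift f h0
    exact mem_of_std_hom_ne_zero (s := {c}) g (D.serre_L {c} c rfl)
      fun h ↦ hf (by rw [← hg, h, zero_comp])
  · have hb : ¬ D.plus (D.rho b) := by rwa [h₁.antisymm h₂]
    have h0 := hom_costd_eq_zero (std_ker_lt hb) (fun h : D.rho c < D.rho b ↦ h.not_ge h₁)
      (kernel.ι (D.head b) ≫ f)
    obtain ⟨g, hg⟩ := (IsSES.of_epi (D.head b)).desc f h0
    exact (mem_of_hom_costd_ne_zero (s := {b}) g (D.serre_L {b} b rfl)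
      fun h ↦ hf (by rw [← hg, h, comp_zero])).symm

lemma std_hom_costd_eq_zero {b c : B} (h : b ≠ c) (f : D.std b ⟶ D.costd c) : f = 0 := by
  by_contra hf
  exact h (eq_of_std_hom_costd f hf)

/-- A morphism to an object filtered by costandard objects vanishes if its source has none of
the relevant labels. -/
lemma hom_costdFilt_eq_zero {l : Λ} {M V : R} (hV : D.costdFilt l V) (hM : D.serre s M)
    (h : ∀ d, l ≤ D.rho d → d ∉ s) (f : M ⟶ V) : f = 0 := by
  induction hV with
  | zero h0 => exact h0.eq_of_tgt _ _
  | @cons X Y Z i p hip hX _ ih =>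
    obtain ⟨d, hd, ⟨e⟩⟩ := hX
    obtain ⟨g, hg⟩ := hip.lift f (ih _)
    have := hom_costd_eq_zero hM (h d hd) (g ≫ e.hom)
    rw [← hg, show g = 0 by rw [← cancel_mono e.hom, this, zero_comp], zero_comp]

/-- A subobject of an object filtered by costandard objects `∇(d)` with `rho d ≥ l` lies in the
Serre subcategory for `l` if its labels which are `≥ l` are `≤ l`. -/
lemma le_of_mono_costdFilt {l : Λ} {E V : R} (hV : D.costdFilt l V) (hE : D.serre s E)
    (h : ∀ e ∈ s, l ≤ D.rho e → D.rho e ≤ l) (j : E ⟶ V) [Mono j] : D.le l E := by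
  induction hV generalizing E with
  | zero h0 => exact IrreducibleFamily.serre_of_isZero (IsZero.of_mono j h0)
  | @cons X Y Z i p hip hX _ ih =>
    obtain ⟨d, hd, ⟨e⟩⟩ := hX
    have := hip.mono
    let q := Abelian.factorThruImage (j ≫ p)
    refine IrreducibleFamily.serre_of_ses (IsSES.of_epi q) ?_
      (ih (IrreducibleFamily.serre_of_epi q hE) (Abelian.image.ι (j ≫ p)))
    obtain ⟨g, hg⟩ := hip.lift (kernel.ι q ≫ j) (by
      have hq : q ≫ Abelian.image.ι (j ≫ p) = j ≫ p := Abelian.image.fac _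
      exact (Category.assoc _ _ _).trans ((kernel.ι q ≫= hq.symm).trans (by simp)))
    have : Mono (g ≫ i) := by rw [hg]; infer_instance
    have : Mono g := mono_of_mono g i
    -- `kernel q` is the intersection of `E` with the bottom section ∇(d). If it is non-zero then `d
    -- ∈ s`, and the hypothesis gives ρ(d) ≤ l.
    by_cases hz : IsZero (kernel q)
    · exact IrreducibleFamily.serre_of_isZero hz
    · have := mem_of_hom_costd_ne_zero (g ≫ e.hom)
        (IrreducibleFamily.serre_of_mono (kernel.ι q) hE)
        (fun h0 ↦ hz (IsZero.of_mono_eq_zero (g ≫ e.hom) h0))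
      exact IrreducibleFamily.serre_of_mono (g ≫ e.hom) (IrreducibleFamily.serre_mono
        (fun x hx ↦ le_trans hx (h d this hd)) (D.costd_le d))

/-- For comparable labels this is a property inside one of the categories R_{≤ρ b} and R_{≤ρ c};
effaceability is needed only for incomparable ones. -/
lemma ext1Zero_std_costd (hD : D.Effaceable) (b c : B) : Ext1Zero (D.std b) (D.costd c) := by
  by_cases hcb : D.rho c ≤ D.rho b
  · rcases hcb.lt_or_eq with h | h
    · exact D.std_lt b (IrreducibleFamily.serre_mono (fun x hx ↦ lt_of_le_of_lt hx h)
        (D.costd_le c))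
    · by_cases hp : D.plus (D.rho b)
      · exact D.std_plus b hp (by rw [← h]; exact D.costd_le c)
      · exact D.costd_minus c (by rwa [h]) (by rw [h]; exact D.std_le b)
  by_cases hbc : D.rho b < D.rho c
  · exact D.costd_lt c (IrreducibleFamily.serre_mono (fun x hx ↦ lt_of_le_of_lt hx hbc)
      (D.std_le b))
  -- Incomparable labels: effaceability gives a quotient of `E` that contains ∇(c) and embeds in a
  -- ∇-filtered object, hence lies in R_{≤ρ c}. Its quotient by ∇(c) is also a quotient of Δ(b), so
  -- it vanishes, and the map from `E` onto this copy of ∇(c) is a retraction.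
  intro E i p hip
  obtain ⟨V, f, hV, hf⟩ := hD i hip.mono
  let π := Abelian.factorThruImage f
  have hπ : π ≫ Abelian.image.ι f = f := Abelian.image.fac f
  have : Mono ((i ≫ π) ≫ Abelian.image.ι f) := by rwa [Category.assoc, hπ]
  have : Mono (i ≫ π) := mono_of_mono _ (Abelian.image.ι f)
  have hE : D.serre {e | D.rho e ≤ D.rho b ∨ D.rho e ≤ D.rho c} E :=
    IrreducibleFamily.serre_of_ses hip
      (IrreducibleFamily.serre_mono (fun _ h ↦ Or.inr h) (D.costd_le c))
      (IrreducibleFamily.serre_mono (fun _ h ↦ Or.inl h) (D.std_le b))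
  have hI := le_of_mono_costdFilt hV (IrreducibleFamily.serre_of_epi π hE)
    (fun e he h ↦ he.elim (fun he ↦ (hcb (h.trans he)).elim) id) (Abelian.image.ι f)
  have hb : ¬ D.rho b ≤ D.rho c := fun h ↦ hbc (lt_of_le_not_ge h hcb)
  obtain ⟨g, hg⟩ := hip.desc (π ≫ cokernel.π (i ≫ π))
    (by rw [← Category.assoc, cokernel.condition])
  have hg0 := std_hom_eq_zero (IrreducibleFamily.serre_of_epi (cokernel.π (i ≫ π)) hI) hb g
  have h0 : cokernel.π (i ≫ π) = 0 := by
    rw [← cancel_epi π, ← hg, hg0, comp_zero, comp_zero]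
  have : Epi (i ≫ π) := Abelian.epi_of_cokernel_π_eq_zero _ h0
  have : IsIso (i ≫ π) := isIso_of_mono_of_epi _
  exact ⟨π ≫ inv (i ≫ π), by rw [← Category.assoc, IsIso.hom_inv_id]⟩

/-! ### Cokernels of embeddings of costandard objects -/

section

variable [AllFiniteLength R] (h1 : ∀ b c, Ext1Zero (D.std b) (D.costd c))
include h1

/-- It suffices to treat M = L(e), where an extension class dies in ∇(e) and would have to come from
a map Δ(d) → ∇(e)/L(e), which is zero. -/
lemma ext1Zero_std_of_serre {d : B} {M : R} (hM : D.serre {e | ¬ D.rho d ≤ D.rho e} M) :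
    Ext1Zero (D.std d) M := by
  refine D.serre_induction (P := fun M ↦ Ext1Zero (D.std d) M)
    (fun _ ↦ Ext1Zero.of_isZero_right) (fun e he ↦ ?_)
    (fun X Y Z i p h _ hX hZ ↦ hX.ext_right h hZ) M hM
  have := D.mono_socle e
  exact (h1 d e).of_hom_eq_zero_right (IsSES.of_mono (D.socle e)) (std_hom_eq_zero
    (IrreducibleFamily.serre_of_epi (cokernel.π (D.socle e)) (D.costd_le e)) he)

lemma ext1Zero_costd_of_serre {d : B} {M : R} (hM : D.serre {e | ¬ D.rho d ≤ D.rho e} M) :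
    Ext1Zero M (D.costd d) :=
  (ext1Zero_std_of_serre (D := D.op) (fun b c ↦ (h1 c b).op)
    (IrreducibleFamily.serre_op.2 hM)).unop

omit [AllFiniteLength R] in
lemma rightOrth_of_costdFilt {l : Λ} {V : R} (hV : D.costdFilt l V) : D.rightOrth V :=
  hV.closed (fun _ h _ ↦ Ext1Zero.of_isZero_right h)
    (fun _ ⟨d, _, ⟨e⟩⟩ ↦ rightOrth_iso e.symm fun b ↦ h1 b d)
    fun _ _ _ _ _ h hX hZ ↦ rightOrth_ext h hX hZ

omit [AllFiniteLength R] in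
/-- An object filtered by costandard objects `∇(d)` with `rho d ≥ l` has a largest subobject in
the Serre subcategory for `l`, and it is filtered by costandard objects, as is the quotient. -/
lemma exists_largest_le {l : Λ} {V : R} (hV : D.costdFilt l V) :
    ∃ (W Q : R) (i : W ⟶ V) (p : V ⟶ Q), IsSES i p ∧ D.le l W ∧ D.rightOrth W ∧
      D.rightOrth Q ∧ ∀ ⦃M : R⦄ (f : M ⟶ Q), D.le l M → f = 0 := by
  induction hV with
  | @zero X h0 =>
    have hz : IsZero (cokernel (𝟙 X)) := isZero_cokernel_of_epi _
    exact ⟨X, _, 𝟙 X, _, IsSES.of_mono _, IrreducibleFamily.serre_of_isZero h0,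
      fun _ ↦ Ext1Zero.of_isZero_right h0, fun _ ↦ Ext1Zero.of_isZero_right hz,
      fun M f _ ↦ hz.eq_of_tgt _ _⟩
  | @cons X Y Z i p hip hX hZ ih =>
    obtain ⟨d, hd, ⟨e⟩⟩ := hX
    obtain ⟨W', Q', i', p', k, hW', hW'o, hQ', hM⟩ := ih
    obtain ⟨W, j, s, t, k₁, k₂, k₃, k₄⟩ := k.preimage hip
    have hXo : D.rightOrth X := rightOrth_iso e.symm fun b ↦ h1 b d
    by_cases hdl : D.rho d ≤ l
    · refine ⟨W, Q', j, p ≫ p', k₁, IrreducibleFamily.serre_of_ses k₂ ?_ hW',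
        rightOrth_ext k₂ hXo hW'o, hQ', hM⟩
      exact IrreducibleFamily.serre_of_mono e.hom
        (IrreducibleFamily.serre_mono (fun x hx ↦ le_trans hx hdl) (D.costd_le d))
    -- Now ρ(d) > l, so `W'` has no extensions by ∇(d) and lifts to the larger object. The section
    -- ∇(d) moves into the quotient.
    · have hs : Ext1Zero W' X := (D.costd_lt d (IrreducibleFamily.serre_mono
        (fun x hx ↦ lt_of_le_of_lt hx (lt_of_le_not_ge hd hdl)) hW')).of_iso (Iso.refl _) e.symm
      obtain ⟨σ, hσ⟩ := hs.exists_section k₂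
      obtain ⟨r, hr, hr'⟩ := k₂.exists_retraction hσ
      obtain ⟨V', π, c, c', m₁, m₂, -, -⟩ := (k₂.swap hr hσ hr').quotient k₁
      refine ⟨W', V', _, _, m₁, hW', hW'o, rightOrth_ext m₂ hXo hQ', fun M f hf ↦ ?_⟩
      obtain ⟨g, hg⟩ := m₂.lift f (hM _ hf)
      have := hom_costd_eq_zero hf hdl (g ≫ e.hom)
      rw [← hg, show g = 0 by rw [← cancel_mono e.hom, this, zero_comp], zero_comp]

/-- Induction on the flag of `V`. Either ∇(c) still embeds after dividing by the bottom section, or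
the map to the quotient kills its socle. In the latter case it factors through ∇(c)/L(c), which lies
in lower strata, so it is zero; then ∇(c) is the bottom section itself. -/
lemma rightOrth_cokernel_plus {c : B} (hc : D.plus (D.rho c)) {V Q : R}
    (hV : D.costdFilt (D.rho c) V) (i : D.costd c ⟶ V) (p : V ⟶ Q) (hip : IsSES i p) :
    D.rightOrth Q := by
  have := D.mono_socle c
  induction hV generalizing Q with
  | zero h0 =>
    have := hip.mono
    exact (D.not_isZero c (IsZero.of_mono (D.socle c ≫ i) h0)).elim
  | @cons X Y Z a q haq hX hZ ih =>
    obtain ⟨d, hd, ⟨e⟩⟩ := hX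
    by_cases hm : Mono (i ≫ q)
    · obtain ⟨W, s, t, k, ⟨e'⟩⟩ := haq.cross hip
      exact rightOrth_iso e' (rightOrth_ext k (rightOrth_iso e.symm fun b ↦ h1 b d)
        (ih _ _ (IsSES.of_mono (i ≫ q))))
    · have h0 : D.socle c ≫ i ≫ q = 0 := by
        by_contra hne
        exact hm (D.socle_essential c _ (IrreducibleFamily.mono_of_ne_zero hne))
      obtain ⟨g, hg⟩ := (IsSES.of_mono (D.socle c)).desc _ h0
      have hg0 := hom_costdFilt_eq_zero hZ (costd_coker_lt hc)
        (fun d hd (h : D.rho d < D.rho c) ↦ h.not_ge hd) g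
      obtain ⟨f, hf⟩ := haq.lift i (by rw [← hg, hg0, comp_zero])
      have := hip.mono
      have : Mono (f ≫ a) := by rw [hf]; infer_instance
      have : Mono f := mono_of_mono f a
      have hne : (D.socle c ≫ f ≫ e.hom) ≠ 0 := fun h ↦
        D.not_isZero c (IsZero.of_mono_eq_zero _ h)
      obtain rfl : d = c := mem_of_hom_costd_ne_zero (s := {c}) _ (D.serre_L {c} c rfl) hne
      have := isIso_of_mono_endo (f ≫ e.hom)
      have : IsIso f := IsIso.of_isIso_comp_right f e.hom
      have h2 : IsSES i q := by
        rw [← hf]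
        exact haq.comp_left_iso f
      obtain ⟨e₁⟩ := h2.cokernelIso
      obtain ⟨e₂⟩ := hip.cokernelIso
      exact rightOrth_iso (e₁.symm ≪≫ e₂) (rightOrth_of_costdFilt h1 hZ)

/-- For sign −, ∇(c) lies in the largest subobject W of `V` in R_{≤ρ c} and splits off it, having
the injectivity property there. So W/∇(c) is a summand of W, and V/∇(c) extends V/W by it. -/
lemma rightOrth_cokernel {c : B} {V Q : R} (hV : D.costdFilt (D.rho c) V) (i : D.costd c ⟶ V)
    (p : V ⟶ Q) (hip : IsSES i p) : D.rightOrth Q := by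
  by_cases hc : D.plus (D.rho c)
  · exact rightOrth_cokernel_plus h1 hc hV i p hip
  obtain ⟨W, Q', j, q, k, hW, hWo, hQ', h0⟩ := exists_largest_le h1 hV
  have := hip.mono
  obtain ⟨f, hf⟩ := k.lift i (h0 _ (D.costd_le c))
  have : Mono (f ≫ j) := by rw [hf]; infer_instance
  have : Mono f := mono_of_mono f j
  obtain ⟨σ, hσ⟩ := (D.costd_minus c hc (IrreducibleFamily.serre_of_epi (cokernel.π f)
    hW)).exists_section (IsSES.of_mono f)
  obtain ⟨V', π, c', d', k₁, k₂, -, -⟩ := (IsSES.of_mono f).quotient k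
  rw [hf] at k₁
  obtain ⟨e₁⟩ := k₁.cokernelIso
  obtain ⟨e₂⟩ := hip.cokernelIso
  exact rightOrth_iso (e₁.symm ≪≫ e₂) (rightOrth_ext k₂
    (fun b ↦ (hWo b).of_retract_right σ _ hσ) hQ')

end

lemma ext2Zero_std_costd [AllFiniteLength R] (hD : D.Effaceable) (b c : B) :
    Ext2Zero (D.std b) (D.costd c) := by
  refine Ext2Zero.of_effaceable fun Y a ha ↦ ?_
  obtain ⟨V, f, hV, hf⟩ := hD a ha
  exact ⟨V, _, f, _, IsSES.of_mono (a ≫ f), rightOrth_cokernel (ext1Zero_std_costd hD) hV _ _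
    (IsSES.of_mono (a ≫ f)) b⟩

end StdData

/-- The part `Ext¹(X, A) ⟶ Ext¹(X', A) ⟶ Ext²(X'', A)` of the long exact sequence. -/
lemma Ext1Zero.of_ext2Zero_left {C : Type u} [Category.{v} C] [Abelian C] {A X' X X'' : C}
    {s : X' ⟶ X} {t : X ⟶ X''} (h : IsSES s t) (H : Ext1Zero X A) (H2 : Ext2Zero X'' A) :
    Ext1Zero X' A :=
  (Ext1Zero.of_ext2Zero_right h.op H.op H2.op).unop

/-- Each morphism factors as an epimorphism followed by a monomorphism. -/
lemma exists_factorization {C : Type u} [Category.{v} C] [Abelian C] {X Y : C} (f : X ⟶ Y) :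
    ∃ (J : C) (π : X ⟶ J) (m : J ⟶ Y), Epi π ∧ Mono m ∧ π ≫ m = f :=
  ⟨_, Abelian.factorThruImage f, Abelian.image.ι f, inferInstance, inferInstance,
    Abelian.image.fac f⟩

/-! ### Recognizing flags by the vanishing of extensions -/

namespace StdData

variable {R : Type u} [Category.{v} R] [Abelian R] {B : Type uB} {Λ : Type uL} [PartialOrder Λ]

/-- The vanishing of `Ext¹` and `Ext²` from standard to costandard objects, and the
well-foundedness of the order on labels. -/
structure IsStratified (D : StdData R B Λ) : Prop where
  ext1 (b c : B) : Ext1Zero (D.std b) (D.costd c)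
  ext2 (b c : B) : Ext2Zero (D.std b) (D.costd c)
  wf : WellFounded fun b c ↦ D.rho b < D.rho c

variable {D : StdData R B Λ}

lemma IsStratified.op (hD : D.IsStratified) : D.op.IsStratified :=
  ⟨fun b c ↦ (hD.ext1 c b).op, fun b c ↦ (hD.ext2 c b).op, hD.wf⟩

lemma rightOrth_costd (hD : D.IsStratified) (b : B) : D.rightOrth (D.costd b) :=
  fun c ↦ hD.ext1 c b

lemma leftOrth_std (hD : D.IsStratified) (b : B) : D.leftOrth (D.std b) := fun c ↦ hD.ext1 b c

variable [AllFiniteLength R]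

/-- Take L(b) in `V` with ρ(b) minimal. Nothing from strata below ρ(b) maps to `V`, so 0 → K → Δ(c)
→ L(c) → 0 shows that L(c) has no extensions by `V` whenever K lies below ρ(b). This covers the
factors of ∇(b)/L(b) for either sign. Hence L(b) → V extends to ∇(b), injectively by essentiality of
the socle; Ext² vanishing handles the cokernel. -/
lemma exists_costd_mono (hD : D.IsStratified) {V : R} (hV : D.rightOrth V) (h0 : ¬ IsZero V) :
    ∃ (b : B) (i : D.costd b ⟶ V), Mono i ∧ D.rightOrth (cokernel i) := by
  obtain ⟨b, ⟨i, hi⟩, hmin⟩ := hD.wf.has_min {b | ∃ i : D.L b ⟶ V, i ≠ 0} (by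
    obtain ⟨b, i, hi⟩ := D.exists_mono h0
    exact ⟨b, i, fun h ↦ D.not_isZero b (IsZero.of_mono_eq_zero i h)⟩)
  have hlt : ∀ {M : R}, D.lt (D.rho b) M → ∀ f : M ⟶ V, f = 0 := by
    intro M hM f
    by_contra hf
    have hI : ¬ IsZero (Abelian.image f) := fun hz ↦ hf (by
      rw [← Abelian.image.fac f, hz.eq_of_src (Abelian.image.ι f) 0, comp_zero])
    obtain ⟨d, j, hj⟩ := D.exists_mono hI
    refine hmin d ⟨j ≫ Abelian.image.ι f, fun h ↦
      D.not_isZero d (IsZero.of_mono_eq_zero (j ≫ Abelian.image.ι f) h)⟩ ?_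
    exact IrreducibleFamily.mem_of_mono (s := {e | D.rho e < D.rho b}) j
      (IrreducibleFamily.serre_of_epi (Abelian.factorThruImage f) hM)
  have hL : ∀ c, D.lt (D.rho b) (kernel (D.head c)) → Ext1Zero (D.L c) V := fun c hc ↦ by
    have := D.epi_head c
    exact (hV c).of_hom_eq_zero_left (IsSES.of_epi (D.head c)) (hlt hc)
  have hL' : ∀ c, D.rho c < D.rho b → Ext1Zero (D.L c) V := fun c hc ↦
    hL c (IrreducibleFamily.serre_of_mono (kernel.ι _)
      (IrreducibleFamily.serre_mono (fun x hx ↦ lt_of_le_of_lt hx hc) (D.std_le c)))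
  have := D.mono_socle b
  have hext : Ext1Zero (cokernel (D.socle b)) V := by
    by_cases hb : D.plus (D.rho b)
    · exact D.serre_induction (P := fun M ↦ Ext1Zero M V) (fun _ ↦ Ext1Zero.of_isZero_left)
        hL' (fun X Y Z i p h _ hX hZ ↦ hX.ext_left h hZ) _ (costd_coker_lt hb)
    · refine D.serre_induction (P := fun M ↦ Ext1Zero M V) (fun _ ↦ Ext1Zero.of_isZero_left)
        (fun c (hc : D.rho c ≤ D.rho b) ↦ ?_) (fun X Y Z i p h _ hX hZ ↦ hX.ext_left h hZ) _
        (IrreducibleFamily.serre_of_epi (cokernel.π (D.socle b)) (D.costd_le b))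
      rcases hc.lt_or_eq with h | h
      · exact hL' c h
      · refine hL c ?_
        rw [← h]
        exact std_ker_lt (by rwa [h])
  obtain ⟨g, hg⟩ := hext.extend (IsSES.of_mono (D.socle b)) i
  have : Mono g := D.socle_essential b g (by
    rw [hg]
    exact IrreducibleFamily.mono_of_ne_zero hi)
  exact ⟨b, g, this, fun c ↦ (hV c).of_ext2Zero_right (IsSES.of_mono g) (hD.ext2 c b)⟩

/-- An object without extensions by standard objects is filtered by costandard objects. -/
lemma filt_of_rightOrth (hD : D.IsStratified) (V : R) (hV : D.rightOrth V) :
    Filt (fun X ↦ ∃ d, Nonempty (X ≅ D.costd d)) V := by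
  induction V using induction_quotient with
  | H V ih =>
    by_cases h0 : IsZero V
    · exact Filt.zero h0
    · obtain ⟨b, i, hi, hb⟩ := exists_costd_mono hD hV h0
      have hz : ¬ IsZero (D.costd b) := fun h ↦ by
        have := D.mono_socle b
        exact D.not_isZero b (IsZero.of_mono (D.socle b) h)
      exact Filt.cons (IsSES.of_mono i) ⟨b, ⟨Iso.refl _⟩⟩ (ih _ _ (IsSES.of_mono i) hz hb)

lemma rightOrth_induction (hD : D.IsStratified) {P : R → Prop} (h0 : ∀ X, IsZero X → P X)
    (h1 : ∀ X b, Nonempty (X ≅ D.costd b) → P X)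
    (hE : ∀ ⦃X Y Z : R⦄ (i : X ⟶ Y) (p : Y ⟶ Z), IsSES i p → P X → P Z → P Y) {V : R}
    (hV : D.rightOrth V) : P V :=
  (filt_of_rightOrth hD V hV).closed h0 (fun _ ⟨b, hb⟩ ↦ h1 _ b hb) hE

lemma leftOrth_induction (hD : D.IsStratified) {P : R → Prop} (h0 : ∀ X, IsZero X → P X)
    (h1 : ∀ X b, Nonempty (X ≅ D.std b) → P X)
    (hE : ∀ ⦃X Y Z : R⦄ (i : X ⟶ Y) (p : Y ⟶ Z), IsSES i p → P X → P Z → P Y) {V : R}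
    (hV : D.leftOrth V) : P V :=
  rightOrth_induction hD.op (P := fun V ↦ P V.unop) (fun _ hX ↦ h0 _ hX.unop)
    (fun _ b ⟨e⟩ ↦ h1 _ b ⟨e.unop.symm⟩) (fun _ _ _ _ _ h hX hZ ↦ hE _ _ h.unop hZ hX)
    (V := Opposite.op V) (rightOrth_op.2 hV)

lemma ext1Zero_of_orth (hD : D.IsStratified) {Z Y : R} (hZ : D.leftOrth Z)
    (hY : D.rightOrth Y) : Ext1Zero Z Y :=
  rightOrth_induction hD (P := fun Y ↦ Ext1Zero Z Y) (fun _ ↦ Ext1Zero.of_isZero_right)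
    (fun _ b ⟨e⟩ ↦ (hZ b).of_iso (Iso.refl _) e.symm)
    (fun _ _ _ _ _ h hX hZ ↦ hX.ext_right h hZ) hY

lemma ext2Zero_of_orth (hD : D.IsStratified) {Z Y : R} (hZ : D.leftOrth Z)
    (hY : D.rightOrth Y) : Ext2Zero Z Y := by
  refine leftOrth_induction hD (P := fun Z ↦ Ext2Zero Z Y) (fun Z h ↦ ?_) (fun Z b ⟨e⟩ ↦ ?_)
    (fun _ _ _ _ _ h hX hZ ↦ hX.ext_left h hZ) hZ
  · exact (Ext2Zero.of_isZero_right (X := Opposite.op Y) h.op).unop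
  · refine rightOrth_induction hD (P := fun Y ↦ Ext2Zero Z Y)
      (fun _ ↦ Ext2Zero.of_isZero_right)
      (fun _ c ⟨e'⟩ ↦ (Ext2Zero.of_iso_right ?_ e'.symm))
      (fun _ _ _ _ _ h hX hZ ↦ hX.ext_right h hZ) hY
    exact ((hD.ext2 b c).op.of_iso_right e.symm.op.symm).unop

/-! ### Approximations -/

variable (D) in
omit [AllFiniteLength R] in
/-- `X` is a quotient of an object without extensions by costandard objects, with labels in `t`,
by an object without extensions by standard objects, with labels in `s`. -/
def LeftApprox (s t : Set B) (X : R) : Prop :=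
  ∃ (Y Z : R) (i : Y ⟶ Z) (p : Z ⟶ X), IsSES i p ∧ D.rightOrth Y ∧ D.leftOrth Z ∧
    D.serre s Y ∧ D.serre t Z

variable (D) in
omit [AllFiniteLength R] in
/-- `X` is a subobject of an object without extensions by standard objects, with labels in `s`,
and the quotient has no extensions by costandard objects and has labels in `t`. -/
def RightApprox (s t : Set B) (X : R) : Prop :=
  ∃ (Y Z : R) (i : X ⟶ Y) (p : Y ⟶ Z), IsSES i p ∧ D.rightOrth Y ∧ D.leftOrth Z ∧
    D.serre s Y ∧ D.serre t Z

variable {s t : Set B}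

omit [AllFiniteLength R] in
lemma LeftApprox.op {X : R} (h : D.LeftApprox s t X) : D.op.RightApprox t s (Opposite.op X) := by
  obtain ⟨Y, Z, i, p, h, h₁, h₂, h₃, h₄⟩ := h
  exact ⟨_, _, p.op, i.op, h.op, rightOrth_op.2 h₂, leftOrth_op.2 h₁,
    IrreducibleFamily.serre_op.2 h₄, IrreducibleFamily.serre_op.2 h₃⟩

omit [AllFiniteLength R] in
lemma RightApprox.op {X : R} (h : D.RightApprox s t X) :
    D.op.LeftApprox t s (Opposite.op X) := by
  obtain ⟨Y, Z, i, p, h, h₁, h₂, h₃, h₄⟩ := h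
  exact ⟨_, _, p.op, i.op, h.op, rightOrth_op.2 h₂, leftOrth_op.2 h₁,
    IrreducibleFamily.serre_op.2 h₄, IrreducibleFamily.serre_op.2 h₃⟩

omit [AllFiniteLength R] in
lemma LeftApprox.of_op {X : Rᵒᵖ} (h : D.op.LeftApprox s t X) : D.RightApprox t s X.unop := by
  obtain ⟨Y, Z, i, p, h, h₁, h₂, h₃, h₄⟩ := h
  exact ⟨_, _, p.unop, i.unop, h.unop, leftOrth_op.1 h₂, rightOrth_op.1 h₁,
    IrreducibleFamily.serre_unop.2 h₄, IrreducibleFamily.serre_unop.2 h₃⟩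

omit [AllFiniteLength R] in
lemma RightApprox.of_op {X : Rᵒᵖ} (h : D.op.RightApprox s t X) : D.LeftApprox t s X.unop := by
  obtain ⟨Y, Z, i, p, h, h₁, h₂, h₃, h₄⟩ := h
  exact ⟨_, _, p.unop, i.unop, h.unop, leftOrth_op.1 h₂, rightOrth_op.1 h₁,
    IrreducibleFamily.serre_unop.2 h₄, IrreducibleFamily.serre_unop.2 h₃⟩

omit [AllFiniteLength R] in
lemma LeftApprox.mono {s' t' : Set B} {X : R} (h : D.LeftApprox s t X) (hs : s ⊆ s')
    (ht : t ⊆ t') : D.LeftApprox s' t' X := by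
  obtain ⟨Y, Z, i, p, h, h₁, h₂, h₃, h₄⟩ := h
  exact ⟨_, _, i, p, h, h₁, h₂, IrreducibleFamily.serre_mono hs h₃,
    IrreducibleFamily.serre_mono ht h₄⟩

omit [AllFiniteLength R] in
lemma RightApprox.mono {s' t' : Set B} {X : R} (h : D.RightApprox s t X) (hs : s ⊆ s')
    (ht : t ⊆ t') : D.RightApprox s' t' X := by
  obtain ⟨Y, Z, i, p, h, h₁, h₂, h₃, h₄⟩ := h
  exact ⟨_, _, i, p, h, h₁, h₂, IrreducibleFamily.serre_mono hs h₃,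
    IrreducibleFamily.serre_mono ht h₄⟩

omit [AllFiniteLength R] in
lemma LeftApprox.of_isZero {X : R} (h : IsZero X) : D.LeftApprox s t X := by
  have hz : IsZero (kernel (𝟙 X)) := isZero_kernel_of_mono _
  exact ⟨_, X, _, _, IsSES.of_epi (𝟙 X), fun _ ↦ Ext1Zero.of_isZero_right hz,
    fun _ ↦ Ext1Zero.of_isZero_left h, IrreducibleFamily.serre_of_isZero hz,
    IrreducibleFamily.serre_of_isZero h⟩

/-- A horseshoe lemma. Pulling `X` back to `Z''` gives an extension of `Z''` by `X'`; the
obstruction to lifting it to an extension `G` of `Z''` by `Z'` lies in Ext²(Z'', Y') = 0. The kernel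
of `G ⟶ X` is an extension of `Y''` by `Y'`. -/
lemma LeftApprox.ext (hD : D.IsStratified) {X' X X'' : R} {i : X' ⟶ X} {p : X ⟶ X''}
    (h : IsSES i p) (h' : D.LeftApprox s t X') (h'' : D.LeftApprox s t X'') :
    D.LeftApprox s t X := by
  obtain ⟨Y', Z', a', b', k', hY', hZ', sY', sZ'⟩ := h'
  obtain ⟨Y'', Z'', a'', b'', k'', hY'', hZ'', sY'', sZ''⟩ := h''
  obtain ⟨X₁, c, d, e, g, m₁, m₂, -, -, -⟩ := h.pullback_epi k''
  obtain ⟨G, j, r, n₁, n₂, -⟩ := ext2Zero_of_orth hD hZ'' hY' a' b' c d k' m₁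
  obtain ⟨W, k, σ, τ, l₁, l₂, -, -⟩ := m₂.preimage n₂
  exact ⟨W, G, k, _, l₁, rightOrth_ext l₂ hY' hY'', leftOrth_ext n₁ hZ' hZ'',
    IrreducibleFamily.serre_of_ses l₂ sY' sY'', IrreducibleFamily.serre_of_ses n₁ sZ' sZ''⟩

lemma LeftApprox.of_serre (hD : D.IsStratified) {r : Set B}
    (h : ∀ c ∈ r, D.LeftApprox s t (D.L c)) {X : R} (hX : D.serre r X) : D.LeftApprox s t X :=
  D.serre_induction (P := fun X ↦ D.LeftApprox s t X) (fun _ ↦ .of_isZero) h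
    (fun _ _ _ _ _ h _ hX hZ ↦ .ext hD h hX hZ) X hX

lemma RightApprox.of_serre (hD : D.IsStratified) {r : Set B}
    (h : ∀ c ∈ r, D.RightApprox s t (D.L c)) {X : R} (hX : D.serre r X) :
    D.RightApprox s t X :=
  (LeftApprox.of_serre hD.op (fun c hc ↦ (h c hc).op)
    (IrreducibleFamily.serre_op.2 hX)).of_op

omit [AllFiniteLength R] in
-- For sign − the kernel of Δ(c) → L(c) lies in lower strata. Pushing out along its right
-- approximation enlarges Δ(c) by a Δ-filtered object and makes the kernel ∇-filtered.
lemma leftApprox_L_of_minus (hD : D.IsStratified) {c : B} (hc : ¬ D.plus (D.rho c))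
    (h : ∀ X, D.lt (D.rho c) X →
      D.RightApprox {b | D.rho b < D.rho c} {b | D.rho b < D.rho c} X) :
    D.LeftApprox {b | D.rho b < D.rho c} {b | D.rho b ≤ D.rho c} (D.L c) := by
  have := D.epi_head c
  obtain ⟨Y, Z, i, p, k, hY, hZ, sY, sZ⟩ := h _ (std_ker_lt hc)
  obtain ⟨Y', i', p', g, k', h₁, h₂, -, -, -⟩ := (IsSES.of_epi (D.head c)).pushout_mono k
  exact ⟨Y, Y', i', p', h₁, hY, leftOrth_ext h₂ (leftOrth_std hD c) hZ, sY,
    IrreducibleFamily.serre_of_ses h₂ (D.std_le c) (le_of_lt sZ)⟩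

lemma leftApprox_of_minus (hD : D.IsStratified) {l : Λ} (hl : ¬ D.plus l)
    (h : ∀ c, D.rho c < l → D.LeftApprox {b | D.rho b < l} {b | D.rho b < l} (D.L c))
    (h' : ∀ c, D.rho c < l → D.RightApprox {b | D.rho b < l} {b | D.rho b < l} (D.L c))
    {X : R} (hX : D.le l X) :
    D.LeftApprox {b | D.rho b < l} {b | D.rho b ≤ l} X := by
  refine LeftApprox.of_serre hD (fun c (hc : D.rho c ≤ l) ↦ ?_) hX
  rcases hc.lt_or_eq with hc | rfl
  · exact (h c hc).mono subset_rfl fun _ hx ↦ _root_.le_of_lt hx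
  · exact leftApprox_L_of_minus hD hl fun X hX ↦ RightApprox.of_serre hD h' hX

/-- The left approximation must come first, and for all of R_{≤ρ c}: the right one is obtained from
0 → L(c) → ∇(c) → ∇(c)/L(c) → 0 by pulling back along a left approximation of the quotient, which
may again involve labels in the stratum ρ(c). -/
lemma approx_L_of_minus (hD : D.IsStratified) {c : B} (hc : ¬ D.plus (D.rho c))
    (h : ∀ d, D.rho d < D.rho c →
      D.LeftApprox {b | D.rho b < D.rho c} {b | D.rho b < D.rho c} (D.L d))
    (h' : ∀ d, D.rho d < D.rho c →
      D.RightApprox {b | D.rho b < D.rho c} {b | D.rho b < D.rho c} (D.L d)) :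
    D.LeftApprox {b | D.rho b ≤ D.rho c} {b | D.rho b ≤ D.rho c} (D.L c) ∧
      D.RightApprox {b | D.rho b ≤ D.rho c} {b | D.rho b ≤ D.rho c} (D.L c) := by
  have := D.mono_socle c
  have hall := fun {X : R} ↦ leftApprox_of_minus hD hc h h' (X := X)
  refine ⟨(hall (L_le c)).mono (fun _ hx ↦ _root_.le_of_lt hx) subset_rfl, ?_⟩
  obtain ⟨Y, Z, i, p, k, hY, hZ, sY, sZ⟩ := hall
    (IrreducibleFamily.serre_of_epi (cokernel.π (D.socle c)) (D.costd_le c))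
  obtain ⟨Y₁, i', p', k', g, h₁, h₂, -, -, -⟩ := (IsSES.of_mono (D.socle c)).pullback_epi k
  exact ⟨Y₁, Z, i', p', h₁, rightOrth_ext h₂ hY (rightOrth_costd hD c), hZ,
    IrreducibleFamily.serre_of_ses h₂ (le_of_lt sY) (D.costd_le c), sZ⟩

lemma approx_L (hD : D.IsStratified) (c : B) :
    D.LeftApprox {b | D.rho b ≤ D.rho c} {b | D.rho b ≤ D.rho c} (D.L c) ∧
      D.RightApprox {b | D.rho b ≤ D.rho c} {b | D.rho b ≤ D.rho c} (D.L c) := by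
  induction c using hD.wf.induction with
  | h c ih =>
    have hsub : ∀ d, D.rho d < D.rho c → {b | D.rho b ≤ D.rho d} ⊆ {b | D.rho b < D.rho c} :=
      fun d hd x hx ↦ lt_of_le_of_lt hx hd
    have h₁ := fun d hd ↦ (ih d hd).1.mono (hsub d hd) (hsub d hd)
    have h₂ := fun d hd ↦ (ih d hd).2.mono (hsub d hd) (hsub d hd)
    by_cases hc : D.plus (D.rho c)
    -- Duality reverses the sign and exchanges the two kinds of approximation.
    · obtain ⟨k₁, k₂⟩ := approx_L_of_minus hD.op (c := c) (not_not.2 hc)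
        (fun d hd ↦ (h₂ d hd).op) (fun d hd ↦ (h₁ d hd).op)
      exact ⟨k₂.of_op, k₁.of_op⟩
    · exact approx_L_of_minus hD hc h₁ h₂

/-- The strict bound on the labels of the Δ-filtered quotient is the point: applied to Δ(b), nothing
else from the stratum of `b` is added. -/
lemma rightApprox_of_plus (hD : D.IsStratified) {l : Λ} (hl : D.plus l) {X : R}
    (hX : D.le l X) : D.RightApprox {b | D.rho b ≤ l} {b | D.rho b < l} X := by
  have hsub : ∀ c, D.rho c < l → {b | D.rho b ≤ D.rho c} ⊆ {b | D.rho b < l} :=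
    fun d hd x hx ↦ lt_of_le_of_lt hx hd
  exact (leftApprox_of_minus hD.op (l := l) (not_not.2 hl)
    (fun c hc ↦ ((approx_L hD c).2.mono (hsub c hc) (hsub c hc)).op)
    (fun c hc ↦ ((approx_L hD c).1.mono (hsub c hc) (hsub c hc)).op)
    (IrreducibleFamily.serre_op.2 hX)).of_op

/-! ### Indecomposable tilting objects -/

variable (D) in
omit [AllFiniteLength R] in
/-- `T` has `Δ(b)` as a subobject, with quotient in `Q` and without extensions by costandard
objects. -/
def StdBottom (b : B) (Q : R → Prop) (T : R) : Prop :=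
  ∃ (Z : R) (i : D.std b ⟶ T) (p : T ⟶ Z), IsSES i p ∧ D.leftOrth Z ∧ Q Z

variable (D) in
omit [AllFiniteLength R] in
/-- `T` has `∇(b)` as a quotient, with kernel in `Q` and without extensions by standard
objects. -/
def CostdTop (b : B) (Q : R → Prop) (T : R) : Prop :=
  ∃ (Z : R) (i : Z ⟶ T) (p : T ⟶ D.costd b), IsSES i p ∧ D.rightOrth Z ∧ Q Z

omit [AllFiniteLength R] in
lemma stdBottom_op {b : B} {Q : R → Prop} {T : Rᵒᵖ} :
    D.op.StdBottom b (fun X ↦ Q X.unop) T ↔ D.CostdTop b Q T.unop := by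
  constructor
  · rintro ⟨Z, i, p, h, hZ, hQ⟩
    exact ⟨_, p.unop, i.unop, h.unop, leftOrth_op.1 hZ, hQ⟩
  · rintro ⟨Z, i, p, h, hZ, hQ⟩
    exact ⟨_, p.op, i.op, h.op, leftOrth_op.2 hZ, hQ⟩

omit [AllFiniteLength R] in
lemma costdTop_op {b : B} {Q : R → Prop} {T : Rᵒᵖ} :
    D.op.CostdTop b (fun X ↦ Q X.unop) T ↔ D.StdBottom b Q T.unop := by
  constructor
  · rintro ⟨Z, i, p, h, hZ, hQ⟩
    exact ⟨_, p.unop, i.unop, h.unop, rightOrth_op.1 hZ, hQ⟩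
  · rintro ⟨Z, i, p, h, hZ, hQ⟩
    exact ⟨_, p.op, i.op, h.op, rightOrth_op.2 hZ, hQ⟩

omit [AllFiniteLength R] in
lemma StdBottom.of_iso {b : B} {Q : R → Prop} {T T' : R} (h : D.StdBottom b Q T) (e : T ≅ T') :
    D.StdBottom b Q T' := by
  obtain ⟨Z, i, p, h, hZ, hQ⟩ := h
  exact ⟨Z, _, _, h.comp_mid_iso e, hZ, hQ⟩

omit [AllFiniteLength R] in
lemma CostdTop.of_iso {b : B} {Q : R → Prop} {T T' : R} (h : D.CostdTop b Q T) (e : T ≅ T') :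
    D.CostdTop b Q T' := by
  obtain ⟨Z, i, p, h, hZ, hQ⟩ := h
  exact ⟨Z, _, _, h.comp_mid_iso e, hZ, hQ⟩

omit [AllFiniteLength R] in
/-- The endomorphism ring of `Δ(b)` has no non-trivial idempotents. -/
lemma std_idempotent {b : B} (e : D.std b ⟶ D.std b) (he : e ≫ e = e) : e = 0 ∨ e = 𝟙 _ := by
  have := D.epi_head b
  by_cases h : e ≫ D.head b = 0
  · left
    have : Epi (𝟙 _ - e) := D.head_essential b _ (by
      rw [Preadditive.sub_comp, h, sub_zero, Category.id_comp]
      infer_instance)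
    rw [← cancel_epi (𝟙 _ - e), comp_zero]
    simp [he]
  · right
    have : Epi e := D.head_essential b _ (IrreducibleFamily.epi_of_ne_zero h)
    rw [← cancel_epi e, he, Category.comp_id]

omit [AllFiniteLength R] in
-- The condition `hι` says that Δ(b) lies in the summand `T'`; then T'/Δ(b) is a retract of T/Δ(b).
lemma StdBottom.of_retract {b : B} {T T' : R} {s : T' ⟶ T} {p : T ⟶ T'} (hs : s ≫ p = 𝟙 T')
    {Z : R} {ι : D.std b ⟶ T} {q : T ⟶ Z} (h : IsSES ι q) (hZ : D.leftOrth Z)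
    (hZ' : D.lt (D.rho b) Z) (hι : ι ≫ p ≫ s = ι) : D.StdBottom b (D.lt (D.rho b)) T' := by
  have := h.mono
  have : Mono ((ι ≫ p) ≫ s) := by rwa [Category.assoc, hι]
  have : Mono (ι ≫ p) := mono_of_mono _ s
  obtain ⟨g, hg⟩ := h.desc (p ≫ cokernel.π (ι ≫ p)) (by
    rw [← Category.assoc, cokernel.condition])
  obtain ⟨f, hf⟩ := (IsSES.of_mono (ι ≫ p)).desc (s ≫ q) (by
    rw [Category.assoc, reassoc_of% hι, h.zero])
  have hfg : f ≫ g = 𝟙 _ := by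
    rw [← cancel_epi (cokernel.π (ι ≫ p)), reassoc_of% hf, hg, reassoc_of% hs, Category.comp_id]
  have : Epi (f ≫ g) := by rw [hfg]; infer_instance
  have : Epi g := epi_of_epi f g
  exact ⟨_, ι ≫ p, _, IsSES.of_mono _, fun c ↦ (hZ c).of_retract_left f g hfg,
    IrreducibleFamily.serre_of_epi g hZ'⟩

/-- A projection onto a summand preserves Δ(b), because Δ(b) has no maps to V/Δ(b). It induces an
idempotent of Δ(b), which is 0 or 1, so Δ(b) lies in one of two complementary summands, and
noetherian induction applies to that one. -/
lemma exists_indecomposable (V : R) (hV : D.rightOrth V) {b : B}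
    (hb : D.StdBottom b (D.lt (D.rho b)) V) :
    ∃ T : R, Indecomposable T ∧ D.rightOrth T ∧ D.StdBottom b (D.lt (D.rho b)) T := by
  induction V using induction_quotient with
  | H V ih =>
    by_cases hi : Indecomposable V
    · exact ⟨V, hi, hV, hb⟩
    obtain ⟨Z, ι, q, h, hZ, hZ'⟩ := hb
    have := h.mono
    have := D.epi_head b
    have hV0 : ¬ IsZero V := fun h0 ↦ head_ne_zero (D := D) b
      ((IsZero.of_mono ι h0).eq_of_src _ _)
    have : ∃ (X Y : R) (i : X ⟶ V) (p : V ⟶ Y) (r : V ⟶ X), IsSES i p ∧ i ≫ r = 𝟙 X ∧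
        ¬ IsZero X ∧ ¬ IsZero Y := by
      by_contra hcon
      refine hi (indecomposable_of_split hV0 fun X Y i p r hip hr ↦ ?_)
      by_contra hn
      exact hcon ⟨X, Y, i, p, r, hip, hr, fun h ↦ hn (Or.inl h), fun h ↦ hn (Or.inr h)⟩
    obtain ⟨X, Y, i, p, r, hip, hr, hX, hY⟩ := this
    obtain ⟨s, hs, hs'⟩ := hip.exists_section hr
    have := hip.mono
    obtain ⟨e, he⟩ := h.lift (ι ≫ r ≫ i)
      (std_hom_eq_zero hZ' (fun h : D.rho b < D.rho b ↦ lt_irrefl _ h) _)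
    have hee : e ≫ e = e := by
      rw [← cancel_mono ι, Category.assoc, he, reassoc_of% he, reassoc_of% hr]
    rcases std_idempotent e hee with rfl | rfl
    · have hιr : ι ≫ r = 0 := by
        rw [← cancel_mono i, Category.assoc, ← he, zero_comp, zero_comp]
      refine ih i p hip hX (fun c ↦ (hV c).of_retract_right s p hs)
        (StdBottom.of_retract hs h hZ hZ' ?_)
      obtain ⟨y, hy⟩ := hip.lift (ι - ι ≫ p ≫ s) (by simp [hs])
      have hy0 : y = 0 := by
        have h := hy =≫ r
        simpa [hr, hs', hιr] using h
      rw [hy0, zero_comp] at hy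
      exact (sub_eq_zero.1 hy.symm).symm
    · refine ih s r (hip.swap hr hs hs') hY (fun c ↦ (hV c).of_retract_right i r hr)
        (StdBottom.of_retract hr h hZ hZ' ?_)
      rw [← he, Category.id_comp]

/-- The map Δ(b) → L(b) → ∇(b) extends to `f : T ⟶ ∇(b)`. It remains to see that the kernel of `f`
stays in `rightOrth` and that `f` is an epimorphism. -/
lemma costdTop_of_plus (hD : D.IsStratified) {b : B} (hb : D.plus (D.rho b)) {T : R}
    (hT : D.rightOrth T) (h : D.StdBottom b (D.lt (D.rho b)) T) :
    D.CostdTop b (fun _ ↦ True) T := by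
  obtain ⟨Z, ι, q, h, hZ, hZ'⟩ := h
  have := D.epi_head b
  have hTle : D.le (D.rho b) T := IrreducibleFamily.serre_of_ses h (D.std_le b) (le_of_lt hZ')
  obtain ⟨f, hf⟩ := (hZ b).extend h (D.head b ≫ D.socle b)
  obtain ⟨J, π, m, hπ, hm, hπm⟩ := exists_factorization f
  have hJ : D.le (D.rho b) J := IrreducibleFamily.serre_of_epi π hTle
  -- In the stratum of `b`, Δ(d) has no extensions by objects of R_{≤ρ b} because the sign is +. For
  -- other d there are no maps Δ(d) → J ⊆ ∇(b), so extensions by the kernel inject into those by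
  -- `T`.
  have hN : D.rightOrth (kernel π) := by
    intro d
    by_cases hd : D.rho d = D.rho b
    · refine D.std_plus d (by rwa [hd]) ?_
      rw [hd]
      exact IrreducibleFamily.serre_of_mono (kernel.ι π) hTle
    · refine (hT d).of_hom_eq_zero_right (IsSES.of_epi π) fun g ↦ ?_
      have hdb : d ≠ b := fun h ↦ hd (by rw [h])
      rw [← cancel_mono m, zero_comp]
      exact std_hom_costd_eq_zero hdb _
  have hJo : D.rightOrth J := fun d ↦
    (hT d).of_ext2Zero_right (IsSES.of_epi π) (ext2Zero_of_orth hD (leftOrth_std hD d) hN)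
  have hQ : D.lt (D.rho b) (cokernel m) := by
    refine D.costd_plus b hb (cokernel.π m) inferInstance ?_
    rw [← cancel_epi (D.head b), ← Category.assoc, ← hf, ← hπm]
    simp
  -- An L(d) in the cokernel would have ρ(d) < ρ(b), and Δ(d) → L(d) would lift to a non-zero map
  -- Δ(d) → ∇(b).
  have hQ0 : IsZero (cokernel m) := by
    by_contra hne
    obtain ⟨d, j, hj⟩ := D.exists_mono hne
    have := D.epi_head d
    have hdb : D.rho d < D.rho b :=
      IrreducibleFamily.mem_of_mono (s := {e | D.rho e < D.rho b}) j hQ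
    obtain ⟨g, hg⟩ := (hJo d).lift (IsSES.of_mono m) (D.head d ≫ j)
    have hg0 : g = 0 := std_hom_costd_eq_zero (fun h ↦ hdb.ne (by rw [h])) g
    refine D.not_isZero d (IsZero.of_mono_eq_zero j ?_)
    rw [← cancel_epi (D.head d), ← hg, hg0, zero_comp, comp_zero]
  have hm := (IsSES.of_mono m).isIso_left hQ0
  refine ⟨kernel π, kernel.ι π, f, ?_, hN, trivial⟩
  rw [← hπm]
  exact (IsSES.of_epi π).comp_right_iso m

/-- The indecomposable tilting object attached to a label with positive sign. -/
lemma exists_tilting_of_plus (hD : D.IsStratified) {b : B} (hb : D.plus (D.rho b)) :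
    ∃ T : R, Indecomposable T ∧ D.leftOrth T ∧ D.rightOrth T ∧
      D.StdBottom b (D.lt (D.rho b)) T ∧ D.CostdTop b (fun _ ↦ True) T := by
  obtain ⟨Y, Z, i, p, h, hY, hZ, -, sZ⟩ := rightApprox_of_plus hD hb (D.std_le b)
  obtain ⟨T, hT, hTo, hTb⟩ := exists_indecomposable Y hY (b := b) ⟨Z, i, p, h, hZ, sZ⟩
  refine ⟨T, hT, ?_, hTo, hTb, costdTop_of_plus hD hb hTo hTb⟩
  obtain ⟨Z, i, p, h, hZ, sZ⟩ := hTb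
  exact leftOrth_ext h (leftOrth_std hD b) hZ

/-- The indecomposable tilting object attached to a label with negative sign. -/
lemma exists_tilting_of_minus (hD : D.IsStratified) {b : B} (hb : ¬ D.plus (D.rho b)) :
    ∃ T : R, Indecomposable T ∧ D.leftOrth T ∧ D.rightOrth T ∧
      D.StdBottom b (fun _ ↦ True) T ∧ D.CostdTop b (D.lt (D.rho b)) T := by
  obtain ⟨T, hT, hl, hr, h, h'⟩ := exists_tilting_of_plus hD.op (b := b) hb
  refine ⟨T.unop, Indecomposable.unop hT, rightOrth_op.1 hr, leftOrth_op.1 hl,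
    costdTop_op (Q := fun _ ↦ True).1 h', ?_⟩
  obtain ⟨Z, i, p, h, hZ, sZ⟩ := h
  exact ⟨_, p.unop, i.unop, h.unop, leftOrth_op.1 hZ, IrreducibleFamily.serre_unop.2 sZ⟩

/-! ### Uniqueness of indecomposable tilting objects -/

lemma iso_of_stdBottom (hD : D.IsStratified) {b : B} {T U : R} (hT : Indecomposable T)
    (hU : Indecomposable U) (hTo : D.rightOrth T) (hUo : D.rightOrth U) {Q Q' : R → Prop}
    (hTb : D.StdBottom b Q T) (hUb : D.StdBottom b Q' U) : Nonempty (U ≅ T) := by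
  obtain ⟨Z, i, p, h, hZ, -⟩ := hTb
  obtain ⟨Z', i', p', h', hZ', -⟩ := hUb
  -- The quotient U/Δ(b) is Δ-filtered and `T` is ∇-filtered, so the inclusion of Δ(b) in `T`
  -- extends to `U`; likewise with the roles exchanged. Both composites fix Δ(b), as Fitting's lemma
  -- requires.
  obtain ⟨f, hf⟩ := (ext1Zero_of_orth hD hZ' hTo).extend h' i
  obtain ⟨g, hg⟩ := (ext1Zero_of_orth hD hZ hUo).extend h i'
  have := h.mono
  have := h'.mono
  have hb : ¬ IsZero (D.std b) := fun h0 ↦ head_ne_zero (D := D) b (h0.eq_of_src _ _)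
  have := isIso_of_fixes hU hT f g i' i (fun h ↦ hb (IsZero.of_mono_eq_zero i' h))
    (fun h ↦ hb (IsZero.of_mono_eq_zero i h)) (by rw [reassoc_of% hf, hg])
    (by rw [reassoc_of% hg, hf])
  exact ⟨asIso f⟩

lemma iso_of_costdTop (hD : D.IsStratified) {b : B} {T U : R} (hT : Indecomposable T)
    (hU : Indecomposable U) (hTo : D.leftOrth T) (hUo : D.leftOrth U) {Q Q' : R → Prop}
    (hTb : D.CostdTop b Q T) (hUb : D.CostdTop b Q' U) : Nonempty (U ≅ T) := by
  obtain ⟨e⟩ := iso_of_stdBottom hD.op (b := b) (Indecomposable.op hT)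
    (Indecomposable.op hU) (rightOrth_op.2 hTo)
    (rightOrth_op.2 hUo) (stdBottom_op (T := Opposite.op T).2 hTb)
    (stdBottom_op (T := Opposite.op U).2 hUb)
  exact ⟨e.unop.symm⟩

/-- If a morphism from `Δ(b)` to an object without extensions by costandard objects is an
isomorphism modulo the Serre subcategory of lower strata, then it identifies `Δ(b)` with the
bottom of a filtration. -/
lemma stdBottom_of_isoMod (hD : D.IsStratified) {b : B} {U : R} (hU : D.leftOrth U)
    (φ : D.std b ⟶ U)
    (hker : ∀ {K : R} (k : K ⟶ D.std b), Mono k → k ≫ φ = 0 → D.lt (D.rho b) K)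
    (hcoker : ∀ {Q : R} (q : U ⟶ Q), Epi q → φ ≫ q = 0 → D.lt (D.rho b) Q) :
    D.StdBottom b (fun _ ↦ True) U := by
  obtain ⟨J, π, m, hπ, hm, hπm⟩ := exists_factorization φ
  have hC : D.lt (D.rho b) (cokernel m) := hcoker (cokernel.π m) inferInstance (by
    rw [← hπm]
    simp)
  -- If ρ(d) < ρ(b), the image J of Δ(b) has no maps to ∇(d), so nothing is lost in passing from `U`
  -- to the cokernel. Otherwise no label of the cokernel is ≥ ρ(d).
  have hCo : D.leftOrth (cokernel m) := by
    intro d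
    by_cases hd : D.rho d < D.rho b
    · refine (hU d).of_hom_eq_zero_left (IsSES.of_mono m) fun g ↦ ?_
      rw [← cancel_epi π, comp_zero]
      exact std_hom_costd_eq_zero (fun h ↦ hd.ne (by rw [h])) _
    · exact ext1Zero_costd_of_serre hD.ext1 (IrreducibleFamily.serre_mono
        (fun e (he : D.rho e < D.rho b) h ↦ hd (lt_of_le_of_lt h he)) hC)
  have hJ : D.leftOrth J := fun d ↦
    (hU d).of_ext2Zero_left (IsSES.of_mono m) (ext2Zero_of_orth hD hCo (rightOrth_costd hD d))
  -- An irreducible quotient L(d) of the kernel would have ρ(d) < ρ(b), and L(d) → ∇(d) would give a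
  -- non-zero map Δ(b) → ∇(d), as extensions of J by ∇(d) split.
  have hK0 : IsZero (kernel π) := by
    by_contra hne
    obtain ⟨d, j, hj⟩ := D.exists_epi hne
    have hdb : D.rho d < D.rho b := IrreducibleFamily.mem_of_epi (s := {e | D.rho e < D.rho b}) j
      (hker (kernel.ι π) inferInstance (by rw [← hπm]; simp))
    obtain ⟨g, hg⟩ := (hJ d).extend (IsSES.of_epi π) (j ≫ D.socle d)
    have hg0 : g = 0 := std_hom_costd_eq_zero (fun h ↦ hdb.ne (by rw [h])) g
    have := D.mono_socle d
    refine D.not_isZero d (IsZero.of_epi_eq_zero j ?_)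
    rw [← cancel_mono (D.socle d), ← hg, hg0, zero_comp, comp_zero]
  have := (IsSES.of_epi π).isIso_right hK0
  refine ⟨cokernel m, φ, cokernel.π m, ?_, hCo, trivial⟩
  rw [← hπm]
  exact (IsSES.of_mono m).comp_left_iso π

lemma costdTop_of_isoMod (hD : D.IsStratified) {b : B} {U : R} (hU : D.rightOrth U)
    (φ : U ⟶ D.costd b)
    (hker : ∀ {K : R} (k : K ⟶ U), Mono k → k ≫ φ = 0 → D.lt (D.rho b) K)
    (hcoker : ∀ {Q : R} (q : D.costd b ⟶ Q), Epi q → φ ≫ q = 0 → D.lt (D.rho b) Q) :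
    D.CostdTop b (fun _ ↦ True) U :=
  stdBottom_op.1 (stdBottom_of_isoMod hD.op (leftOrth_op.2 hU) φ.op
    (fun {_} k hk h ↦ IrreducibleFamily.serre_unop.1 (hcoker k.unop
      (@unop_epi_of_mono _ _ _ _ k hk)
      (Quiver.Hom.op_inj h)))
    (fun {_} q hq h ↦ IrreducibleFamily.serre_unop.1 (hker q.unop
      (@unop_mono_of_epi _ _ _ _ q hq)
      (Quiver.Hom.op_inj h))))

end StdData

/-! ### Flags -/

section Flags

variable {C : Type u} [Category.{v} C] [Abelian C] {B : Type uB} {Φ : B → C → Prop}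

/-- Induction for objects with a filtration, adding one section at the top at a time. -/
lemma Filt.snoc_induction {Ψ : ObjectProperty C} {P : C → Prop}
    (hsnoc : ∀ ⦃X Y Z : C⦄ (i : X ⟶ Y) (p : Y ⟶ Z), IsSES i p → P X → Ψ Z → P Y)
    {X Y Z : C} {i : X ⟶ Y} {p : Y ⟶ Z} (h : IsSES i p) (hX : ∀ ⦃X' : C⦄, (X ≅ X') → P X')
    (hZ : Filt Ψ Z) : P Y := by
  induction hZ generalizing X Y with
  | zero h0 =>
    have := h.isIso_left h0
    exact hX (asIso i)
  | cons h' hΨ _ ih =>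
    obtain ⟨W, k, s, t, h₁, h₂, -, -⟩ := h'.preimage h
    exact ih h₁ fun X' e ↦ hsnoc _ _ (h₂.comp_mid_iso e) (hX (Iso.refl _)) hΨ

lemma isSES_ofLE {V : C} {K L : Subobject V} (h : K ≤ L) :
    IsSES (K.ofLE L h) (cokernel.π (K.ofLE L h)) :=
  IsSES.of_mono _

lemma isZero_bot {V : C} : IsZero ((⊥ : Subobject V) : C) :=
  IsZero.of_mono_eq_zero (⊥ : Subobject V).arrow Subobject.bot_arrow

namespace IsFlag

variable {V : C} {n : ℕ} {F : Fin (n + 1) → Subobject V} {c : Fin n → B} {Q : B → Prop}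

lemma filt (h : IsFlag Φ V F c) (hQ : ∀ m, Q (c m)) (m : Fin (n + 1)) :
    Filt (fun X ↦ ∃ b, Q b ∧ Φ b X) (F m : C) := by
  induction m using Fin.induction with
  | zero =>
    rw [h.bot]
    exact Filt.zero isZero_bot
  | succ m ih =>
    exact Filt.ext (isSES_ofLE _) ih (Filt.single ⟨c m, hQ m, h.sections m⟩)

/-- A chain of subobjects is a flag if consecutive subobjects have the right quotients. -/
lemma of_step (hiso : ∀ b ⦃X Y : C⦄, (X ≅ Y) → Φ b X → Φ b Y)
    (h0 : ∀ b ⦃X : C⦄, IsZero X → ¬ Φ b X) (hbot : F 0 = ⊥) (htop : F (Fin.last n) = ⊤)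
    (h : ∀ m : Fin n, ∃ (f : (F m.castSucc : C) ⟶ F m.succ) (X : C) (p : (F m.succ : C) ⟶ X),
      f ≫ (F m.succ).arrow = (F m.castSucc).arrow ∧ IsSES f p ∧ Φ (c m) X) :
    IsFlag Φ V F c := by
  refine ⟨hbot, htop, Fin.strictMono_iff_lt_succ.2 fun m ↦ ?_, fun m ↦ ?_⟩
  · obtain ⟨f, X, p, hf, hp, hX⟩ := h m
    refine lt_of_le_of_ne (Subobject.le_of_comm f hf) fun he ↦ h0 _ ?_ hX
    have : f = (Subobject.isoOfEq _ _ he).hom := by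
      rw [← cancel_mono (F m.succ).arrow, hf]
      simp
    have : Epi f := by rw [this]; infer_instance
    exact hp.isZero_right
  · obtain ⟨f, X, p, hf, hp, hX⟩ := h m
    have he : (F m.castSucc).ofLE (F m.succ) (Subobject.le_of_comm f hf) = f := by
      rw [← cancel_mono (F m.succ).arrow, hf, Subobject.ofLE_arrow]
    obtain ⟨e⟩ := hp.cokernelIso
    exact hiso _ (e.symm ≪≫ cokernelIsoOfEq he.symm) hX

end IsFlag

lemma HasFlag.filt {V : C} (h : HasFlag Φ V) : Filt (fun X ↦ ∃ b, Φ b X) V := by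
  obtain ⟨n, F, c, h⟩ := h
  have := h.filt (Q := fun _ ↦ True) (fun _ ↦ trivial) (Fin.last n)
  rw [h.top] at this
  simpa using this.of_iso (asIso (⊤ : Subobject V).arrow)

lemma HasFlagTop.exists_ses {V : C} {b : B} {Q : B → Prop} (h : HasFlagTop Φ b Q V) :
    ∃ (Z X : C) (i : Z ⟶ V) (p : V ⟶ X), IsSES i p ∧ Φ b X ∧
      Filt (fun X ↦ ∃ c, Q c ∧ Φ c X) Z := by
  obtain ⟨n, F, c, h, rfl, hQ⟩ := h
  have h1 := isSES_ofLE (h.strict.monotone (Fin.castSucc_lt_succ (i := Fin.last n)).le)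
  have htop : F (Fin.last n).succ = ⊤ := h.top
  have : IsIso (F (Fin.last n).succ).arrow := by rw [htop]; infer_instance
  exact ⟨_, _, _, _, h1.comp_mid_iso (asIso (F (Fin.last n).succ).arrow), h.sections _,
    h.filt hQ _⟩

lemma HasFlagBottom.exists_ses {V : C} {b : B} {Q : B → Prop} (h : HasFlagBottom Φ b Q V) :
    ∃ (Z X : C) (i : X ⟶ V) (p : V ⟶ Z), IsSES i p ∧ Φ b X ∧
      Filt (fun X ↦ ∃ c, Q c ∧ Φ c X) Z := by
  obtain ⟨n, F, c, h, rfl, hQ⟩ := h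
  -- `F 1` is the bottom section, since `F 0 = ⊥`; the induction shows that its quotient in each
  -- later term is filtered.
  have key : ∀ m : Fin (n + 1), ∃ (W : C) (i : (F (Fin.succ 0) : C) ⟶ F m.succ)
      (p : (F m.succ : C) ⟶ W), IsSES i p ∧ Filt (fun X ↦ ∃ c, Q c ∧ Φ c X) W := by
    intro m
    induction m using Fin.induction with
    | zero =>
      exact ⟨_, 𝟙 _, _, IsSES.of_mono _, Filt.zero (isZero_cokernel_of_epi _)⟩
    | succ m ih =>
      obtain ⟨W, i, p, h1, hW⟩ := ih
      have h2 := isSES_ofLE (h.strict.monotone (Fin.castSucc_lt_succ (i := m.succ)).le)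
      obtain ⟨W', π, s, t, k₁, k₂, -, -⟩ := h1.quotient h2
      exact ⟨W', _, π, k₁, Filt.ext k₂ hW (Filt.single ⟨_, hQ _, h.sections m.succ⟩)⟩
  obtain ⟨W, i, p, h1, hW⟩ := key (Fin.last n)
  have htop : F (Fin.last n).succ = ⊤ := h.top
  have : IsIso (F (Fin.last n).succ).arrow := by rw [htop]; infer_instance
  have h2 := isSES_ofLE (h.strict.monotone (Fin.castSucc_lt_succ (i := 0)).le)
  have hbot : IsZero (F (Fin.castSucc 0) : C) := by
    rw [Fin.castSucc_zero, h.bot]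
    exact isZero_bot
  have := h2.isIso_right hbot
  exact ⟨_, _, _, _, (h1.comp_left_iso (inv (cokernel.π _))).comp_mid_iso
    (asIso (F (Fin.last n).succ).arrow), h.sections 0, hW⟩

lemma HasFlagTop.hasFlag {V : C} {b : B} {Q : B → Prop} (h : HasFlagTop Φ b Q V) :
    HasFlag Φ V := by
  obtain ⟨n, F, c, h, -⟩ := h
  exact ⟨_, F, c, h⟩

lemma isFlag_of_isZero {V : C} (h : IsZero V) :
    IsFlag Φ V (fun _ : Fin 1 ↦ ⊥) Fin.elim0 := by
  have : (⊥ : Subobject V) = ⊤ := by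
    have : IsIso (⊥ : Subobject V).arrow :=
      ⟨0, isZero_bot.eq_of_src _ _, h.eq_of_src _ _⟩
    exact Subobject.eq_top_of_isIso_arrow _
  exact ⟨rfl, this, fun i j hij ↦ by omega, fun m ↦ m.elim0⟩

lemma HasFlag.of_isZero {V : C} (h : IsZero V) : HasFlag Φ V :=
  ⟨0, _, _, isFlag_of_isZero h⟩

section

variable (hiso : ∀ b ⦃X Y : C⦄, (X ≅ Y) → Φ b X → Φ b Y)
  (h0 : ∀ b ⦃X : C⦄, IsZero X → ¬ Φ b X)
include hiso h0

/-- A flag of a subobject is extended by a section at the top. -/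
lemma IsFlag.snoc {V Z X : C} {n : ℕ} {F : Fin (n + 1) → Subobject Z} {c : Fin n → B}
    (h : IsFlag Φ Z F c) {i : Z ⟶ V} {p : V ⟶ X} (hip : IsSES i p) {b : B} (hX : Φ b X)
    [Mono i] :
    IsFlag Φ V (Fin.snoc (α := fun _ ↦ Subobject V)
      (fun m ↦ Subobject.mk ((F m).arrow ≫ i)) ⊤) (Fin.snoc (α := fun _ ↦ B) c b) := by
  refine IsFlag.of_step hiso h0 ?_ (Fin.snoc_last (α := fun _ ↦ Subobject V) _ _) fun m ↦ ?_
  · rw [← Fin.castSucc_zero, Fin.snoc_castSucc, h.bot]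
    rw [eq_bot_iff]
    refine Subobject.mk_le_of_comm 0 ?_
    simp
  · induction m using Fin.lastCases with
    | last =>
      rw [Fin.snoc_last, Fin.succ_last, Fin.snoc_last, Fin.snoc_castSucc]
      have := hip.comp_mid_iso (asIso (⊤ : Subobject V).arrow).symm
      have htop : IsIso (F (Fin.last n)).arrow := by rw [h.top]; infer_instance
      exact ⟨_, _, _, by simp, this.comp_left_iso
        ((Subobject.underlyingIso ((F (Fin.last n)).arrow ≫ i)).hom ≫ (F (Fin.last n)).arrow), hX⟩
    | cast m =>
      rw [Fin.snoc_castSucc, Fin.snoc_castSucc, Fin.succ_castSucc, Fin.snoc_castSucc]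
      have := (isSES_ofLE (h.strict.monotone (Fin.castSucc_lt_succ (i := m)).le)).comp_mid_iso
        (Subobject.underlyingIso ((F m.succ).arrow ≫ i)).symm
      exact ⟨_, _, _, by simp, this.comp_left_iso
        (Subobject.underlyingIso ((F m.castSucc).arrow ≫ i)).hom, h.sections m⟩

lemma HasFlag.snoc {V Z X : C} (h : HasFlag Φ Z) {i : Z ⟶ V} {p : V ⟶ X} (hip : IsSES i p)
    {b : B} (hX : Φ b X) : HasFlagTop Φ b (fun _ ↦ True) V := by
  obtain ⟨n, F, c, h⟩ := h
  have := hip.mono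
  exact ⟨n, _, _, IsFlag.snoc hiso h0 h hip hX, Fin.snoc_last (α := fun _ ↦ B) _ _,
    fun _ ↦ trivial⟩

lemma HasFlagBottom.snoc {V Z X : C} {b : B} (h : HasFlagBottom Φ b (fun _ ↦ True) Z)
    {i : Z ⟶ V} {p : V ⟶ X} (hip : IsSES i p) {d : B} (hX : Φ d X) :
    HasFlagBottom Φ b (fun _ ↦ True) V := by
  obtain ⟨n, F, c, h, hb, -⟩ := h
  have := hip.mono
  refine ⟨n + 1, _, _, IsFlag.snoc hiso h0 h hip hX, ?_, fun _ ↦ trivial⟩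
  rw [← Fin.castSucc_zero, Fin.snoc_castSucc, hb]

lemma HasFlagBottom.single {X : C} {b : B} (h : Φ b X) :
    HasFlagBottom Φ b (fun _ ↦ True) X := by
  have h2 : IsSES (0 : (0 : C) ⟶ X) (𝟙 X) := IsSES.of_lift _ _ zero_comp fun f hf ↦
    ⟨0, by rw [zero_comp, ← hf, Category.comp_id]⟩
  have := h2.mono
  exact ⟨0, _, _, IsFlag.snoc hiso h0 (isFlag_of_isZero (isZero_zero C)) h2 h,
    Fin.snoc_last (α := fun _ ↦ B) _ _, fun _ ↦ trivial⟩

end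

end Flags

/-! ### Projective covers and adjoint values -/

section Covers

variable {C : Type u} [Category.{v} C]

lemma IsProjectiveCover.iso_unique {P P' X : C} (h : IsProjectiveCover P X)
    (h' : IsProjectiveCover P' X) : Nonempty (P ≅ P') := by
  obtain ⟨hP, p, hp, he⟩ := h
  obtain ⟨hP', p', hp', he'⟩ := h'
  have hf := Projective.factorThru_comp p p'
  set f := Projective.factorThru p p'
  have : Epi f := he' _ f (by rwa [hf])
  have hs := Projective.factorThru_comp (𝟙 P') f
  set s := Projective.factorThru (𝟙 P') f
  have : Epi s := he _ s (by rwa [← hf, reassoc_of% hs])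
  refine ⟨⟨f, s, ?_, hs⟩⟩
  rw [← cancel_epi s, reassoc_of% hs, Category.comp_id]

lemma IsProjectiveCover.of_iso {P P' X : C} (h : IsProjectiveCover P X) (e : P ≅ P') :
    IsProjectiveCover P' X := by
  obtain ⟨hP, p, hp, he⟩ := h
  refine ⟨Projective.of_iso e hP, e.inv ≫ p, epi_comp _ _, fun Y g hg ↦ ?_⟩
  have := he _ (g ≫ e.inv) (by rwa [Category.assoc])
  have h2 : g = (g ≫ e.inv) ≫ e.hom := by simp
  rw [h2]
  exact epi_comp _ _

lemma isInjectiveHull_iff_op {I X : C} :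
    IsInjectiveHull I X ↔ IsProjectiveCover (Opposite.op I) (Opposite.op X) := by
  constructor
  · rintro ⟨hI, i, hi, he⟩
    refine ⟨inferInstance, i.op, inferInstance, fun Y g hg ↦ ?_⟩
    have : Mono (i ≫ g.unop) := @unop_mono_of_epi _ _ _ _ (g ≫ i.op) hg
    have := he _ g.unop this
    exact op_epi_of_mono g.unop
  · rintro ⟨hI, p, hp, he⟩
    refine ⟨(Injective.injective_iff_projective_op).2 hI, p.unop,
      @unop_mono_of_epi _ _ _ _ p hp, fun Y g hg ↦ ?_⟩
    have : Epi (g.op ≫ p) := @op_epi_of_mono _ _ _ _ (p.unop ≫ g) hg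
    have := he _ g.op this
    exact unop_mono_of_epi g.op

lemma IsInjectiveHull.iso_unique {I I' X : C} (h : IsInjectiveHull I X)
    (h' : IsInjectiveHull I' X) : Nonempty (I ≅ I') := by
  obtain ⟨f⟩ := (isInjectiveHull_iff_op.1 h).iso_unique (isInjectiveHull_iff_op.1 h')
  exact ⟨f.symm.unop⟩

lemma IsInjectiveHull.of_iso {I I' X : C} (h : IsInjectiveHull I X) (e : I ≅ I') :
    IsInjectiveHull I' X :=
  isInjectiveHull_iff_op.2 ((isInjectiveHull_iff_op.1 h).of_iso e.symm.op)

variable {D : Type*} [Category* D]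

lemma isLeftAdjointValue_iff {j : C ⥤ D} {P : D} {X : C} :
    IsLeftAdjointValue j P X ↔
      ∃ η : P ⟶ j.obj X, ∀ (Z : C) (φ : P ⟶ j.obj Z), ∃! f : X ⟶ Z, η ≫ j.map f = φ := by
  constructor
  · rintro ⟨η, ⟨h⟩⟩
    refine ⟨η, fun Z φ ↦ ⟨(h.to (StructuredArrow.mk φ)).right,
      StructuredArrow.w (h.to (StructuredArrow.mk φ)), fun f hf ↦ ?_⟩⟩
    have := h.hom_ext (StructuredArrow.homMk f hf : StructuredArrow.mk η ⟶ StructuredArrow.mk φ)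
      (h.to (StructuredArrow.mk φ))
    exact congrArg (fun x ↦ x.right) this
  · rintro ⟨η, h⟩
    refine ⟨η, ⟨IsInitial.ofUniqueHom (fun Y ↦ StructuredArrow.homMk (h Y.right Y.hom).choose
      (h Y.right Y.hom).choose_spec.1) fun Y m ↦ ?_⟩⟩
    ext
    exact (h Y.right Y.hom).choose_spec.2 _ (StructuredArrow.w m)

lemma isRightAdjointValue_iff_op {j : C ⥤ D} {P : D} {X : C} :
    IsRightAdjointValue j P X ↔ IsLeftAdjointValue j.op (Opposite.op P) (Opposite.op X) := by
  rw [isLeftAdjointValue_iff]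
  constructor
  · rintro ⟨θ, ⟨h⟩⟩
    refine ⟨θ.op, fun Z φ ↦ ⟨(h.from (CostructuredArrow.mk φ.unop)).left.op,
      Quiver.Hom.unop_inj (CostructuredArrow.w (h.from (CostructuredArrow.mk φ.unop))),
      fun f hf ↦ ?_⟩⟩
    have := h.hom_ext (CostructuredArrow.homMk f.unop (Quiver.Hom.op_inj hf) :
      CostructuredArrow.mk φ.unop ⟶ CostructuredArrow.mk θ) (h.from (CostructuredArrow.mk φ.unop))
    exact Quiver.Hom.unop_inj (congrArg (fun x ↦ x.left) this)
  · rintro ⟨η, h⟩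
    refine ⟨η.unop, ⟨IsTerminal.ofUniqueHom (fun Y ↦ CostructuredArrow.homMk
      (h (.op Y.left) Y.hom.op).choose.unop
      (Quiver.Hom.op_inj (h (.op Y.left) Y.hom.op).choose_spec.1)) fun Y m ↦ ?_⟩⟩
    ext
    exact Quiver.Hom.op_inj ((h (.op Y.left) Y.hom.op).choose_spec.2 _
      (Quiver.Hom.unop_inj (CostructuredArrow.w m)))

lemma IsLeftAdjointValue.iso_unique {j : C ⥤ D} {P P' : D} {X X' : C}
    (h : IsLeftAdjointValue j P X) (h' : IsLeftAdjointValue j P' X') (e : P ≅ P') :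
    Nonempty (X ≅ X') := by
  obtain ⟨η, h⟩ := isLeftAdjointValue_iff.1 h
  obtain ⟨η', h'⟩ := isLeftAdjointValue_iff.1 h'
  obtain ⟨f, hf, -⟩ := h _ (e.hom ≫ η')
  obtain ⟨g, hg, -⟩ := h' _ (e.inv ≫ η)
  refine ⟨⟨f, g, (h X η).unique ?_ (by simp), (h' X' η').unique ?_ (by simp)⟩⟩
  · rw [j.map_comp, reassoc_of% hf, hg, e.hom_inv_id_assoc]
  · rw [j.map_comp, reassoc_of% hg, hf, e.inv_hom_id_assoc]

lemma IsRightAdjointValue.iso_unique {j : C ⥤ D} {P P' : D} {X X' : C}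
    (h : IsRightAdjointValue j P X) (h' : IsRightAdjointValue j P' X') (e : P ≅ P') :
    Nonempty (X ≅ X') := by
  obtain ⟨f⟩ := (isRightAdjointValue_iff_op.1 h).iso_unique (isRightAdjointValue_iff_op.1 h')
    e.symm.op
  exact ⟨f.symm.unop⟩

end Covers

/-! ### Serre quotients -/

section SerreQuotient

variable {C : Type u} [Category.{v} C] [Abelian C] (P : ObjectProperty C)

/-- `Y` has neither non-zero morphisms to objects of `P` nor extensions by them. -/
def IsColocal (Y : C) : Prop :=
  ∀ M, P M → (∀ f : Y ⟶ M, f = 0) ∧ Ext1Zero Y M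

variable {P} [P.IsSerreClass] {D : Type*} [Category* D] [Preadditive D] (L : C ⥤ D)
  [L.IsLocalization P.isoModSerre] [L.Additive]

include L in
open ObjectProperty.SerreClassLocalization in
-- Write `φ` as a fraction with denominator `s = π ≫ m`. The numerator lands in the image of `s`
-- because `Y` has no maps to the cokernel, and lifts through `π` because `Y` has no extensions by
-- the kernel.
lemma IsColocal.existsUnique_map {Y Z : C} (hY : IsColocal P Y) (φ : L.obj Y ⟶ L.obj Z) :
    ∃! f : Y ⟶ Z, L.map f = φ := by
  obtain ⟨ψ, hψ⟩ := Localization.exists_leftFraction L P.isoModSerre φ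
  have hψ' : φ ≫ L.map ψ.s = L.map ψ.f := by
    rw [hψ]
    exact ψ.map_comp_map_s _ _
  obtain ⟨f, s, hs⟩ := ψ
  obtain ⟨J, π, m, hπ, hm, rfl⟩ := exists_factorization s
  have hker : P (kernel π) := P.prop_of_mono
    (kernel.lift (π ≫ m) (kernel.ι π) (by simp)) hs.1
  have hcoker : P (cokernel m) := P.prop_of_epi
    (cokernel.desc (π ≫ m) (cokernel.π m) (by simp)) hs.2
  obtain ⟨f₁, hf₁⟩ := (IsSES.of_mono m).lift f ((hY _ hcoker).1 _)
  obtain ⟨g, hg⟩ := (hY _ hker).2.lift (IsSES.of_epi π) f₁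
  have := Localization.inverts L P.isoModSerre _ hs
  refine ⟨g, ?_, fun g' hg' ↦ ?_⟩
  · dsimp only at hψ' ⊢
    rw [← cancel_mono (L.map (π ≫ m)), hψ', ← L.map_comp, reassoc_of% hg, hf₁]
  · dsimp only at hψ' hg'
    have h0 : L.map (g' - g) = 0 := by
      rw [L.map_sub, hg', sub_eq_zero, ← cancel_mono (L.map (π ≫ m)), hψ', ← L.map_comp,
        reassoc_of% hg, hf₁]
    rw [map_eq_zero_iff L P] at h0
    have h1 := (hY _ h0).1 (Abelian.factorThruImage (g' - g))
    rw [← sub_eq_zero, ← Abelian.image.fac (g' - g), h1, zero_comp]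

lemma IsColocal.isLeftAdjointValue {Y : C} (hY : IsColocal P Y) {X : D} (e : X ≅ L.obj Y) :
    IsLeftAdjointValue L X Y := by
  refine isLeftAdjointValue_iff.2 ⟨e.hom, fun Z φ ↦ ?_⟩
  obtain ⟨f, hf, hu⟩ := hY.existsUnique_map L (e.inv ≫ φ)
  exact ⟨f, by simp [hf], fun g hg ↦ hu g (by simp [← hg])⟩

open ObjectProperty.SerreClassLocalization in
/-- The quotient functor sends a projective cover of a simple object, not in `P`, to a projective
cover. -/
lemma isProjectiveCover_obj {Y S : C} [Simple S] (hS : ¬ P S) (hY : IsColocal P Y) [Projective Y]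
    (p : Y ⟶ S) [Epi p] (hp : ∀ ⦃Z : C⦄ (g : Z ⟶ Y), Epi (g ≫ p) → Epi g) :
    IsProjectiveCover (L.obj Y) (L.obj S) := by
  have := preservesEpimorphisms L P
  have := Localization.essSurj L P.isoModSerre
  refine ⟨⟨fun {E X} g e he ↦ ?_⟩, L.map p, inferInstance, fun X g hg ↦ ?_⟩
  -- Up to isomorphism an epimorphism of the quotient category comes from one upstairs, where `Y` is
  -- projective; colocality turns the target map into a morphism of `C`.
  · obtain ⟨X', Y', f', hf', ⟨a⟩⟩ := (epi_iff L P e).1 he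
    let α : L.obj X' ≅ E := Arrow.leftFunc.mapIso a
    let β : L.obj Y' ≅ X := Arrow.rightFunc.mapIso a
    have hαβ : α.hom ≫ e = L.map f' ≫ β.hom := a.hom.w
    obtain ⟨f, hf, -⟩ := hY.existsUnique_map L (g ≫ β.inv)
    refine ⟨L.map (Projective.factorThru f f') ≫ α.hom, ?_⟩
    rw [Category.assoc, hαβ, ← L.map_comp_assoc, Projective.factorThru_comp, hf]
    simp
  · obtain ⟨ψ, hψ⟩ := Localization.exists_rightFraction L P.isoModSerre
      ((L.objObjPreimageIso X).hom ≫ g)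
    have hψ' : L.map ψ.s ≫ (L.objObjPreimageIso X).hom ≫ g = L.map ψ.f := by
      rw [hψ]
      exact ψ.map_s_comp_map _ _
    have hs := Localization.inverts L P.isoModSerre _ ψ.hs
    have h1 : Epi (L.map (ψ.f ≫ p)) := by
      rw [L.map_comp, ← hψ']
      simp only [Category.assoc]
      infer_instance
    rw [epi_map_iff L P] at h1
    -- A zero map can be epi modulo `P` only onto an object of `P`. As `S` is simple, the numerator
    -- then maps onto `S`, and essentiality upstairs applies.
    have h2 : ψ.f ≫ p ≠ 0 := fun h0 ↦ hS (by
      rwa [h0, ObjectProperty.epiModSerre_zero_iff] at h1)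
    have := hp _ (epi_of_nonzero_to_simple h2)
    have : Epi (L.map ψ.s ≫ (L.objObjPreimageIso X).hom ≫ g) := by rw [hψ']; infer_instance
    have := epi_of_epi (L.map ψ.s) ((L.objObjPreimageIso X).hom ≫ g)
    exact epi_of_epi (L.objObjPreimageIso X).hom g

end SerreQuotient

/-! ### Covers by objects colocal for a Serre subcategory -/

section Existence

variable {C : Type u} [Category.{v} C] [Abelian C] (P : ObjectProperty C) [P.IsSerreClass]

variable {P} in
/-- An object with an essential epimorphism to a simple object which is not in `P` has no
morphisms to objects of `P`. -/
lemma hom_eq_zero_of_essential {Y S M : C} [Simple S] (hS : ¬ P S) (p : Y ⟶ S) [Epi p]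
    (hp : ∀ ⦃Z : C⦄ (g : Z ⟶ Y), Epi (g ≫ p) → Epi g) (hM : P M) (f : Y ⟶ M) : f = 0 := by
  by_cases h : kernel.ι f ≫ p = 0
  · obtain ⟨J, π, m, hπ, hm, rfl⟩ := exists_factorization f
    obtain ⟨g, hg⟩ := (IsSES.of_epi π).desc p (by
      have : kernel.ι π = kernel.lift (π ≫ m) (kernel.ι π) (by simp) ≫ kernel.ι (π ≫ m) := by simp
      rw [this, Category.assoc, h, comp_zero])
    have : Epi (π ≫ g) := by rw [hg]; infer_instance
    have : Epi g := epi_of_epi π g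
    exact (hS (P.prop_of_epi g (P.prop_of_mono m hM))).elim
  · have := hp _ (epi_of_nonzero_to_simple h)
    rw [← cancel_epi (kernel.ι f), kernel.condition, comp_zero]

variable [AllFiniteLength C]

/-- Artinian induction reaches a subobject minimal among those mapping onto `S`; minimality is
essentiality. -/
lemma exists_essential_sub {V S : C} (p : V ⟶ S) [Epi p] :
    ∃ (Y : C) (i : Y ⟶ V), Mono i ∧ Epi (i ≫ p) ∧
      ∀ ⦃Z : C⦄ (g : Z ⟶ Y), Epi (g ≫ i ≫ p) → Epi g := by
  induction V using induction_sub with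
  | H V ih =>
    by_cases he : ∀ ⦃Z : C⦄ (g : Z ⟶ V), Epi (g ≫ p) → Epi g
    · exact ⟨V, 𝟙 V, inferInstance, by rwa [Category.id_comp], by simpa using he⟩
    · push Not at he
      obtain ⟨Z, g, hg, hg'⟩ := he
      obtain ⟨J, π, m, hπ, hm, rfl⟩ := exists_factorization g
      have : Epi (m ≫ p) := by
        rw [Category.assoc] at hg
        exact epi_of_epi π (m ≫ p)
      obtain ⟨Y, i, hi, h₁, h₂⟩ := ih m _ (IsSES.of_mono m) (fun h0 ↦ hg' (by
        have := (IsSES.of_mono m).isIso_left h0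
        exact epi_comp _ _)) (m ≫ p)
      exact ⟨Y, i ≫ m, mono_comp _ _, by rwa [Category.assoc], by simpa using h₂⟩

/-- The minimal subobject of a projective object over `S` is a direct summand: lifting gives an
endomorphism over `S`, which is epi by essentiality and hence invertible. -/
lemma exists_projective_essential [EnoughProjectives C] (S : C) :
    ∃ (Y : C) (p : Y ⟶ S), Projective Y ∧ Epi p ∧ ∀ ⦃Z : C⦄ (g : Z ⟶ Y), Epi (g ≫ p) → Epi g := by
  obtain ⟨Y, i, hi, h₁, h₂⟩ := exists_essential_sub (Projective.π S)
  refine ⟨Y, i ≫ Projective.π S, ?_, h₁, h₂⟩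
  have hh := Projective.factorThru_comp (Projective.π S) (i ≫ Projective.π S)
  set h := Projective.factorThru (Projective.π S) (i ≫ Projective.π S)
  have : Epi (i ≫ h) := h₂ _ (by rwa [Category.assoc, hh])
  have := isIso_of_epi_endo (i ≫ h)
  exact Retract.projective ⟨i, h ≫ inv (i ≫ h), by
    rw [← Category.assoc, IsIso.hom_inv_id]⟩

/-- Among the quotients of `Y` over `S` with kernel in `P` there is a largest one. -/
lemma exists_maximal_quotient {K Y Q S : C} {i : K ⟶ Y} {π : Y ⟶ Q} (h : IsSES i π) {p : Y ⟶ S}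
    {q : Q ⟶ S} (hq : P.monoModSerre q) (hπ : π ≫ q = p) :
    ∃ (Q : C) (π : Y ⟶ Q) (q : Q ⟶ S), Epi π ∧ P.monoModSerre q ∧ π ≫ q = p ∧
      ∀ ⦃Q' : C⦄ (π' : Y ⟶ Q') (r : Q' ⟶ Q), Epi π' → P.monoModSerre r → π' ≫ r = π →
        IsIso r := by
  induction K using induction_sub generalizing Q with
  | H K ih =>
    by_cases he : ∀ ⦃Q' : C⦄ (π' : Y ⟶ Q') (r : Q' ⟶ Q), Epi π' → P.monoModSerre r →
        π' ≫ r = π → IsIso r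
    · exact ⟨Q, π, q, h.epi, hq, hπ, he⟩
    · push Not at he
      obtain ⟨Q', π', r, hπ', hr, rfl, hr'⟩ := he
      have := h.epi
      have : Epi r := epi_of_epi π' r
      obtain ⟨W, k, s, t, h₁, h₂, -, h₄⟩ := (IsSES.of_epi r).preimage (IsSES.of_epi π')
      obtain ⟨a, ha⟩ := h.lift k h₁.zero
      obtain ⟨a', ha'⟩ := h₁.lift i h.zero
      have := h.mono
      have := h₁.mono
      have haa : a ≫ a' = 𝟙 W := by
        rw [← cancel_mono k, Category.assoc, ha', ha, Category.id_comp]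
      have haa' : a' ≫ a = 𝟙 K := by
        rw [← cancel_mono i, Category.assoc, ha, ha', Category.id_comp]
      -- The kernel of `π'` is a proper subobject of `K`: the quotient is the kernel of `r`,
      -- non-zero because `r` is not an isomorphism.
      refine ih _ _ (h₂.comp_mid_iso ⟨a, a', haa, haa'⟩) (fun h0 ↦ hr' ?_)
        (IsSES.of_epi π')
        (P.monoModSerre.comp_mem _ _ hr hq) (by simpa using hπ)
      exact (IsSES.of_epi r).isIso_right h0

/-- The universal extension of a simple object `S`, not in `P`, by objects of `P`. -/
lemma exists_colocal_cover [EnoughProjectives C] {S : C} [Simple S] (hS : ¬ P S) :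
    ∃ (Q : C) (q : Q ⟶ S), IsColocal P Q ∧ Epi q ∧
      (∀ ⦃Z : C⦄ (g : Z ⟶ Q), Epi (g ≫ q) → Epi g) ∧ P.monoModSerre q := by
  obtain ⟨Y, p, hY, hp, he⟩ := exists_projective_essential S
  obtain ⟨Q, π, q, hπ, hq, rfl, hmax⟩ := exists_maximal_quotient P (IsSES.of_epi p)
    (P.monoModSerre_of_mono (𝟙 S)) (Category.comp_id p)
  have : Epi q := epi_of_epi π q
  have hess : ∀ ⦃Z : C⦄ (g : Z ⟶ Q), Epi (g ≫ q) → Epi g := fun Z g hg ↦ by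
    have e : pullback.snd g π ≫ π ≫ q = pullback.fst g π ≫ g ≫ q := by
      rw [← pullback.condition_assoc]
    have := he (pullback.snd g π) (by rw [e]; infer_instance)
    have : Epi (pullback.fst g π ≫ g) := by rw [pullback.condition]; infer_instance
    exact epi_of_epi (pullback.fst g π) g
  refine ⟨Q, q, fun M hM ↦ ⟨hom_eq_zero_of_essential hS q hess hM,
    Ext1Zero.of_lift fun E m r hmr ↦ ?_⟩, inferInstance, hess, hq⟩
  have := hmr.epi
  -- Lift `π` to the extension `E`. The image of the lift is a quotient of `Y` over `Q` with kernel
  -- in `P`, so by maximality it maps isomorphically to `Q` and splits the extension.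
  have hf := Projective.factorThru_comp π r
  obtain ⟨J, σ, ι, hσ, hι, hσι⟩ := exists_factorization (Projective.factorThru π r)
  have hr : P.monoModSerre r := by
    obtain ⟨e⟩ := hmr.kernelIso
    exact P.prop_of_iso e.symm hM
  have := hmax σ (ι ≫ r) hσ (P.monoModSerre.comp_mem _ _ (P.monoModSerre_of_mono ι) hr)
    (by rw [reassoc_of% hσι, hf])
  exact ⟨inv (ι ≫ r) ≫ ι, by simp⟩

end Existence

/-! ### Duality for Serre quotients -/

section Duality

variable {C : Type u} [Category.{v} C] [Abelian C] (P : ObjectProperty C) [P.IsSerreClass]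

instance isSerreClass_op : P.op.IsSerreClass where
  exists_zero := ⟨0, isZero_zero _, P.prop_of_isZero (isZero_zero _).unop⟩
  prop_of_mono f _ hY := P.prop_of_epi f.unop hY
  prop_of_epi f _ hX := P.prop_of_mono f.unop hX
  prop_X₂_of_shortExact hS h₁ h₃ := P.prop_X₂_of_shortExact hS.unop h₃ h₁

lemma monoModSerre_op {X Y : Cᵒᵖ} (f : X ⟶ Y) :
    P.op.monoModSerre f ↔ P.epiModSerre f.unop :=
  P.op.prop_iff_of_iso (cokernelUnopOp f).symm

lemma epiModSerre_op {X Y : Cᵒᵖ} (f : X ⟶ Y) :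
    P.op.epiModSerre f ↔ P.monoModSerre f.unop :=
  P.op.prop_iff_of_iso (kernelUnopOp f).symm

lemma isoModSerre_op : P.op.isoModSerre = P.isoModSerre.op := by
  ext X Y f
  exact (and_congr (monoModSerre_op P f) (epiModSerre_op P f)).trans and_comm

/-- There are neither non-zero morphisms to `Y` from objects of `P` nor extensions of them
by `Y`. -/
def IsLocal (Y : C) : Prop :=
  ∀ M, P M → (∀ f : M ⟶ Y, f = 0) ∧ Ext1Zero M Y

variable {P}

omit [P.IsSerreClass] in
lemma IsLocal.op {Y : C} (h : IsLocal P Y) : IsColocal P.op (Opposite.op Y) :=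
  fun M hM ↦ ⟨fun f ↦ Quiver.Hom.unop_inj ((h M.unop hM).1 f.unop), (h M.unop hM).2.op⟩

omit [P.IsSerreClass] in
lemma IsColocal.unop {Y : Cᵒᵖ} (h : IsColocal P.op Y) : IsLocal P Y.unop :=
  fun M hM ↦ ⟨fun f ↦ Quiver.Hom.op_inj ((h (.op M) hM).1 f.op), (h (.op M) hM).2.unop⟩

variable {D : Type*} [Category* D] [Preadditive D] (L : C ⥤ D)
  [L.IsLocalization P.isoModSerre] [L.Additive]

instance isLocalization_op : L.op.IsLocalization P.op.isoModSerre := by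
  rw [isoModSerre_op]
  infer_instance

lemma IsLocal.existsUnique_map {Y Z : C} (hY : IsLocal P Y) (φ : L.obj Z ⟶ L.obj Y) :
    ∃! f : Z ⟶ Y, L.map f = φ := by
  obtain ⟨f, hf, hu⟩ := hY.op.existsUnique_map (Z := Opposite.op Z) L.op φ.op
  exact ⟨f.unop, Quiver.Hom.op_inj hf, fun g hg ↦
    Quiver.Hom.op_inj (hu g.op (Quiver.Hom.unop_inj hg))⟩

lemma IsLocal.isRightAdjointValue {Y : C} (hY : IsLocal P Y) {X : D} (e : L.obj Y ≅ X) :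
    IsRightAdjointValue L X Y :=
  isRightAdjointValue_iff_op.2 (hY.op.isLeftAdjointValue L.op e.symm.op.symm)

lemma isInjectiveHull_obj {Y S : C} [Simple S] (hS : ¬ P S) (hY : IsLocal P Y) [Injective Y]
    (i : S ⟶ Y) [Mono i] (hi : ∀ ⦃Z : C⦄ (g : Y ⟶ Z), Mono (i ≫ g) → Mono g) :
    IsInjectiveHull (L.obj Y) (L.obj S) := by
  have := simple_op (X := S)
  exact isInjectiveHull_iff_op.2 (isProjectiveCover_obj L.op (Y := Opposite.op Y) hS hY.op i.op
    fun Z g hg ↦ by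
      have : Mono (i ≫ g.unop) := @unop_mono_of_epi _ _ _ _ (g ≫ i.op) hg
      have := hi g.unop this
      exact op_epi_of_mono g.unop)

variable (P) [AllFiniteLength C]

/-- `pr` selects between j_! of a projective cover and j_! of the irreducible object. Leaving it
arbitrary lets the dual statement reuse the lemma with the opposite sign condition. -/
lemma exists_cover [EnoughProjectives C] {S : C} [Simple S] (hS : ¬ P S) (pr : Prop) :
    ∃ (Y : C) (p : Y ⟶ S), IsColocal P Y ∧ Epi p ∧
      (∀ ⦃Z : C⦄ (g : Z ⟶ Y), Epi (g ≫ p) → Epi g) ∧ (pr → Projective Y) ∧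
      (¬ pr → P.monoModSerre p) := by
  by_cases h : pr
  · obtain ⟨Y, p, hY, hp, he⟩ := exists_projective_essential S
    exact ⟨Y, p, fun M hM ↦ ⟨hom_eq_zero_of_essential hS p he hM, Ext1Zero.of_lift
      fun E m r hmr ↦ have := hmr.epi; ⟨_, Projective.factorThru_comp (𝟙 Y) r⟩⟩, hp, he,
      fun _ ↦ hY, fun h' ↦ (h' h).elim⟩
  · obtain ⟨Y, p, hY, hp, he, hm⟩ := exists_colocal_cover P hS
    exact ⟨Y, p, hY, hp, he, fun h' ↦ (h h').elim, fun _ ↦ hm⟩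

lemma exists_hull [EnoughInjectives C] {S : C} [Simple S] (hS : ¬ P S) (pr : Prop) :
    ∃ (Y : C) (i : S ⟶ Y), IsLocal P Y ∧ Mono i ∧
      (∀ ⦃Z : C⦄ (g : Y ⟶ Z), Mono (i ≫ g) → Mono g) ∧ (pr → Injective Y) ∧
      (¬ pr → P.epiModSerre i) := by
  have := simple_op (X := S)
  obtain ⟨Y, p, hY, hp, he, h₁, h₂⟩ := exists_cover P.op (S := Opposite.op S) hS pr
  refine ⟨Y.unop, p.unop, hY.unop, @unop_mono_of_epi _ _ _ _ p hp, fun Z g hg ↦ ?_,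
    fun h ↦ ?_, fun h ↦ (monoModSerre_op P p).1 (h₂ h)⟩
  · have : Epi (g.op ≫ p) := @op_epi_of_mono _ _ _ _ (p.unop ≫ g) hg
    have := he g.op this
    exact unop_mono_of_epi g.op
  · have := h₁ h
    exact (Injective.injective_iff_projective_op).2 this

end Duality

/-! ### Serre subcategories -/

section FullSubcategory

/-- Used to pull chain conditions back along the inclusion of a Serre subcategory and along an
equivalence with modules. -/
lemma subobject_orderEmbedding {C : Type*} [Category* C] {D : Type*} [Category* D] (F : C ⥤ D)
    [F.Full] [F.Faithful] [F.PreservesMonomorphisms] (V : C) :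
    Nonempty (Subobject V ↪o Subobject (F.obj V)) := by
  refine ⟨OrderEmbedding.ofMapLEIff (fun K ↦ Subobject.mk (F.map K.arrow)) fun K K' ↦ ?_⟩
  constructor
  · intro h
    refine Subobject.le_of_comm (F.preimage (Subobject.ofMkLEMk _ _ h)) (F.map_injective ?_)
    simp
  · intro h
    refine Subobject.mk_le_mk_of_comm (F.map (K.ofLE K' h)) ?_
    rw [← F.map_comp, Subobject.ofLE_arrow]

variable {R : Type u} [Category.{v} R] [Abelian R] {B : Type uB} {𝓛 : IrreducibleFamily R B}
  {s t : Set B}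

instance [AllFiniteLength R] : AllFiniteLength (𝓛.serre s).FullSubcategory where
  noetherian V := by
    obtain ⟨e⟩ := subobject_orderEmbedding (𝓛.serre s).ι V
    have : WellFoundedGT (Subobject ((𝓛.serre s).ι.obj V)) :=
      (AllFiniteLength.noetherian V.obj).1
    exact ⟨e.wellFoundedGT⟩
  artinian V := by
    obtain ⟨e⟩ := subobject_orderEmbedding (𝓛.serre s).ι V
    have : WellFoundedLT (Subobject ((𝓛.serre s).ι.obj V)) :=
      (AllFiniteLength.artinian V.obj).1
    exact ⟨e.wellFoundedLT⟩

lemma isSES_of_hom {X Y Z : (𝓛.serre s).FullSubcategory} {i : X ⟶ Y} {p : Y ⟶ Z}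
    (h : IsSES i.hom p.hom) : IsSES i p := by
  have := h.mono
  have := h.epi
  have : Mono i := (𝓛.serre s).ι.mono_of_mono_map (f := i) h.mono
  have : Epi p := (𝓛.serre s).ι.epi_of_epi_map (f := p) h.epi
  refine IsSES.of_lift i p (ObjectProperty.hom_ext _ h.zero) fun f hf ↦ ?_
  obtain ⟨g, hg⟩ := h.lift f.hom (congrArg (fun x ↦ x.hom) hf)
  exact ⟨ObjectProperty.homMk g, ObjectProperty.hom_ext _ hg⟩

/-- A Serre subcategory is closed under extensions, so every extension formed in `R` already lies in
it. -/
lemma ext1Zero_obj {X Y : (𝓛.serre s).FullSubcategory} (h : Ext1Zero X Y) :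
    Ext1Zero X.obj Y.obj := by
  intro E i p hip
  let E' : (𝓛.serre s).FullSubcategory :=
    ⟨E, IrreducibleFamily.serre_of_ses hip Y.property X.property⟩
  obtain ⟨r, hr⟩ := h (E := E') (ObjectProperty.homMk i) (ObjectProperty.homMk p)
    (isSES_of_hom hip)
  exact ⟨r.hom, congrArg (fun x ↦ x.hom) hr⟩

lemma mono_hom {X Y : (𝓛.serre s).FullSubcategory} (f : X ⟶ Y) [Mono f] : Mono f.hom :=
  inferInstanceAs (Mono ((𝓛.serre s).ι.map f))

lemma epi_hom {X Y : (𝓛.serre s).FullSubcategory} (f : X ⟶ Y) [Epi f] : Epi f.hom :=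
  inferInstanceAs (Epi ((𝓛.serre s).ι.map f))

lemma mono_of_hom {X Y : (𝓛.serre s).FullSubcategory} (f : X ⟶ Y) (h : Mono f.hom) : Mono f :=
  (𝓛.serre s).ι.mono_of_mono_map (f := f) h

lemma epi_of_hom {X Y : (𝓛.serre s).FullSubcategory} (f : X ⟶ Y) (h : Epi f.hom) : Epi f :=
  (𝓛.serre s).ι.epi_of_epi_map (f := f) h

lemma monoModSerre_iff_hom {X Y : (𝓛.serre s).FullSubcategory} (f : X ⟶ Y) :
    ((𝓛.serre t).inverseImage (𝓛.serre s).ι).monoModSerre f ↔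
      ∀ {K : R} (k : K ⟶ X.obj), Mono k → k ≫ f.hom = 0 → 𝓛.serre t K := by
  constructor
  · intro h K k hk hkf
    let K' : (𝓛.serre s).FullSubcategory := ⟨K, IrreducibleFamily.serre_of_mono k X.property⟩
    have : Mono (ObjectProperty.homMk k : K' ⟶ X) := mono_of_hom _ hk
    let l := kernel.lift f (ObjectProperty.homMk k : K' ⟶ X) (ObjectProperty.hom_ext _ hkf)
    have : Mono (l ≫ kernel.ι f) := by rw [kernel.lift_ι]; infer_instance
    have : Mono l := mono_of_mono l (kernel.ι f)
    exact ((𝓛.serre t).inverseImage (𝓛.serre s).ι).prop_of_mono l h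
  · intro h
    exact h (kernel.ι f).hom (mono_hom _) (congrArg (fun x ↦ x.hom) (kernel.condition f))

lemma epiModSerre_iff_hom {X Y : (𝓛.serre s).FullSubcategory} (f : X ⟶ Y) :
    ((𝓛.serre t).inverseImage (𝓛.serre s).ι).epiModSerre f ↔
      ∀ {Q : R} (q : Y.obj ⟶ Q), Epi q → f.hom ≫ q = 0 → 𝓛.serre t Q := by
  constructor
  · intro h Q q hq hfq
    let Q' : (𝓛.serre s).FullSubcategory := ⟨Q, IrreducibleFamily.serre_of_epi q Y.property⟩
    have : Epi (ObjectProperty.homMk q : Y ⟶ Q') := epi_of_hom _ hq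
    let l := cokernel.desc f (ObjectProperty.homMk q : Y ⟶ Q') (ObjectProperty.hom_ext _ hfq)
    have : Epi (cokernel.π f ≫ l) := by rw [cokernel.π_desc]; infer_instance
    have : Epi l := epi_of_epi (cokernel.π f) l
    exact ((𝓛.serre t).inverseImage (𝓛.serre s).ι).prop_of_epi l h
  · intro h
    exact h (cokernel.π f).hom (epi_hom _) (congrArg (fun x ↦ x.hom) (cokernel.condition f))

/-- A test object of `R` may be replaced by its image in `X`, which belongs to the subcategory. -/
lemma epi_of_essential {X Y : (𝓛.serre s).FullSubcategory} {p : X ⟶ Y}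
    (hp : ∀ ⦃Z⦄ (g : Z ⟶ X), Epi (g ≫ p) → Epi g) {Z : R} (g : Z ⟶ X.obj)
    (hg : Epi (g ≫ p.hom)) : Epi g := by
  obtain ⟨J, π, m, hπ, hm, rfl⟩ := exists_factorization g
  let J' : (𝓛.serre s).FullSubcategory := ⟨J, IrreducibleFamily.serre_of_mono m X.property⟩
  have : Epi (π ≫ m ≫ p.hom) := by rwa [Category.assoc] at hg
  have := hp (ObjectProperty.homMk m : J' ⟶ X) (epi_of_hom _ (epi_of_epi π (m ≫ p.hom)))
  have : Epi m := epi_hom (ObjectProperty.homMk m : J' ⟶ X)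
  exact epi_comp _ _

lemma mono_of_essential {X Y : (𝓛.serre s).FullSubcategory} {i : X ⟶ Y}
    (hi : ∀ ⦃Z⦄ (g : Y ⟶ Z), Mono (i ≫ g) → Mono g) {Z : R} (g : Y.obj ⟶ Z)
    (hg : Mono (i.hom ≫ g)) : Mono g := by
  obtain ⟨J, π, m, hπ, hm, rfl⟩ := exists_factorization g
  let J' : (𝓛.serre s).FullSubcategory := ⟨J, IrreducibleFamily.serre_of_epi π Y.property⟩
  have : Mono ((i.hom ≫ π) ≫ m) := by rwa [Category.assoc]
  have := hi (ObjectProperty.homMk π : Y ⟶ J') (mono_of_hom _ (mono_of_mono (i.hom ≫ π) m))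
  have : Mono π := mono_hom (ObjectProperty.homMk π : Y ⟶ J')
  exact mono_comp _ _

end FullSubcategory

/-! ### The standard and costandard objects of a stratification -/

namespace Stratification

variable {R : Type u} [Category.{v} R] [Abelian R] {B : Type uB} {Λ : Type uL} [PartialOrder Λ]
  (S : Stratification R B Λ) (ε : Λ → Sgn)

instance simple_LLe (b : B) : Simple (S.LLe b) where
  mono_isIso_iff_nonzero {Y} f hf := by
    have := S.simple b
    have : Simple (S.LLe b).obj := S.simple b
    have := mono_hom f
    rw [← ObjectProperty.isIso_hom_iff, Simple.mono_isIso_iff_nonzero f.hom, not_iff_not]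
    exact ⟨fun h ↦ ObjectProperty.hom_ext _ h, fun h ↦ by rw [h]; rfl⟩

lemma not_ltProp_LLe (b : B) : ¬ S.ltProp (S.rho b) (S.LLe b) := fun h ↦
  lt_irrefl (S.rho b) (IrreducibleFamily.mem_of_mono (𝓛 := S.toIrreducibleFamily)
    (s := {c | S.rho c < S.rho b}) (𝟙 (S.L b)) h)

variable [AllFiniteLength R]

lemma exists_std (b : B) :
    ∃ (Y : S.Le (S.rho b)) (p : Y ⟶ S.LLe b), IsColocal (S.ltProp (S.rho b)) Y ∧ Epi p ∧
      (∀ ⦃Z : S.Le (S.rho b)⦄ (g : Z ⟶ Y), Epi (g ≫ p) → Epi g) ∧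
      (ε (S.rho b) = .plus → Projective Y) ∧
      (¬ ε (S.rho b) = .plus → (S.ltProp (S.rho b)).monoModSerre p) := by
  have := S.enough_projectives (S.rho b)
  exact exists_cover _ (S.not_ltProp_LLe b) _

lemma exists_costd (b : B) :
    ∃ (Y : S.Le (S.rho b)) (i : S.LLe b ⟶ Y), IsLocal (S.ltProp (S.rho b)) Y ∧ Mono i ∧
      (∀ ⦃Z : S.Le (S.rho b)⦄ (g : Y ⟶ Z), Mono (i ≫ g) → Mono g) ∧
      (ε (S.rho b) ≠ .plus → Injective Y) ∧
      (¬ ε (S.rho b) ≠ .plus → (S.ltProp (S.rho b)).epiModSerre i) := by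
  have := S.enough_injectives (S.rho b)
  exact exists_hull _ (S.not_ltProp_LLe b) _

/-- The standard object as an object of `R_{≤ ρ b}`. -/
noncomputable def stdLe (b : B) : S.Le (S.rho b) := (S.exists_std ε b).choose

/-- The costandard object as an object of `R_{≤ ρ b}`. -/
noncomputable def costdLe (b : B) : S.Le (S.rho b) := (S.exists_costd ε b).choose

/-- The projection of the standard object to its head. -/
noncomputable def headLe (b : B) : S.stdLe ε b ⟶ S.LLe b := (S.exists_std ε b).choose_spec.choose

/-- The inclusion of the socle of the costandard object. -/
noncomputable def socleLe (b : B) : S.LLe b ⟶ S.costdLe ε b :=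
  (S.exists_costd ε b).choose_spec.choose

lemma stdLe_spec (b : B) : IsColocal (S.ltProp (S.rho b)) (S.stdLe ε b) ∧ Epi (S.headLe ε b) ∧
      (∀ ⦃Z : S.Le (S.rho b)⦄ (g : Z ⟶ S.stdLe ε b), Epi (g ≫ S.headLe ε b) → Epi g) ∧
      (ε (S.rho b) = .plus → Projective (S.stdLe ε b)) ∧
      (¬ ε (S.rho b) = .plus → (S.ltProp (S.rho b)).monoModSerre (S.headLe ε b)) :=
  (S.exists_std ε b).choose_spec.choose_spec

lemma costdLe_spec (b : B) : IsLocal (S.ltProp (S.rho b)) (S.costdLe ε b) ∧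
      Mono (S.socleLe ε b) ∧
      (∀ ⦃Z : S.Le (S.rho b)⦄ (g : S.costdLe ε b ⟶ Z), Mono (S.socleLe ε b ≫ g) → Mono g) ∧
      (ε (S.rho b) ≠ .plus → Injective (S.costdLe ε b)) ∧
      (¬ ε (S.rho b) ≠ .plus → (S.ltProp (S.rho b)).epiModSerre (S.socleLe ε b)) :=
  (S.exists_costd ε b).choose_spec.choose_spec

/-- The standard and costandard objects attached to a stratification and signs. -/
noncomputable def stdData : StdData R B Λ where
  toIrreducibleFamily := S.toIrreducibleFamily
  rho := S.rho
  plus l := ε l = .plus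
  std b := (S.stdLe ε b).obj
  costd b := (S.costdLe ε b).obj
  head b := (S.headLe ε b).hom
  socle b := (S.socleLe ε b).hom
  epi_head b := by
    have := (S.stdLe_spec ε b).2.1
    exact epi_hom _
  mono_socle b := by
    have := (S.costdLe_spec ε b).2.1
    exact mono_hom _
  head_essential b _ g hg := epi_of_essential (S.stdLe_spec ε b).2.2.1 g hg
  socle_essential b _ g hg := mono_of_essential (S.costdLe_spec ε b).2.2.1 g hg
  std_le b := (S.stdLe ε b).property
  costd_le b := (S.costdLe ε b).property
  std_lt b M hM := ext1Zero_obj ((S.stdLe_spec ε b).1 ⟨M, IrreducibleFamily.serre_mono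
    (fun _ h ↦ le_of_lt h) hM⟩ hM).2
  costd_lt b M hM := ext1Zero_obj ((S.costdLe_spec ε b).1 ⟨M, IrreducibleFamily.serre_mono
    (fun _ h ↦ le_of_lt h) hM⟩ hM).2
  std_plus b hb M hM := by
    have := (S.stdLe_spec ε b).2.2.2.1 hb
    exact ext1Zero_obj (Y := ⟨M, hM⟩) (Ext1Zero.of_projective (X := S.stdLe ε b))
  costd_minus b hb M hM := by
    have := (S.costdLe_spec ε b).2.2.2.1 hb
    exact ext1Zero_obj (X := ⟨M, hM⟩) (Ext1Zero.of_injective (Y := S.costdLe ε b))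
  std_minus b hb _ i hi h0 :=
    (monoModSerre_iff_hom _).1 ((S.stdLe_spec ε b).2.2.2.2 hb) i hi h0
  costd_plus b hb _ p hp h0 :=
    (epiModSerre_iff_hom _).1 ((S.costdLe_spec ε b).2.2.2.2 (not_not.2 hb)) p hp h0

lemma isProjectiveCover_stdLe {b : B} (hb : ε (S.rho b) = .plus) :
    IsProjectiveCover ((S.j (S.rho b)).obj (S.stdLe ε b)) (S.LStratum b) := by
  obtain ⟨h₁, h₂, h₃, h₄, -⟩ := S.stdLe_spec ε b
  have := h₄ hb
  exact isProjectiveCover_obj (S.j (S.rho b)) (S.not_ltProp_LLe b) h₁ _ h₃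

lemma isInjectiveHull_costdLe {b : B} (hb : ε (S.rho b) ≠ .plus) :
    IsInjectiveHull ((S.j (S.rho b)).obj (S.costdLe ε b)) (S.LStratum b) := by
  obtain ⟨h₁, h₂, h₃, h₄, -⟩ := S.costdLe_spec ε b
  have := h₄ hb
  exact isInjectiveHull_obj (S.j (S.rho b)) (S.not_ltProp_LLe b) h₁ _ h₃

omit [AllFiniteLength R] in
lemma nonempty_iso_obj {l : Λ} {X Y : S.Le l} (h : Nonempty (X ≅ Y)) :
    Nonempty (X.obj ≅ Y.obj) :=
  h.map fun e ↦ (S.leProp l).ι.mapIso e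

/-- Universal arrows and projective covers are unique up to isomorphism, so it is enough that the
chosen object qualifies. For sign − this is because its head becomes an isomorphism in the stratum.
-/
lemma isEpsStandard_iff {b : B} {X : R} :
    S.IsEpsStandard ε b X ↔ Nonempty (X ≅ (S.stdData ε).std b) := by
  cases hb : ε (S.rho b) with
  | plus =>
    have key : IsLeftAdjointValue (S.j (S.rho b)) ((S.j (S.rho b)).obj (S.stdLe ε b))
      (S.stdLe ε b) := (S.stdLe_spec ε b).1.isLeftAdjointValue _ (Iso.refl _)
    simp only [IsEpsStandard, hb]
    constructor
    · rintro ⟨P, Y, hP, hY, ⟨e⟩⟩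
      obtain ⟨a⟩ := hP.iso_unique (S.isProjectiveCover_stdLe ε hb)
      obtain ⟨f⟩ := S.nonempty_iso_obj (hY.iso_unique key a)
      exact ⟨e ≪≫ f⟩
    · rintro ⟨e⟩
      exact ⟨_, S.stdLe ε b, S.isProjectiveCover_stdLe ε hb, key, ⟨e⟩⟩
  | minus =>
    obtain ⟨h₁, h₂, h₃, -, h₅⟩ := S.stdLe_spec ε b
    have := Localization.inverts (S.j (S.rho b)) (S.ltProp (S.rho b)).isoModSerre (S.headLe ε b)
      ((S.ltProp (S.rho b)).isoModSerre_of_epi _ (h₅ (by simp [hb])))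
    have key : IsLeftAdjointValue (S.j (S.rho b)) (S.LStratum b) (S.stdLe ε b) :=
      h₁.isLeftAdjointValue _ (asIso ((S.j (S.rho b)).map (S.headLe ε b))).symm
    simp only [IsEpsStandard, hb]
    constructor
    · rintro ⟨Y, hY, ⟨e⟩⟩
      obtain ⟨f⟩ := S.nonempty_iso_obj (hY.iso_unique key (Iso.refl _))
      exact ⟨e ≪≫ f⟩
    · rintro ⟨e⟩
      exact ⟨S.stdLe ε b, key, ⟨e⟩⟩

lemma isEpsCostandard_iff {b : B} {X : R} :
    S.IsEpsCostandard ε b X ↔ Nonempty (X ≅ (S.stdData ε).costd b) := by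
  cases hb : ε (S.rho b) with
  | minus =>
    have hb' : ε (S.rho b) ≠ .plus := by simp [hb]
    have key : IsRightAdjointValue (S.j (S.rho b)) ((S.j (S.rho b)).obj (S.costdLe ε b))
      (S.costdLe ε b) := (S.costdLe_spec ε b).1.isRightAdjointValue _ (Iso.refl _)
    simp only [IsEpsCostandard, hb]
    constructor
    · rintro ⟨P, Y, hP, hY, ⟨e⟩⟩
      obtain ⟨a⟩ := hP.iso_unique (S.isInjectiveHull_costdLe ε hb')
      obtain ⟨f⟩ := S.nonempty_iso_obj (hY.iso_unique key a)
      exact ⟨e ≪≫ f⟩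
    · rintro ⟨e⟩
      exact ⟨_, S.costdLe ε b, S.isInjectiveHull_costdLe ε hb', key, ⟨e⟩⟩
  | plus =>
    obtain ⟨h₁, h₂, h₃, -, h₅⟩ := S.costdLe_spec ε b
    have := Localization.inverts (S.j (S.rho b)) (S.ltProp (S.rho b)).isoModSerre (S.socleLe ε b)
      ((S.ltProp (S.rho b)).isoModSerre_of_mono _ (h₅ (by simp [hb])))
    have key : IsRightAdjointValue (S.j (S.rho b)) (S.LStratum b) (S.costdLe ε b) :=
      h₁.isRightAdjointValue _ (asIso ((S.j (S.rho b)).map (S.socleLe ε b))).symm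
    simp only [IsEpsCostandard, hb]
    constructor
    · rintro ⟨Y, hY, ⟨e⟩⟩
      obtain ⟨f⟩ := S.nonempty_iso_obj (hY.iso_unique key (Iso.refl _))
      exact ⟨e ≪≫ f⟩
    · rintro ⟨e⟩
      exact ⟨S.costdLe ε b, key, ⟨e⟩⟩

lemma isIso_j_map_iff {l : Λ} {X Y : S.Le l} (f : X ⟶ Y) :
    IsIso ((S.j l).map f) ↔
      (∀ {K : R} (k : K ⟶ X.obj), Mono k → k ≫ f.hom = 0 → (S.stdData ε).lt l K) ∧
      (∀ {Q : R} (q : Y.obj ⟶ Q), Epi q → f.hom ≫ q = 0 → (S.stdData ε).lt l Q) := by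
  rw [ObjectProperty.SerreClassLocalization.isIso_map_iff (S.j l) (S.ltProp l),
    ObjectProperty.isoModSerre_iff, monoModSerre_iff_hom, epiModSerre_iff_hom]
  rfl

/-- Removes the quotient category from property (iii): colocality of Δ(b) lifts an isomorphism
P_λ(b) ≅ j T to a morphism in `R`, and invertibility becomes a condition on its kernel and cokernel.
-/
lemma hasTiltingStratum_iff_of_plus {b : B} (hb : ε (S.rho b) = .plus) {T : R} :
    S.HasTiltingStratum ε b T ↔ (S.stdData ε).le (S.rho b) T ∧
      ∃ φ : (S.stdData ε).std b ⟶ T,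
        (∀ {K : R} (k : K ⟶ (S.stdData ε).std b), Mono k → k ≫ φ = 0 →
          (S.stdData ε).lt (S.rho b) K) ∧
        (∀ {Q : R} (q : T ⟶ Q), Epi q → φ ≫ q = 0 → (S.stdData ε).lt (S.rho b) Q) := by
  simp only [HasTiltingStratum, hb]
  constructor
  · rintro ⟨h, hT⟩
    refine ⟨h, ?_⟩
    obtain ⟨e⟩ := (S.isProjectiveCover_stdLe ε hb).iso_unique hT
    obtain ⟨f, hf, -⟩ := (S.stdLe_spec ε b).1.existsUnique_map (S.j (S.rho b)) e.hom
    have : IsIso ((S.j (S.rho b)).map f) := by rw [hf]; infer_instance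
    exact ⟨f.hom, (S.isIso_j_map_iff ε f).1 this⟩
  · rintro ⟨h, φ, hφ⟩
    refine ⟨h, ?_⟩
    have := (S.isIso_j_map_iff ε (ObjectProperty.homMk φ :
      S.stdLe ε b ⟶ (⟨T, h⟩ : S.Le (S.rho b)))).2 hφ
    exact (S.isProjectiveCover_stdLe ε hb).of_iso (asIso ((S.j (S.rho b)).map
      (ObjectProperty.homMk φ : S.stdLe ε b ⟶ (⟨T, h⟩ : S.Le (S.rho b)))))

lemma hasTiltingStratum_iff_of_minus {b : B} (hb : ε (S.rho b) = .minus) {T : R} :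
    S.HasTiltingStratum ε b T ↔ (S.stdData ε).le (S.rho b) T ∧
      ∃ φ : T ⟶ (S.stdData ε).costd b,
        (∀ {K : R} (k : K ⟶ T), Mono k → k ≫ φ = 0 → (S.stdData ε).lt (S.rho b) K) ∧
        (∀ {Q : R} (q : (S.stdData ε).costd b ⟶ Q), Epi q → φ ≫ q = 0 →
          (S.stdData ε).lt (S.rho b) Q) := by
  have hb' : ε (S.rho b) ≠ .plus := by simp [hb]
  simp only [HasTiltingStratum, hb]
  constructor
  · rintro ⟨h, hT⟩
    refine ⟨h, ?_⟩
    obtain ⟨e⟩ := hT.iso_unique (S.isInjectiveHull_costdLe ε hb')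
    obtain ⟨f, hf, -⟩ := (S.costdLe_spec ε b).1.existsUnique_map (S.j (S.rho b)) e.hom
    have : IsIso ((S.j (S.rho b)).map f) := by rw [hf]; infer_instance
    exact ⟨f.hom, (S.isIso_j_map_iff ε f).1 this⟩
  · rintro ⟨h, φ, hφ⟩
    refine ⟨h, ?_⟩
    have := (S.isIso_j_map_iff ε (ObjectProperty.homMk φ :
      (⟨T, h⟩ : S.Le (S.rho b)) ⟶ S.costdLe ε b)).2 hφ
    exact (S.isInjectiveHull_costdLe ε hb').of_iso (asIso ((S.j (S.rho b)).map
      (ObjectProperty.homMk φ : (⟨T, h⟩ : S.Le (S.rho b)) ⟶ S.costdLe ε b))).symm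

end Stratification

/-! ### Directed sums in ind-completions -/

section IndCompletion

/-- In a Grothendieck category a directed union of subobjects is their colimit. The family is
replaced by a small model so that the index category has the right universe level. -/
lemma exists_colimit_of_directed {C : Type u} [Category.{v} C] [Abelian C]
    [IsGrothendieckAbelian.{w} C] {X : C} (𝒱 : Set (Subobject X)) (hne : 𝒱.Nonempty)
    (hdir : DirectedOn (· ≤ ·) 𝒱) (hlub : IsLUB 𝒱 ⊤) :
    ∃ (J : Type w) (_ : SmallCategory J) (_ : IsFiltered J) (F : J ⥤ C) (c : Cocone F)
      (_ : IsColimit c) (e : c.pt ≅ X), ∀ j, ∃ W ∈ 𝒱, ∃ f : F.obj j ⟶ W,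
        f ≫ W.arrow = c.ι.app j ≫ e.hom := by
  have : Nonempty 𝒱 := hne.to_subtype
  have : IsDirectedOrder 𝒱 := directedOn_iff_isDirectedOrder.1 hdir
  have hsm : Small.{w} 𝒱 := small_subset (Set.subset_univ _)
  have : EssentiallySmall.{w} 𝒱 := essentiallySmall_of_small_of_locallySmall _
  let E := equivSmallModel.{w} 𝒱
  have : IsFiltered (SmallModel.{w} 𝒱) := IsFiltered.of_equivalence E
  let G : 𝒱 ⥤ Subobject X := 
    (show Monotone (fun W : 𝒱 ↦ (W : Subobject X)) from fun _ _ h ↦ h).functor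
  let F : SmallModel.{w} 𝒱 ⥤ MonoOver X := E.inverse ⋙ G ⋙ Subobject.representative
  let c : Cocone (F ⋙ MonoOver.forget X) :=
    { pt := Over.mk (𝟙 X)
      ι :=
        { app j := Over.homMk (F.obj j).obj.hom
          naturality j j' f := by
            refine Over.OverMorphism.ext ?_
            exact (MonoOver.w (F.map f)).trans (Category.comp_id _).symm } }
  have : Mono c.pt.hom := inferInstanceAs (Mono (𝟙 X))
  have hc := IsGrothendieckAbelian.isColimitMapCoconeOfSubobjectMkEqISup F c (by
    refine le_antisymm (le_top.trans (hlub.2 fun W hW ↦ ?_)) (iSup_le fun j ↦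
      le_top.trans (Subobject.mk_eq_top_of_isIso (𝟙 X)).ge)
    have h : W ≤ (E.inverse.obj (E.functor.obj ⟨W, hW⟩)).1 :=
      leOfHom (E.unit.app (⟨W, hW⟩ : 𝒱))
    exact h.trans ((Subobject.mk_arrow _).ge.trans (le_iSup
      (fun j ↦ Subobject.mk (F.obj j).obj.hom) (E.functor.obj ⟨W, hW⟩))))
  exact ⟨_, inferInstance, inferInstance, _, _, hc, Iso.refl _, fun j ↦
    ⟨(E.inverse.obj j).1, (E.inverse.obj j).2, 𝟙 ((E.inverse.obj j).1 : C),
      (Category.id_comp _).trans (Category.comp_id _).symm⟩⟩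

/-- By Yoneda, maps from a representable object are elements of a presheaf value. The inclusion in
presheaves preserves filtered colimits, so such an element comes from one stage of the union. -/
lemma exists_factor_of_directed {C : Type w} [SmallCategory C] [Abelian C] {X : Ind C}
    (𝒱 : Set (Subobject X)) (hne : 𝒱.Nonempty) (hdir : DirectedOn (· ≤ ·) 𝒱)
    (hlub : IsLUB 𝒱 ⊤) {Y : C} (g : Ind.yoneda.obj Y ⟶ X) :
    ∃ W ∈ 𝒱, ∃ f : Ind.yoneda.obj Y ⟶ (W : Ind C), f ≫ W.arrow = g := by
  obtain ⟨J, _, _, F, c, hc, e, he⟩ := exists_colimit_of_directed 𝒱 hne hdir hlub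
  let a := Ind.yonedaCompInclusion.app Y
  have hc' := isColimitOfPreserves (Ind.inclusion C ⋙ (evaluation _ _).obj (Opposite.op Y)) hc
  obtain ⟨j, x, hx⟩ := Types.jointly_surjective_of_isColimit hc'
    (yonedaEquiv (a.inv ≫ (Ind.inclusion C).map (g ≫ e.inv)))
  obtain ⟨W, hW, f, hf⟩ := he j
  refine ⟨W, hW, (Ind.inclusion C).preimage (a.hom ≫ yonedaEquiv.symm x) ≫ f, ?_⟩
  rw [Category.assoc, hf]
  apply (Ind.inclusion C).map_injective
  have key : yonedaEquiv.symm x ≫ (Ind.inclusion C).map (c.ι.app j) =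
      a.inv ≫ (Ind.inclusion C).map (g ≫ e.inv) := by
    apply yonedaEquiv.injective
    rw [yonedaEquiv_comp, Equiv.apply_symm_apply]
    exact hx
  rw [Functor.map_comp, Functor.map_comp, Functor.map_preimage, Category.assoc,
    reassoc_of% key, ← Functor.map_comp, Category.assoc, e.inv_hom_id, Category.comp_id]
  exact Iso.hom_inv_id_assoc a _

end IndCompletion

/-! ### From projectives and injectives with flags to the vanishing of `Ext¹` and `Ext²` -/

lemma nonempty_abelian_smallModel (R : Type u) [Category.{v} R] [Abelian R]
    [EssentiallySmall.{w} R] : Nonempty (Abelian (SmallModel.{w} R)) := by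
  let E := equivSmallModel.{w} R
  let : Preadditive (SmallModel.{w} R) := .ofFullyFaithful E.fullyFaithfulInverse
  have : HasFiniteProducts (SmallModel.{w} R) :=
    ⟨fun n ↦ Adjunction.hasLimitsOfShape_of_equivalence E.inverse⟩
  exact ⟨abelianOfEquivalence E.inverse⟩

lemma Filt.op {C : Type u} [Category.{v} C] [Abelian C] {Φ : ObjectProperty C} {X : C}
    (h : Filt Φ X) : Filt Φ.op (Opposite.op X) :=
  h.closed (P := fun X ↦ Filt Φ.op (Opposite.op X)) (fun _ h ↦ Filt.zero h.op)
    (fun _ h ↦ Filt.single h) fun _ _ _ _ _ h hX hZ ↦ Filt.ext h.op hZ hX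

lemma Filt.mono {C : Type u} [Category.{v} C] [Abelian C] {Φ Ψ : ObjectProperty C} {X : C}
    (h : Filt Φ X) (hΦ : ∀ X, Φ X → Ψ X) : Filt Ψ X :=
  h.closed (fun _ ↦ Filt.zero) (fun _ h ↦ Filt.single (hΦ _ h)) fun _ _ _ _ _ h ↦ Filt.ext h

namespace Stratification

variable {R : Type u} [Category.{v} R] [Abelian R] {B : Type uB} {Λ : Type uL} [PartialOrder Λ]
  {S : Stratification R B Λ} {ε : Λ → Sgn} [AllFiniteLength R]

lemma costdFilt_of_hasFlagBottom {b : B} {V : R}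
    (h : HasFlagBottom (S.IsEpsCostandard ε) b (fun c ↦ S.rho b ≤ S.rho c) V) :
    (S.stdData ε).costdFilt (S.rho b) V ∧
      ∃ i : (S.stdData ε).costd b ⟶ V, Mono i := by
  obtain ⟨Z, X, i, p, hip, hX, hZ⟩ := h.exists_ses
  obtain ⟨e⟩ := (S.isEpsCostandard_iff ε).1 hX
  have := hip.mono
  exact ⟨Filt.cons hip ⟨b, le_rfl, ⟨e⟩⟩ (hZ.mono fun X ⟨d, hd, hX⟩ ↦
    ⟨d, hd, (S.isEpsCostandard_iff ε).1 hX⟩), e.inv ≫ i, inferInstance⟩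

/-- The bottom section embeds ∇(c) in an injective ∇-filtered object, and this embedding extends
along any monomorphism from ∇(c). -/
lemma effaceable_of_iNablaHat (h : S.INablaHat ε) : (S.stdData ε).Effaceable := by
  intro c Y i hi
  obtain ⟨I, hI, hf⟩ := h c
  obtain ⟨hV, a, ha⟩ := costdFilt_of_hasFlagBottom hf
  exact ⟨I, Injective.factorThru a i, hV, by rwa [Injective.comp_factorThru]⟩

lemma effaceable_op_of_pDeltaHat (h : S.PDeltaHat ε) : (S.stdData ε).op.Effaceable := by
  intro c Y i hi
  obtain ⟨P, hP, hf⟩ := h c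
  obtain ⟨Z, X, j, p, hip, hX, hZ⟩ := hf.exists_ses
  obtain ⟨e⟩ := (S.isEpsStandard_iff ε).1 hX
  let q : Y.unop ⟶ (S.stdData ε).std c := i.unop
  have : Epi q := @unop_epi_of_mono _ _ _ _ i hi
  have := hip.epi
  refine ⟨Opposite.op P, (Projective.factorThru (p ≫ e.hom) q).op, ?_, ?_⟩
  · refine Filt.ext hip.op (Filt.single ⟨c, le_rfl, ⟨e.symm.op⟩⟩) (hZ.op.mono ?_)
    rintro X ⟨d, hd, hX⟩
    obtain ⟨e'⟩ := (S.isEpsStandard_iff ε).1 hX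
    exact ⟨d, hd, ⟨e'.symm.op⟩⟩
  · have e1 : i ≫ (Projective.factorThru (p ≫ e.hom) q).op = (p ≫ e.hom).op :=
      congrArg Quiver.Hom.op (Projective.factorThru_comp (p ≫ e.hom) q)
    have : Epi (p ≫ e.hom) := epi_comp _ _
    rw [e1]
    exact op_mono_of_epi _

/-- The injective object now lives only in the ind-completion. The extended map from `Y` factors
through one of the subobjects with a finite flag, and its restriction to ∇(c) stays mono. -/
lemma effaceable_of_iNablaHatAsc [EssentiallySmall.{w} R] (h : INablaHatAsc.{w} S ε) :
    (S.stdData ε).Effaceable := by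
  intro c Y i hi
  obtain ⟨I, hI, -, 𝒱, hne, hdir, hlub, h𝒱⟩ := h c
  obtain ⟨hab⟩ := nonempty_abelian_smallModel.{w} R
  obtain ⟨W₀, hW₀⟩ := hne
  obtain ⟨V₀, ⟨e₀⟩, hV₀⟩ := h𝒱 W₀ hW₀
  obtain ⟨-, a, ha⟩ := costdFilt_of_hasFlagBottom hV₀
  have : Mono ((toInd.{w} R).map a) := inferInstance
  have : Mono ((toInd.{w} R).map i) := inferInstance
  let α : (toInd.{w} R).obj ((S.stdData ε).costd c) ⟶ I :=
    (toInd.{w} R).map a ≫ e₀.inv ≫ W₀.arrow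
  have hα : (toInd.{w} R).map i ≫ Injective.factorThru α ((toInd.{w} R).map i) = α :=
    Injective.comp_factorThru _ _
  obtain ⟨W, hW, f, hf⟩ := exists_factor_of_directed 𝒱 ⟨W₀, hW₀⟩ hdir hlub
    (Y := (equivSmallModel.{w} R).functor.obj Y)
    (Injective.factorThru α ((toInd.{w} R).map i))
  obtain ⟨V, ⟨e⟩, hV⟩ := h𝒱 W hW
  let f' : (toInd.{w} R).obj Y ⟶ (toInd.{w} R).obj V := f ≫ e.hom
  refine ⟨V, (toInd.{w} R).preimage f', (costdFilt_of_hasFlagBottom hV).1,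
    (toInd.{w} R).mono_of_mono_map ?_⟩
  have h1 : (toInd.{w} R).map (i ≫ (toInd.{w} R).preimage f') ≫ e.inv ≫ W.arrow = α := by
    rw [Functor.map_comp, Functor.map_preimage, ← hα, ← hf]
    simp [f']
  have : Mono ((toInd.{w} R).map (i ≫ (toInd.{w} R).preimage f') ≫ e.inv ≫ W.arrow) := by
    rw [h1]
    infer_instance
  exact mono_of_mono _ (e.inv ≫ W.arrow)

lemma isStratified_of_effaceable (hwf : WellFounded fun b c : B ↦ S.rho b < S.rho c)
    (h : (S.stdData ε).Effaceable) : (S.stdData ε).IsStratified :=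
  ⟨StdData.ext1Zero_std_costd h, StdData.ext2Zero_std_costd h, hwf⟩

lemma isStratified_of_effaceable_op (hwf : WellFounded fun b c : B ↦ S.rho b < S.rho c)
    (h : (S.stdData ε).op.Effaceable) : (S.stdData ε).IsStratified :=
  ⟨fun b c ↦ (StdData.ext1Zero_std_costd h c b).unop,
    fun b c ↦ (StdData.ext2Zero_std_costd h c b).unop, hwf⟩

end Stratification

/-! ### Finiteness conditions -/

section FiniteAbelian

variable {R : Type u} [Category.{v} R] [Abelian R]

/-- Labels occurring in an extension occur in one of the two ends, by closure under extensions of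
the Serre subcategory for their union. -/
lemma finite_compositionFactors [AllFiniteLength R] {B : Type uB} (𝓛 : IrreducibleFamily R B)
    (V : R) : {b | IsCompositionFactor (𝓛.L b) V}.Finite := by
  have hmem : ∀ {s : Set B} {X : R}, 𝓛.serre s X → {b | IsCompositionFactor (𝓛.L b) X} ⊆ s :=
    fun h b hb ↦ h b hb
  refine 𝓛.serre_induction (s := Set.univ)
    (P := fun V ↦ {b | IsCompositionFactor (𝓛.L b) V}.Finite) (fun X hX ↦ ?_) (fun b _ ↦ ?_)
    (fun X Y Z i p h _ hX hZ ↦ ?_) V fun _ _ ↦ trivial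
  · exact Set.finite_empty.subset (hmem (IrreducibleFamily.serre_of_isZero hX))
  · exact (Set.finite_singleton b).subset (hmem (𝓛.serre_L {b} b rfl))
  · exact (hX.union hZ).subset (hmem (IrreducibleFamily.serre_of_ses h (fun _ h ↦ Or.inl h)
      fun _ h ↦ Or.inr h))

variable {k : Type uk} [Field k] [Linear k R]

lemma IsFiniteAbelian.allFiniteLength (h : IsFiniteAbelian k R) : AllFiniteLength R := by
  obtain ⟨A, _, _, _, e, -⟩ := h
  have : IsNoetherianRing A := isNoetherian_of_tower k inferInstance
  have : IsArtinianRing A := IsArtinianRing.of_finite k A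
  have : PreservesFiniteLimits (ModuleCat.isFG A).ι :=
    inferInstanceAs (PreservesFiniteLimits (forget₂ (FGModuleCat A) (ModuleCat A)))
  have hemb := fun V ↦ subobject_orderEmbedding (e.functor ⋙ (ModuleCat.isFG A).ι) V
  constructor
  · intro V
    obtain ⟨i⟩ := hemb V
    have : Module.Finite A ((e.functor ⋙ (ModuleCat.isFG A).ι).obj V) :=
      (e.functor.obj V).property
    exact ⟨OrderEmbedding.wellFoundedGT
      (RelEmbedding.trans i (ModuleCat.subobjectModule _).toOrderEmbedding)⟩
  · intro V
    obtain ⟨i⟩ := hemb V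
    have : Module.Finite A ((e.functor ⋙ (ModuleCat.isFG A).ι).obj V) :=
      (e.functor.obj V).property
    exact ⟨OrderEmbedding.wellFoundedLT
      (RelEmbedding.trans i (ModuleCat.subobjectModule _).toOrderEmbedding)⟩

/-- Each irreducible object is a quotient of the regular module, which has finitely many composition
factors up to isomorphism. Finiteness of `B` makes the order on labels well-founded. -/
lemma IsFiniteAbelian.finite_labels (h : IsFiniteAbelian k R) {B : Type uB}
    (𝓛 : IrreducibleFamily R B) : Finite B := by
  have := h.allFiniteLength
  obtain ⟨A, _, _, _, e, -⟩ := h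
  let P : R := e.inverse.obj (FGModuleCat.of A A)
  rw [← Set.finite_univ_iff]
  refine (finite_compositionFactors 𝓛 P).subset fun b _ ↦ ?_
  have hb : ¬ Subsingleton (e.functor.obj (𝓛.L b)) := fun hs ↦ by
    refine 𝓛.not_isZero b ((IsZero.iff_id_eq_zero _).2 (e.functor.map_injective ?_))
    ext x
    exact Subsingleton.elim _ _
  rw [not_subsingleton_iff_nontrivial] at hb
  obtain ⟨x, hx⟩ := exists_ne (0 : e.functor.obj (𝓛.L b))
  let f : FGModuleCat.of A A ⟶ e.functor.obj (𝓛.L b) :=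
    ObjectProperty.homMk (ModuleCat.ofHom (LinearMap.toSpanSingleton A _ x))
  have hf : f ≠ 0 := fun h0 ↦ hx (by
    have := congrArg (fun g ↦ g.hom.hom (1 : A)) h0
    simpa [f] using this)
  have hp : e.inverse.map f ≫ e.unitInv.app (𝓛.L b) ≠ 0 := fun h0 ↦ hf (by
    have h1 : e.inverse.map f = 0 := by
      rw [← cancel_mono (e.unitInv.app (𝓛.L b)), h0, zero_comp]
    exact e.inverse.map_injective (h1.trans (Functor.map_zero _ _ _).symm))
  exact ⟨P, 𝟙 P, _, inferInstance, IrreducibleFamily.epi_of_ne_zero hp⟩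

end FiniteAbelian

lemma wellFounded_lt_of_finite_Iic {Λ : Type uL} [PartialOrder Λ]
    (h : ∀ l : Λ, (Set.Iic l).Finite) : WellFounded fun a b : Λ ↦ a < b :=
  Subrelation.wf (fun {_ b} hab ↦ Set.ncard_lt_ncard
    ⟨Set.Iic_subset_Iic.2 hab.le, fun h' ↦ hab.not_ge (h' Set.self_mem_Iic)⟩ (h b))
    (measure fun l : Λ ↦ (Set.Iic l).ncard).wf

namespace Stratification

variable {R : Type u} [Category.{v} R] [Abelian R] {B : Type uB} {Λ : Type uL} [PartialOrder Λ]
  {S : Stratification R B Λ} {ε : Λ → Sgn} {k : Type uk} [Field k] [Linear k R]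

lemma IsFiniteEpsStratified.isStratified [AllFiniteLength R]
    (h : S.IsFiniteEpsStratified ε k) : (S.stdData ε).IsStratified := by
  have := h.finite_abelian.finite_labels S.toIrreducibleFamily
  have : IsTrans B fun b c ↦ S.rho b < S.rho c := ⟨fun _ _ _ ↦ lt_trans⟩
  have : Std.Irrefl fun b c : B ↦ S.rho b < S.rho c := ⟨fun _ ↦ lt_irrefl _⟩
  have hwf := Finite.wellFounded_of_trans_of_irrefl fun b c : B ↦ S.rho b < S.rho c
  rcases h.flags with h | h
  · exact isStratified_of_effaceable_op hwf (effaceable_op_of_pDeltaHat h)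
  · exact isStratified_of_effaceable hwf (effaceable_of_iNablaHat h)

lemma IsLowerFiniteEpsStratified.isStratified [AllFiniteLength R] [EssentiallySmall.{w} R]
    (h : IsLowerFiniteEpsStratified.{w} S ε k) : (S.stdData ε).IsStratified :=
  isStratified_of_effaceable (InvImage.wf S.rho (wellFounded_lt_of_finite_Iic h.lower_finite))
    (effaceable_of_iNablaHatAsc h.flags)

/-! ### Flags of standard and costandard objects -/

variable [AllFiniteLength R]

lemma isEpsStandard_iso (b : B) ⦃X Y : R⦄ (e : X ≅ Y) (h : S.IsEpsStandard ε b X) :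
    S.IsEpsStandard ε b Y :=
  (S.isEpsStandard_iff ε).2 (((S.isEpsStandard_iff ε).1 h).map fun f ↦ e.symm ≪≫ f)

lemma isEpsCostandard_iso (b : B) ⦃X Y : R⦄ (e : X ≅ Y) (h : S.IsEpsCostandard ε b X) :
    S.IsEpsCostandard ε b Y :=
  (S.isEpsCostandard_iff ε).2 (((S.isEpsCostandard_iff ε).1 h).map fun f ↦ e.symm ≪≫ f)

lemma isEpsStandard_not_isZero (b : B) ⦃X : R⦄ (h0 : IsZero X) : ¬ S.IsEpsStandard ε b X := by
  intro h
  obtain ⟨e⟩ := (S.isEpsStandard_iff ε).1 h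
  exact (S.stdData ε).head_ne_zero b ((h0.of_iso e.symm).eq_of_src _ _)

lemma isEpsCostandard_not_isZero (b : B) ⦃X : R⦄ (h0 : IsZero X) :
    ¬ S.IsEpsCostandard ε b X := by
  intro h
  obtain ⟨e⟩ := (S.isEpsCostandard_iff ε).1 h
  exact (S.stdData ε).socle_ne_zero b ((h0.of_iso e.symm).eq_of_tgt _ _)

variable (hD : (S.stdData ε).IsStratified)
include hD

lemma leftOrth_of_filt {V : R} (h : Filt (fun X ↦ ∃ b, S.IsEpsStandard ε b X) V) :
    (S.stdData ε).leftOrth V :=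
  h.closed (fun _ h _ ↦ Ext1Zero.of_isZero_left h) (fun _ ⟨b, hb⟩ ↦ by
    obtain ⟨e⟩ := (S.isEpsStandard_iff ε).1 hb
    exact StdData.leftOrth_iso e.symm (StdData.leftOrth_std hD b))
    fun _ _ _ _ _ ↦ StdData.leftOrth_ext

lemma rightOrth_of_filt {V : R} (h : Filt (fun X ↦ ∃ b, S.IsEpsCostandard ε b X) V) :
    (S.stdData ε).rightOrth V :=
  h.closed (fun _ h _ ↦ Ext1Zero.of_isZero_right h) (fun _ ⟨b, hb⟩ ↦ by
    obtain ⟨e⟩ := (S.isEpsCostandard_iff ε).1 hb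
    exact StdData.rightOrth_iso e.symm (StdData.rightOrth_costd hD b))
    fun _ _ _ _ _ ↦ StdData.rightOrth_ext

lemma filt_of_leftOrth {V : R} (h : (S.stdData ε).leftOrth V) :
    Filt (fun X ↦ ∃ b, S.IsEpsStandard ε b X) V :=
  StdData.leftOrth_induction hD (fun _ ↦ Filt.zero)
    (fun _ b hb ↦ Filt.single ⟨b, (S.isEpsStandard_iff ε).2 hb⟩) (fun _ _ _ _ _ ↦ Filt.ext) h

lemma filt_of_rightOrth {V : R} (h : (S.stdData ε).rightOrth V) :
    Filt (fun X ↦ ∃ b, S.IsEpsCostandard ε b X) V :=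
  StdData.rightOrth_induction hD (fun _ ↦ Filt.zero)
    (fun _ b hb ↦ Filt.single ⟨b, (S.isEpsCostandard_iff ε).2 hb⟩) (fun _ _ _ _ _ ↦ Filt.ext) h

lemma hasFlag_of_leftOrth {V : R} (h : (S.stdData ε).leftOrth V) :
    HasFlag (S.IsEpsStandard ε) V :=
  Filt.snoc_induction (P := HasFlag (S.IsEpsStandard ε))
    (fun _ _ _ _ _ h hX ⟨_, hZ⟩ ↦
      (HasFlag.snoc isEpsStandard_iso isEpsStandard_not_isZero hX h hZ).hasFlag)
    (IsSES.of_mono (0 : (0 : R) ⟶ V)) (fun _ e ↦ HasFlag.of_isZero ((isZero_zero R).of_iso e.symm))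
    (filt_of_leftOrth hD (StdData.leftOrth_iso (cokernelZeroIsoTarget).symm h))

lemma hasFlag_of_rightOrth {V : R} (h : (S.stdData ε).rightOrth V) :
    HasFlag (S.IsEpsCostandard ε) V :=
  Filt.snoc_induction (P := HasFlag (S.IsEpsCostandard ε))
    (fun _ _ _ _ _ h hX ⟨_, hZ⟩ ↦
      (HasFlag.snoc isEpsCostandard_iso isEpsCostandard_not_isZero hX h hZ).hasFlag)
    (IsSES.of_mono (0 : (0 : R) ⟶ V)) (fun _ e ↦ HasFlag.of_isZero ((isZero_zero R).of_iso e.symm))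
    (filt_of_rightOrth hD (StdData.rightOrth_iso (cokernelZeroIsoTarget).symm h))

lemma hasBottomStandard_iff {b : B} {V : R} :
    S.HasBottomStandard ε b V ↔ (S.stdData ε).StdBottom b (fun _ ↦ True) V := by
  constructor
  · intro h
    obtain ⟨Z, X, i, p, hip, hX, hZ⟩ := HasFlagBottom.exists_ses h
    obtain ⟨e⟩ := (S.isEpsStandard_iff ε).1 hX
    exact ⟨Z, e.inv ≫ i, p, hip.comp_left_iso _,
      leftOrth_of_filt hD (hZ.mono fun _ ⟨c, _, hc⟩ ↦ ⟨c, hc⟩), trivial⟩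
  · rintro ⟨Z, i, p, hip, hZ, -⟩
    exact Filt.snoc_induction (P := S.HasBottomStandard ε b)
      (fun _ _ _ _ _ h hX ⟨_, hZ⟩ ↦
        HasFlagBottom.snoc isEpsStandard_iso isEpsStandard_not_isZero hX h hZ) hip
      (fun _ e ↦ HasFlagBottom.single isEpsStandard_iso isEpsStandard_not_isZero
        ((S.isEpsStandard_iff ε).2 ⟨e.symm⟩)) (filt_of_leftOrth hD hZ)

lemma hasTopCostandard_iff {b : B} {V : R} :
    S.HasTopCostandard ε b V ↔ (S.stdData ε).CostdTop b (fun _ ↦ True) V := by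
  constructor
  · intro h
    obtain ⟨Z, X, i, p, hip, hX, hZ⟩ := HasFlagTop.exists_ses h
    obtain ⟨e⟩ := (S.isEpsCostandard_iff ε).1 hX
    exact ⟨Z, i, p ≫ e.hom, hip.comp_right_iso _,
      rightOrth_of_filt hD (hZ.mono fun _ ⟨c, _, hc⟩ ↦ ⟨c, hc⟩), trivial⟩
  · rintro ⟨Z, i, p, hip, hZ, -⟩
    exact HasFlag.snoc isEpsCostandard_iso isEpsCostandard_not_isZero
      (hasFlag_of_rightOrth hD hZ) hip ((S.isEpsCostandard_iff ε).2 ⟨Iso.refl _⟩)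

/-- From here on, tilting objects are handled only through vanishing of extensions. -/
lemma isTilting_iff {V : R} :
    S.IsTilting ε V ↔ (S.stdData ε).leftOrth V ∧ (S.stdData ε).rightOrth V :=
  ⟨fun h ↦ ⟨leftOrth_of_filt hD h.1.filt, rightOrth_of_filt hD h.2.filt⟩,
    fun h ↦ ⟨hasFlag_of_leftOrth hD h.1, hasFlag_of_rightOrth hD h.2⟩⟩

omit hD

lemma hasTiltingStratum_of_stdBottom {b : B} (hb : ε (S.rho b) = .plus) {T : R}
    (h : (S.stdData ε).StdBottom b ((S.stdData ε).lt (S.rho b)) T) :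
    S.HasTiltingStratum ε b T := by
  obtain ⟨Z, i, p, hip, -, hZ⟩ := h
  have := hip.mono
  have := hip.epi
  refine (S.hasTiltingStratum_iff_of_plus ε hb).2 ⟨IrreducibleFamily.serre_of_ses hip
    ((S.stdData ε).std_le b) (StdData.le_of_lt hZ), i, fun k _ hk ↦ ?_, fun {Q} q _ hq ↦ ?_⟩
  · have hk0 : k = 0 := by rw [← cancel_mono i, hk, zero_comp]
    exact IrreducibleFamily.serre_of_isZero (IsZero.of_mono_eq_zero k hk0)
  · obtain ⟨g, hg⟩ := hip.desc q hq
    have : Epi g := epi_of_epi_fac hg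
    exact IrreducibleFamily.serre_of_epi g hZ

lemma hasTiltingStratum_of_costdTop {b : B} (hb : ε (S.rho b) = .minus) {T : R}
    (h : (S.stdData ε).CostdTop b ((S.stdData ε).lt (S.rho b)) T) :
    S.HasTiltingStratum ε b T := by
  obtain ⟨Z, i, p, hip, -, hZ⟩ := h
  have := hip.mono
  have := hip.epi
  refine (S.hasTiltingStratum_iff_of_minus ε hb).2 ⟨IrreducibleFamily.serre_of_ses hip
    (StdData.le_of_lt hZ) ((S.stdData ε).costd_le b), p, fun {K} k _ hk ↦ ?_, fun q _ hq ↦ ?_⟩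
  · obtain ⟨g, hg⟩ := hip.lift k hk
    have : Mono g := mono_of_mono_fac hg
    exact IrreducibleFamily.serre_of_mono g hZ
  · have hq0 : q = 0 := by rw [← cancel_epi p, hq, comp_zero]
    exact IrreducibleFamily.serre_of_isZero (IsZero.of_epi_eq_zero q hq0)

omit [AllFiniteLength R] in
lemma HasTiltingStratum.of_iso {b : B} {T U : R} (h : S.HasTiltingStratum ε b T) (e : T ≅ U) :
    S.HasTiltingStratum ε b U := by
  obtain ⟨h₁, h₂⟩ := h
  refine ⟨(S.leProp (S.rho b)).prop_of_iso e h₁, ?_⟩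
  let f : S.Le (S.rho b) := ⟨U, (S.leProp (S.rho b)).prop_of_iso e h₁⟩
  have a : (⟨T, h₁⟩ : S.Le (S.rho b)) ≅ f := (S.leProp (S.rho b)).isoMk e
  cases hb : ε (S.rho b) with
  | plus =>
    simp only [hb] at h₂ ⊢
    exact h₂.of_iso ((S.j (S.rho b)).mapIso a)
  | minus =>
    simp only [hb] at h₂ ⊢
    exact h₂.of_iso ((S.j (S.rho b)).mapIso a)

/-! ### Existence and uniqueness for a stratification -/

section

include hD

lemma exists_tilting (b : B) : ∃ T : R, Indecomposable T ∧ S.IsTilting ε T ∧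
    S.HasBottomStandard ε b T ∧ S.HasTopCostandard ε b T ∧ S.HasTiltingStratum ε b T := by
  cases hb : ε (S.rho b) with
  | plus =>
    obtain ⟨T, hT, hl, hr, ⟨Z, i, p, hip, hZ, hlt⟩, htop⟩ :=
      StdData.exists_tilting_of_plus hD (b := b) hb
    exact ⟨T, hT, (isTilting_iff hD).2 ⟨hl, hr⟩,
      (hasBottomStandard_iff hD).2 ⟨Z, i, p, hip, hZ, trivial⟩, (hasTopCostandard_iff hD).2 htop,
      hasTiltingStratum_of_stdBottom hb ⟨Z, i, p, hip, hZ, hlt⟩⟩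
  | minus =>
    have hb' : ¬ ε (S.rho b) = .plus := by simp [hb]
    obtain ⟨T, hT, hl, hr, hbot, ⟨Z, i, p, hip, hZ, hlt⟩⟩ :=
      StdData.exists_tilting_of_minus hD (b := b) hb'
    exact ⟨T, hT, (isTilting_iff hD).2 ⟨hl, hr⟩, (hasBottomStandard_iff hD).2 hbot,
      (hasTopCostandard_iff hD).2 ⟨Z, i, p, hip, hZ, trivial⟩,
      hasTiltingStratum_of_costdTop hb ⟨Z, i, p, hip, hZ, hlt⟩⟩

/-- The stratum condition is first converted into a Δ-flag starting with Δ(b) for sign +, or a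
∇-flag ending with ∇(b) for sign −; then the Fitting argument applies. -/
lemma tilting_unique {b : B} {T U : R} (hT : Indecomposable T) (hU : Indecomposable U)
    (hTt : S.IsTilting ε T) (hUt : S.IsTilting ε U) (hTb : S.HasBottomStandard ε b T)
    (hTc : S.HasTopCostandard ε b T) (h : S.HasBottomStandard ε b U ∨
      S.HasTopCostandard ε b U ∨ S.HasTiltingStratum ε b U) : Nonempty (U ≅ T) := by
  rw [isTilting_iff hD] at hTt hUt
  rw [hasBottomStandard_iff hD] at hTb h
  rw [hasTopCostandard_iff hD] at hTc h
  have h' : (S.stdData ε).StdBottom b (fun _ ↦ True) U ∨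
      (S.stdData ε).CostdTop b (fun _ ↦ True) U := by
    rcases h with h | h | h
    · exact Or.inl h
    · exact Or.inr h
    · cases hb : ε (S.rho b) with
      | plus =>
        obtain ⟨-, φ, h₁, h₂⟩ := (S.hasTiltingStratum_iff_of_plus ε hb).1 h
        exact Or.inl (StdData.stdBottom_of_isoMod hD hUt.1 φ h₁ h₂)
      | minus =>
        obtain ⟨-, φ, h₁, h₂⟩ := (S.hasTiltingStratum_iff_of_minus ε hb).1 h
        exact Or.inr (StdData.costdTop_of_isoMod hD hUt.2 φ h₁ h₂)
  rcases h' with h | h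
  · exact StdData.iso_of_stdBottom hD hT hU hTt.2 hUt.2 hTb h
  · exact StdData.iso_of_costdTop hD hT hU hTt.1 hUt.1 hTc h

end

end Stratification

end EpsStrat

theorem theorem3 {k : Type uk} [Field k] [IsAlgClosed k]
    {R : Type u} [Category.{v} R] [Abelian R] [Linear k R] [EssentiallySmall.{w} R]
    {B : Type uB} {Λ : Type uL} [PartialOrder Λ]
    (S : EpsStrat.Stratification R B Λ) (ε : Λ → EpsStrat.Sgn)
    (hR : S.IsFiniteEpsStratified ε k ∨
      EpsStrat.Stratification.IsLowerFiniteEpsStratified.{w} S ε k)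
    (b : B) :
    ∃ T : R, Indecomposable T ∧ S.IsTilting ε T ∧
      S.HasBottomStandard ε b T ∧ S.HasTopCostandard ε b T ∧ S.HasTiltingStratum ε b T ∧
      ∀ U : R, Indecomposable U → S.IsTilting ε U →
        (S.HasBottomStandard ε b U ∨ S.HasTopCostandard ε b U ∨ S.HasTiltingStratum ε b U) →
        Nonempty (U ≅ T) ∧
          S.HasBottomStandard ε b U ∧ S.HasTopCostandard ε b U ∧ S.HasTiltingStratum ε b U := by
  have hfl : EpsStrat.AllFiniteLength R := by
    rcases hR with h | h
    · exact h.finite_abelian.allFiniteLength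
    · exact ⟨h.locally_finite.noetherian, h.locally_finite.artinian⟩
  have hD : (S.stdData ε).IsStratified := by
    rcases hR with h | h
    · exact h.isStratified
    · exact h.isStratified
  obtain ⟨T, hT, hTt, hb, hc, hs⟩ := EpsStrat.Stratification.exists_tilting hD b
  refine ⟨T, hT, hTt, hb, hc, hs, fun U hU hUt h ↦ ?_⟩
  obtain ⟨e⟩ := EpsStrat.Stratification.tilting_unique hD hT hU hTt hUt hb hc h
  exact ⟨⟨e⟩, (EpsStrat.Stratification.hasBottomStandard_iff hD).2
      (((EpsStrat.Stratification.hasBottomStandard_iff hD).1 hb).of_iso e.symm),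
    (EpsStrat.Stratification.hasTopCostandard_iff hD).2
      (((EpsStrat.Stratification.hasTopCostandard_iff hD).1 hc).of_iso e.symm), hs.of_iso e.symm⟩
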